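/- Let $\Bbbk$ be an algebraically closed field of characteristic zero; $\otimes=\otimes_\Bbbk$, Sweedler notation is used for coproducts $h\mapsto h_1\otimes h_2$ and left coactions $v\mapsto v_{-1}\otimes v_0$, $*$ is the convolution product, and empty products are $1$ (the unit $\varepsilon_H$ for convolution). **Conventions.** A *dual quasi-bialgebra* $(H,\omega)$ is a coalgebra $H$ with coalgebra maps $m:H\otimes H\to H$ (unital, not necessarily associative) and $u:\Bbbk\to H$, and a convolution invertible $\omega:H^{\otimes 3}\to\Bbbk$ with $\omega(h\otimes 1\otimes l)=\varepsilon(h)\varepsilon(l)$, $(\varepsilon\otimes\omega)*\omega(H\otimes m\otimes H)*(\omega\otimes\varepsilon)=\omega(H\otimes H\otimes m)*\omega(m\otimes H\otimes H)$ and $m(H\otimes m)*u\omega=u\omega*m(m\otimes H)$. A *Yetter–Drinfeld module* over $(H,\omega)$ is a left $H$-comodule $V$ with a linear map $H\otimes V\to V$, $h\otimes v\mapsto h\vartriangleright v$, such that $1\vartriangleright v=v$, $(h_1\vartriangleright v)_{-1}h_2\otimes(h_1\vartriangleright v)_0=h_1v_{-1}\otimes(h_2\vartriangleright v_0)$ and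 $$(hl)\vartriangleright v=\omega^{-1}(h_1\otimes l_1\otimes v_{-1})\,\omega(h_2\otimes(l_2\vartriangleright v_0)_{-1}\otimes l_3)\,\omega^{-1}((h_3\vartriangleright(l_2\vartriangleright v_0)_0)_{-1}\otimes h_4\otimes l_4)\,(h_3\vartriangleright(l_2\vartriangleright v_0)_0)_0 .$$ They form a prebraided monoidal category ${}^H_H\mathcal{YD}$: the tensor product has the diagonal coaction and the action $$h\vartriangleright(v\otimes w)=\omega(h_1\otimes v_{-1}\otimes w_{-2})\,\omega^{-1}((h_2\vartriangleright v_0)_{-2}\otimes h_3\otimes w_{-1})\,\omega((h_2\vartriangleright v_0)_{-1}\otimes(h_4\vartriangleright w_0)_{-1}\otimes h_5)\,(h_2\vartriangleright v_0)_0\otimes(h_4\vartriangleright w_0)_0,$$ the associativity constraint is $(u\otimes v)\otimes w\mapsto\omega^{-1}(u_{-1}\otimes v_{-1}\otimes w_{-1})\,u_0\otimes(v_0\otimes w_0)$, the unit is $\Bbbk$ with trivial structures, and the prebraiding is $v\otimes w\mapsto(v_{-1}\vartriangleright w)\otimes v_0$. Bialgebras in ${}^H_H\mathcal{YD}$ are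 understood in this sense. A *quasi-YD datum* $((H,\omega),g,\chi)$ *for* $q$ consists of a group-like $g\in H$ and $\chi\in H^*$ with $\chi(1)=1$, $\chi(g)=q$ such that, for all $h,l\in H$, $g\,\chi(h_1)h_2=h_1\chi(h_2)\,g$ and $$\chi(hl)=\omega^{-1}(h_1\otimes l_1\otimes g)\chi(l_2)\,\omega(h_2\otimes g\otimes l_3)\chi(h_3)\,\omega^{-1}(g\otimes h_4\otimes l_4).$$ Put $$\chi_{[n]}=\Big[\prod^{*}_{0\le i\le n-1}\omega(-\otimes g\otimes g^{n-1-i})*\chi*\omega^{-1}(g\otimes-\otimes g^{n-1-i})\Big]*\Big[\prod^{*}_{0\le i\le n-1}\omega(g\otimes g^i\otimes-)\Big]$$ (factors in order of increasing $i$) and $\beta(i,n)=\binom{n}{i}_q\prod_{0\le j\le i-1}\omega(g\otimes g^j\otimes g^{n-i})$ for $0\le i\le n$, where $\binom{n}{i}_q$ is the Gaussian binomial coefficient (the Gaussian polynomial evaluated at $q$). **Theorem.** Let $((H,\omega),g,\chi)$ be a quasi-YD datum for $q$, where $q\ne1$ is a primitive $N$-th root of unity, $N>0$. (i) There is a bialgebra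 $R$ in ${}^H_H\mathcal{YD}$ with basis $(x^{[n]})_{0\le n\le N-1}$ such that, for all $0\le n,a,b\le N-1$ and $h\in H$: $\rho(x^{[n]})=g^n\otimes x^{[n]}$; $h\vartriangleright x^{[n]}=\chi_{[n]}(h)\,x^{[n]}$; $1_R=x^{[0]}$; $$m_R(x^{[a]}\otimes x^{[b]})=\Big[\prod_{0\le i\le a-1}\omega^{-1}(g\otimes g^i\otimes g^b)\Big]x^{[a+b]}\ \text{ if } a+b\le N-1,\ \text{ and } 0 \text{ otherwise};$$ $$\Delta_R(x^{[n]})=\sum_{0\le i\le n}\beta(i,n)\,x^{[i]}\otimes x^{[n-i]};\qquad \varepsilon_R(x^{[n]})=\delta_{n,0}.$$ (ii) Let $B=R\#H$ be the bosonization of this $R$ by $H$. As a coalgebra it is the vector space $R\otimes H$ with, writing $\Delta_R(r)=r^1\otimes r^2$, $$\Delta_B(r\otimes h)=\omega^{-1}(r^1_{-1}\otimes r^2_{-2}\otimes h_1)\,(r^1_0\otimes r^2_{-1}h_2)\otimes(r^2_0\otimes h_3),\qquad \varepsilon_B(r\otimes h)=\varepsilon_R(r)\varepsilon_H(h).$$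 Then $(B,\Delta_B,\varepsilon_B)$ is a coalgebra and its coradical $B_0$ (the sum of its simple subcoalgebras) satisfies $B_0\subseteq\Bbbk1_R\otimes H$. -/

import Mathlib

open TensorProduct Coalgebra

universe u v

noncomputable section

/-! ## Dual quasi-bialgebras

A coalgebra `H` with a (not necessarily associative) unital multiplication is encoded by the
instances `NonAssocRing H`, `Module k H`, `SMulCommClass k H H`, `IsScalarTower k H H` (a unital
`k`-algebra with bilinear, possibly non-associative, multiplication) and `Coalgebra k H`.
Triple tensor powers are bracketed as `(H ⊗ H) ⊗ H`; `WithConv (C →ₗ[k] A)` is the space of linear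
maps with Mathlib's convolution product `(f * g) c = f c₁ * g c₂`. -/

/-- A dual quasi-bialgebra `(H, Δ, ε, m, u, ω)`: multiplication and unit are coalgebra maps, and
`ω` is a convolution invertible normalized 3-cocycle that controls associativity. Unitality of
the multiplication is part of `NonAssocRing H`. -/
class DualQuasiBialgebra (k : Type u) (H : Type v) [Field k] [NonAssocRing H] [Module k H]
    [SMulCommClass k H H] [IsScalarTower k H H] [Coalgebra k H] where
  /-- `Δ (h l) = h₁ l₁ ⊗ h₂ l₂` -/
  comul_mul : comul ∘ₗ LinearMap.mul' k H =
    TensorProduct.map (LinearMap.mul' k H) (LinearMap.mul' k H) ∘ₗ comul (R := k) (A := H ⊗[k] H)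
  /-- `ε (h l) = ε h * ε l` -/
  counit_mul : counit ∘ₗ LinearMap.mul' k H = counit (R := k) (A := H ⊗[k] H)
  comul_one : comul (R := k) (1 : H) = 1 ⊗ₜ[k] 1
  counit_one : counit (R := k) (1 : H) = 1
  /-- The reassociator `ω`, an invertible element of the convolution algebra. -/
  reassociator : (WithConv (((H ⊗[k] H) ⊗[k] H) →ₗ[k] k))ˣ
  /-- `(ε ⊗ ω) * ω (H ⊗ m ⊗ H) * (ω ⊗ ε) = ω (H ⊗ H ⊗ m) * ω (m ⊗ H ⊗ H)` on
  `((H ⊗ H) ⊗ H) ⊗ H`. -/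
  cocycle :
    WithConv.toConv (reassociator.val.ofConv ∘ₗ LinearMap.rTensor H (LinearMap.rTensor H
        ((TensorProduct.lid k H).toLinearMap ∘ₗ LinearMap.rTensor H counit))) *
      WithConv.toConv (reassociator.val.ofConv ∘ₗ LinearMap.rTensor H
        (LinearMap.lTensor H (LinearMap.mul' k H) ∘ₗ (TensorProduct.assoc k H H H).toLinearMap)) *
      WithConv.toConv (LinearMap.mul' k k ∘ₗ TensorProduct.map reassociator.val.ofConv counit) =
    WithConv.toConv (reassociator.val.ofConv ∘ₗ
        LinearMap.lTensor (H ⊗[k] H) (LinearMap.mul' k H) ∘ₗ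
        (TensorProduct.assoc k (H ⊗[k] H) H H).toLinearMap) *
      WithConv.toConv (reassociator.val.ofConv ∘ₗ
        LinearMap.rTensor H (LinearMap.rTensor H (LinearMap.mul' k H)))
  /-- `ω (h ⊗ 1 ⊗ l) = ε h * ε l` -/
  normalized : ∀ h l : H, reassociator.val.ofConv ((h ⊗ₜ[k] 1) ⊗ₜ[k] l) =
    counit (R := k) h * counit (R := k) l
  /-- `m (H ⊗ m) * u ω = u ω * m (m ⊗ H)` in `Hom (H ⊗ H ⊗ H, H)`. -/
  quasi_assoc :
    WithConv.toConv (LinearMap.mul' k H ∘ₗ LinearMap.lTensor H (LinearMap.mul' k H) ∘ₗ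
        (TensorProduct.assoc k H H H).toLinearMap) *
      WithConv.toConv (LinearMap.toSpanSingleton k H 1 ∘ₗ reassociator.val.ofConv) =
    WithConv.toConv (LinearMap.toSpanSingleton k H 1 ∘ₗ reassociator.val.ofConv) *
      WithConv.toConv (LinearMap.mul' k H ∘ₗ LinearMap.rTensor H (LinearMap.mul' k H))

section Basic

variable (k : Type u) (H : Type v) [Field k] [NonAssocRing H] [Module k H]
  [SMulCommClass k H H] [IsScalarTower k H H] [Coalgebra k H] [DualQuasiBialgebra k H]

/-- The reassociator `ω` as a linear map. -/
def omega : ((H ⊗[k] H) ⊗[k] H) →ₗ[k] k :=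
  (DualQuasiBialgebra.reassociator (k := k) (H := H)).val.ofConv

/-- The convolution inverse `ω⁻¹` as a linear map. -/
def omegaInv : ((H ⊗[k] H) ⊗[k] H) →ₗ[k] k :=
  ((DualQuasiBialgebra.reassociator (k := k) (H := H))⁻¹).val.ofConv

end Basic

/-- Powers `g⁰ = 1`, `gⁿ⁺¹ = g gⁿ` (for group-like `g` the bracketing is irrelevant). -/
def grpPow {H : Type v} [NonAssocRing H] (g : H) : ℕ → H
  | 0 => 1
  | n + 1 => g * grpPow g n

/-! ## Coactions, associativity constraint, Yetter–Drinfeld modules -/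

section Coactions

variable {k : Type u} [Field k]
variable {A B C U V W : Type*} [AddCommMonoid A] [Module k A] [AddCommMonoid B] [Module k B]
  [AddCommMonoid C] [Module k C] [AddCommMonoid U] [Module k U] [AddCommMonoid V] [Module k V]
  [AddCommMonoid W] [Module k W]

/-- `u ⊗ v ↦ (u₋₁ ⊗ v₋₁) ⊗ (u₀ ⊗ v₀)`. -/
def coactPair (ρU : U →ₗ[k] A ⊗[k] U) (ρV : V →ₗ[k] B ⊗[k] V) :
    U ⊗[k] V →ₗ[k] (A ⊗[k] B) ⊗[k] (U ⊗[k] V) :=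
  (TensorProduct.tensorTensorTensorComm k A U B V).toLinearMap ∘ₗ TensorProduct.map ρU ρV

/-- `(u ⊗ v) ⊗ w ↦ φ (u₋₁ ⊗ v₋₁ ⊗ w₋₁) (u₀ ⊗ v₀) ⊗ w₀`. -/
def twist (φ : ((A ⊗[k] B) ⊗[k] C) →ₗ[k] k) (ρU : U →ₗ[k] A ⊗[k] U) (ρV : V →ₗ[k] B ⊗[k] V)
    (ρW : W →ₗ[k] C ⊗[k] W) : (U ⊗[k] V) ⊗[k] W →ₗ[k] (U ⊗[k] V) ⊗[k] W :=
  (TensorProduct.lid k ((U ⊗[k] V) ⊗[k] W)).toLinearMap ∘ₗ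
    LinearMap.rTensor ((U ⊗[k] V) ⊗[k] W) φ ∘ₗ coactPair (coactPair ρU ρV) ρW

/-- `u ⊗ w ↦ (u₋₁ ▷ w) ⊗ u₀`. For a Yetter–Drinfeld module `U` this is the prebraiding; for
`U = H` with coaction `Δ` it is `h ⊗ w ↦ (h₁ ▷ w) ⊗ h₂`. -/
def braid (ρU : U →ₗ[k] A ⊗[k] U) (actW : A ⊗[k] W →ₗ[k] W) : U ⊗[k] W →ₗ[k] W ⊗[k] U :=
  LinearMap.rTensor U actW ∘ₗ (TensorProduct.rightComm k A U W).toLinearMap ∘ₗ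
    LinearMap.rTensor W ρU

end Coactions

section YetterDrinfeld

variable {k : Type u} {H : Type v} [Field k] [NonAssocRing H] [Module k H]
  [SMulCommClass k H H] [IsScalarTower k H H] [Coalgebra k H]
variable {U V W : Type*} [AddCommGroup U] [Module k U] [AddCommGroup V] [Module k V]
  [AddCommGroup W] [Module k W]

/-- Diagonal coaction `v ⊗ w ↦ v₋₁ w₋₁ ⊗ (v₀ ⊗ w₀)`. -/
def tensorCoact (ρV : V →ₗ[k] H ⊗[k] V) (ρW : W →ₗ[k] H ⊗[k] W) :
    V ⊗[k] W →ₗ[k] H ⊗[k] (V ⊗[k] W) :=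
  LinearMap.rTensor (V ⊗[k] W) (LinearMap.mul' k H) ∘ₗ coactPair ρV ρW

variable [DualQuasiBialgebra k H]

/-- Associativity constraint
`(u ⊗ v) ⊗ w ↦ ω⁻¹ (u₋₁ ⊗ v₋₁ ⊗ w₋₁) u₀ ⊗ (v₀ ⊗ w₀)`. -/
def assocYD (ρU : U →ₗ[k] H ⊗[k] U) (ρV : V →ₗ[k] H ⊗[k] V) (ρW : W →ₗ[k] H ⊗[k] W) :
    (U ⊗[k] V) ⊗[k] W →ₗ[k] U ⊗[k] (V ⊗[k] W) :=
  (TensorProduct.assoc k U V W).toLinearMap ∘ₗ twist (omegaInv k H) ρU ρV ρW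

/-- Inverse associativity constraint
`u ⊗ (v ⊗ w) ↦ ω (u₋₁ ⊗ v₋₁ ⊗ w₋₁) (u₀ ⊗ v₀) ⊗ w₀`. -/
def assocInvYD (ρU : U →ₗ[k] H ⊗[k] U) (ρV : V →ₗ[k] H ⊗[k] V) (ρW : W →ₗ[k] H ⊗[k] W) :
    U ⊗[k] (V ⊗[k] W) →ₗ[k] (U ⊗[k] V) ⊗[k] W :=
  twist (omega k H) ρU ρV ρW ∘ₗ (TensorProduct.assoc k U V W).symm.toLinearMap

/-- The action of `H` on the tensor product of Yetter–Drinfeld modules: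
`h ▷ (v ⊗ w) = ω (h₁ ⊗ v₋₁ ⊗ w₋₂) ω⁻¹ ((h₂ ▷ v₀)₋₂ ⊗ h₃ ⊗ w₋₁)
  ω ((h₂ ▷ v₀)₋₁ ⊗ (h₄ ▷ w₀)₋₁ ⊗ h₅) (h₂ ▷ v₀)₀ ⊗ (h₄ ▷ w₀)₀`. -/
def tensorAct (ρV : V →ₗ[k] H ⊗[k] V) (actV : H ⊗[k] V →ₗ[k] V)
    (ρW : W →ₗ[k] H ⊗[k] W) (actW : H ⊗[k] W →ₗ[k] W) :
    H ⊗[k] (V ⊗[k] W) →ₗ[k] V ⊗[k] W :=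
  (TensorProduct.rid k (V ⊗[k] W)).toLinearMap ∘ₗ LinearMap.lTensor (V ⊗[k] W) counit ∘ₗ
    assocInvYD ρV ρW comul ∘ₗ LinearMap.lTensor V (braid comul actW) ∘ₗ
    assocYD ρV comul ρW ∘ₗ LinearMap.rTensor W (braid comul actV) ∘ₗ
    assocInvYD comul ρV ρW

/-- A (left-left) Yetter–Drinfeld module structure on `V` over the dual quasi-bialgebra `H`. -/
structure YDModule (k : Type u) (H : Type v) (V : Type*) [Field k] [NonAssocRing H] [Module k H]
    [SMulCommClass k H H] [IsScalarTower k H H] [Coalgebra k H] [DualQuasiBialgebra k H]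
    [AddCommGroup V] [Module k V] where
  /-- coaction `v ↦ v₋₁ ⊗ v₀` -/
  coact : V →ₗ[k] H ⊗[k] V
  /-- action `h ⊗ v ↦ h ▷ v` -/
  act : H ⊗[k] V →ₗ[k] V
  coact_coassoc : (TensorProduct.assoc k H H V).toLinearMap ∘ₗ LinearMap.rTensor V comul ∘ₗ coact =
    LinearMap.lTensor H coact ∘ₗ coact
  coact_counit : (TensorProduct.lid k V).toLinearMap ∘ₗ LinearMap.rTensor V counit ∘ₗ coact =
    LinearMap.id
  /-- `(h l) ▷ v = ω⁻¹ (h₁ ⊗ l₁ ⊗ v₋₁) ω (h₂ ⊗ (l₂ ▷ v₀)₋₁ ⊗ l₃)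
    ω⁻¹ ((h₃ ▷ (l₂ ▷ v₀)₀)₋₁ ⊗ h₄ ⊗ l₄) (h₃ ▷ (l₂ ▷ v₀)₀)₀` -/
  mul_act : act ∘ₗ LinearMap.rTensor V (LinearMap.mul' k H) =
    (TensorProduct.rid k V).toLinearMap ∘ₗ LinearMap.lTensor V counit ∘ₗ
      assocYD coact comul comul ∘ₗ LinearMap.rTensor H (braid comul act) ∘ₗ
      assocInvYD comul coact comul ∘ₗ LinearMap.lTensor H (braid comul act) ∘ₗ
      assocYD comul comul coact
  one_act : ∀ v : V, act (1 ⊗ₜ[k] v) = v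
  /-- `(h₁ ▷ v)₋₁ h₂ ⊗ (h₁ ▷ v)₀ = h₁ v₋₁ ⊗ (h₂ ▷ v₀)` -/
  compat : LinearMap.rTensor V (LinearMap.mul' k H) ∘ₗ
      (TensorProduct.rightComm k H V H).toLinearMap ∘ₗ LinearMap.rTensor H coact ∘ₗ
      braid comul act =
    TensorProduct.map (LinearMap.mul' k H) act ∘ₗ coactPair comul coact

/-- The middle-four interchange `Ω_V : (V ⊗ V) ⊗ (V ⊗ V) → (V ⊗ V) ⊗ (V ⊗ V)`,
`Ω = a⁻¹_{V,V,V⊗V} (V ⊗ a_{V,V,V}) (V ⊗ (c ⊗ V)) (V ⊗ a⁻¹_{V,V,V}) a_{V,V,V⊗V}`. -/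
def interchange (ρ : V →ₗ[k] H ⊗[k] V) (act : H ⊗[k] V →ₗ[k] V) :
    (V ⊗[k] V) ⊗[k] (V ⊗[k] V) →ₗ[k] (V ⊗[k] V) ⊗[k] (V ⊗[k] V) :=
  assocInvYD ρ ρ (tensorCoact ρ ρ) ∘ₗ LinearMap.lTensor V (assocYD ρ ρ ρ) ∘ₗ
    LinearMap.lTensor V (LinearMap.rTensor V (braid ρ act)) ∘ₗ
    LinearMap.lTensor V (assocInvYD ρ ρ ρ) ∘ₗ assocYD ρ ρ (tensorCoact ρ ρ)

/-- A bialgebra in the prebraided monoidal category of Yetter–Drinfeld modules over `H`: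
an algebra and a coalgebra in this category (so all four structure maps are `H`-linear and
`H`-colinear, with associativity up to the constraint) such that comultiplication and counit are
algebra maps. -/
structure YDBialgebra (k : Type u) (H : Type v) (R : Type*) [Field k] [NonAssocRing H] [Module k H]
    [SMulCommClass k H H] [IsScalarTower k H H] [Coalgebra k H] [DualQuasiBialgebra k H]
    [AddCommGroup R] [Module k R] extends YDModule k H R where
  mul : R ⊗[k] R →ₗ[k] R
  one : R
  Δ : R →ₗ[k] R ⊗[k] R
  ε : R →ₗ[k] k
  -- the structure maps are morphisms of Yetter–Drinfeld modules
  mul_coact : LinearMap.lTensor H mul ∘ₗ tensorCoact coact coact = coact ∘ₗ mul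
  mul_act_linear : mul ∘ₗ tensorAct coact act coact act = act ∘ₗ LinearMap.lTensor H mul
  one_coact : coact one = 1 ⊗ₜ[k] one
  one_act_linear : ∀ h : H, act (h ⊗ₜ[k] one) = counit (R := k) h • one
  Δ_coact : LinearMap.lTensor H Δ ∘ₗ coact = tensorCoact coact coact ∘ₗ Δ
  Δ_act_linear : Δ ∘ₗ act = tensorAct coact act coact act ∘ₗ LinearMap.lTensor H Δ
  ε_coact : ∀ r : R, TensorProduct.rid k H (LinearMap.lTensor H ε (coact r)) = ε r • (1 : H)
  ε_act_linear : ∀ (h : H) (r : R), ε (act (h ⊗ₜ[k] r)) = counit (R := k) h * ε r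
  -- algebra
  mul_assoc : mul ∘ₗ LinearMap.rTensor R mul =
    mul ∘ₗ LinearMap.lTensor R mul ∘ₗ assocYD coact coact coact
  one_mul : ∀ r : R, mul (one ⊗ₜ[k] r) = r
  mul_one : ∀ r : R, mul (r ⊗ₜ[k] one) = r
  -- coalgebra
  Δ_coassoc : assocYD coact coact coact ∘ₗ LinearMap.rTensor R Δ ∘ₗ Δ = LinearMap.lTensor R Δ ∘ₗ Δ
  ε_Δ : (TensorProduct.lid k R).toLinearMap ∘ₗ LinearMap.rTensor R ε ∘ₗ Δ = LinearMap.id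
  Δ_ε : (TensorProduct.rid k R).toLinearMap ∘ₗ LinearMap.lTensor R ε ∘ₗ Δ = LinearMap.id
  -- compatibility
  Δ_mul : Δ ∘ₗ mul = TensorProduct.map mul mul ∘ₗ interchange coact act ∘ₗ TensorProduct.map Δ Δ
  Δ_one : Δ one = one ⊗ₜ[k] one
  ε_mul : ∀ r s : R, ε (mul (r ⊗ₜ[k] s)) = ε r * ε s
  ε_one : ε one = 1

end YetterDrinfeld

/-! ## Bosonization and coradical -/

/-- The structure maps of a (candidate) dual quasi-bialgebra on `B`. -/
structure DualQuasiBialgebraMaps (k : Type u) (B : Type*) [Field k] [AddCommGroup B]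
    [Module k B] where
  mul : B ⊗[k] B →ₗ[k] B
  one : B
  comul : B →ₗ[k] B ⊗[k] B
  counit : B →ₗ[k] k
  reassociator : ((B ⊗[k] B) ⊗[k] B) →ₗ[k] k

section Bosonization

variable {k : Type u} {H : Type v} [Field k] [NonAssocRing H] [Module k H]
  [SMulCommClass k H H] [IsScalarTower k H H] [Coalgebra k H] [DualQuasiBialgebra k H]
variable {R : Type*} [AddCommGroup R] [Module k R]

/-- The multiplication of `R # H`:
`(r ⊗ h)(s ⊗ l) = ω⁻¹ (r₋₂ ⊗ h₁ ⊗ s₋₂ l₁) ω (h₂ ⊗ s₋₁ ⊗ l₂) ω⁻¹ ((h₃ ▷ s₀)₋₂ ⊗ h₄ ⊗ l₃)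
  ω (r₋₁ ⊗ (h₃ ▷ s₀)₋₁ ⊗ h₅ l₄) r₀ (h₃ ▷ s₀)₀ ⊗ h₆ l₅`. -/
def bosonMul (S : YDBialgebra k H R) : (R ⊗[k] H) ⊗[k] (R ⊗[k] H) →ₗ[k] R ⊗[k] H :=
  TensorProduct.map S.mul (LinearMap.mul' k H) ∘ₗ
    assocInvYD S.coact S.coact (tensorCoact comul comul) ∘ₗ
    LinearMap.lTensor R (assocYD S.coact comul comul) ∘ₗ
    LinearMap.lTensor R (LinearMap.rTensor H (braid comul S.act)) ∘ₗ
    LinearMap.lTensor R (assocInvYD comul S.coact comul) ∘ₗ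
    assocYD S.coact comul (tensorCoact S.coact comul)

/-- The comultiplication of `R # H`, with `Δ_R r = r¹ ⊗ r²`:
`Δ (r ⊗ h) = ω⁻¹ (r¹₋₁ ⊗ r²₋₂ ⊗ h₁) (r¹₀ ⊗ r²₋₁ h₂) ⊗ (r²₀ ⊗ h₃)`. -/
def bosonComul (S : YDBialgebra k H R) : R ⊗[k] H →ₗ[k] (R ⊗[k] H) ⊗[k] (R ⊗[k] H) :=
  (TensorProduct.assoc k R H (R ⊗[k] H)).symm.toLinearMap ∘ₗ
    LinearMap.lTensor R (tensorCoact S.coact comul) ∘ₗ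
    assocYD S.coact S.coact comul ∘ₗ LinearMap.rTensor H S.Δ

/-- The projection `R # H → H`, `r ⊗ h ↦ ε_R r • h`. -/
def bosonProj (S : YDBialgebra k H R) : R ⊗[k] H →ₗ[k] H :=
  (TensorProduct.lid k H).toLinearMap ∘ₗ LinearMap.rTensor H S.ε

/-- The bosonization `R # H`, on the vector space `R ⊗ H`. -/
def bosonization (S : YDBialgebra k H R) : DualQuasiBialgebraMaps k (R ⊗[k] H) where
  mul := bosonMul S
  one := S.one ⊗ₜ[k] 1
  comul := bosonComul S
  counit := counit ∘ₗ bosonProj S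
  reassociator := omega k H ∘ₗ
    TensorProduct.map (TensorProduct.map (bosonProj S) (bosonProj S)) (bosonProj S)

end Bosonization

section Coradical

variable (k : Type u) (C : Type*) [Field k] [AddCommGroup C] [Module k C] [Coalgebra k C]

/-- `Δ D ⊆ D ⊗ D`. -/
def IsSubcoalgebra (D : Submodule k C) : Prop :=
  ∀ d ∈ D, comul (R := k) d ∈ LinearMap.range (TensorProduct.map D.subtype D.subtype)

/-- A nonzero subcoalgebra whose only subcoalgebras are `0` and itself. -/
def IsSimpleSubcoalgebra (D : Submodule k C) : Prop :=
  IsSubcoalgebra k C D ∧ D ≠ ⊥ ∧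
    ∀ E : Submodule k C, IsSubcoalgebra k C E → E ≤ D → E = ⊥ ∨ E = D

/-- The coradical `C₀`: the sum of all simple subcoalgebras. -/
def coradical : Submodule k C := sSup {D | IsSimpleSubcoalgebra k C D}

end Coradical

/-! ## Quasi-Yetter–Drinfeld data and the coefficients of the quantum line -/

section QuasiYD

variable {k : Type u} {H : Type v} [Field k] [NonAssocRing H] [Module k H]
  [SMulCommClass k H H] [IsScalarTower k H H] [Coalgebra k H] [DualQuasiBialgebra k H]

/-- `((H, ω), g, χ)` is a quasi-Yetter–Drinfeld datum. -/
structure IsQuasiYDDatum (g : H) (χ : H →ₗ[k] k) : Prop where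
  groupLike : IsGroupLikeElem k g
  unitary : χ 1 = 1
  /-- `χ (h l) = ω⁻¹ (h₁ ⊗ l₁ ⊗ g) χ (l₂) ω (h₂ ⊗ g ⊗ l₃) χ (h₃) ω⁻¹ (g ⊗ h₄ ⊗ l₄)`, as an identity
  in the convolution algebra of `H ⊗ H`. -/
  chi_mul : WithConv.toConv (χ ∘ₗ LinearMap.mul' k H) =
    WithConv.toConv (omegaInv k H ∘ₗ (TensorProduct.mk k (H ⊗[k] H) H).flip g) *
      WithConv.toConv (LinearMap.mul' k k ∘ₗ TensorProduct.map counit χ) *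
      WithConv.toConv (omega k H ∘ₗ LinearMap.rTensor H ((TensorProduct.mk k H H).flip g)) *
      WithConv.toConv (LinearMap.mul' k k ∘ₗ TensorProduct.map χ counit) *
      WithConv.toConv (omegaInv k H ∘ₗ LinearMap.rTensor H (TensorProduct.mk k H H g))
  /-- `g (χ (h₁) h₂) = (h₁ χ (h₂)) g` -/
  chi_comm : ∀ h : H,
    g * TensorProduct.lid k H (LinearMap.rTensor H χ (comul h)) =
      TensorProduct.rid k H (LinearMap.lTensor H χ (comul h)) * g

/-- `φ (- ⊗ a ⊗ b)` as an element of the convolution algebra of `H`. -/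
def sliceLeft (φ : ((H ⊗[k] H) ⊗[k] H) →ₗ[k] k) (a b : H) : WithConv (H →ₗ[k] k) :=
  WithConv.toConv (φ ∘ₗ (TensorProduct.mk k (H ⊗[k] H) H).flip b ∘ₗ (TensorProduct.mk k H H).flip a)

/-- `φ (a ⊗ - ⊗ b)` as an element of the convolution algebra of `H`. -/
def sliceMid (φ : ((H ⊗[k] H) ⊗[k] H) →ₗ[k] k) (a b : H) : WithConv (H →ₗ[k] k) :=
  WithConv.toConv (φ ∘ₗ (TensorProduct.mk k (H ⊗[k] H) H).flip b ∘ₗ TensorProduct.mk k H H a)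

/-- `φ (a ⊗ b ⊗ -)` as an element of the convolution algebra of `H`. -/
def sliceRight (φ : ((H ⊗[k] H) ⊗[k] H) →ₗ[k] k) (a b : H) : WithConv (H →ₗ[k] k) :=
  WithConv.toConv (φ ∘ₗ TensorProduct.mk k (H ⊗[k] H) H (a ⊗ₜ[k] b))

/-- The functional `χ_[n]`: the convolution product
`(∏_{0 ≤ i ≤ n-1} ω (- ⊗ g ⊗ gⁿ⁻¹⁻ⁱ) * χ * ω⁻¹ (g ⊗ - ⊗ gⁿ⁻¹⁻ⁱ)) * (∏_{0 ≤ i ≤ n-1} ω (g ⊗ gⁱ ⊗ -))`,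
factors ordered by increasing `i`; in particular `χ_[0] = ε`. -/
def chiN (g : H) (χ : H →ₗ[k] k) (n : ℕ) : H →ₗ[k] k :=
  (((List.range n).map fun i =>
      sliceLeft (omega k H) g (grpPow g (n - 1 - i)) * WithConv.toConv χ *
        sliceMid (omegaInv k H) g (grpPow g (n - 1 - i))).prod *
    ((List.range n).map fun i => sliceRight (omega k H) g (grpPow g i)).prod).ofConv

/-- The Gaussian binomial coefficient `binom(n, i)_q`, by the `q`-Pascal rule. -/
def qBinom (q : k) : ℕ → ℕ → k
  | _, 0 => 1
  | 0, _ + 1 => 0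
  | n + 1, i + 1 => qBinom q n i + q ^ (i + 1) * qBinom q n (i + 1)

/-- `β (i, n) = binom(n, i)_q ∏_{0 ≤ j ≤ i-1} ω (g ⊗ gʲ ⊗ gⁿ⁻ⁱ)`, for `0 ≤ i ≤ n`. -/
def beta (g : H) (q : k) (i n : ℕ) : k :=
  qBinom q n i * ∏ j ∈ Finset.range i, omega k H ((g ⊗ₜ[k] grpPow g j) ⊗ₜ[k] grpPow g (n - i))

end QuasiYD

end

/-!
A quasi-Yetter–Drinfeld datum `(g, χ)` is the same thing as a one-dimensional Yetter–Drinfeld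
module. The tensor product of two such modules is again one-dimensional, and the associativity
constraint shows that its character does not depend on bracketing (`tensorChar_assoc`); the
functionals `χ_[n]` are the characters of the tensor powers (`powChar_eq_chiN`). So the coaction
and the action prescribed on `x^[n]` form a Yetter–Drinfeld module.

On vectors homogeneous for powers of `g`, every structure map of the category multiplies by a
scalar. The restriction of `ω` to powers of `g`, indexed by `ℕ`, is the coboundary of
`f (a, b) = ∏_{i < a} ω (g ⊗ gⁱ ⊗ gᵇ)` (`powOmega_eq`), and the braiding of `x^[a]` with `x^[b]` is
`q ^ (a b) f (b, a) / f (a, b)` (`powChar_powGL`). Hence rescaling by `f` turns the asserted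
bialgebra axioms into those of the ordinary quantum line `k[x] / (x^N)`: coassociativity is
`sum_qBinom_assoc`, multiplicativity of the comultiplication is the `q`-Vandermonde identity
`sum_qBinom_add`, and the truncation at `N` is consistent because the Gaussian binomial
coefficients `binom(a + b, a)_q` with `a, b < N ≤ a + b` vanish at a primitive `N`-th root of unity
(`qBinom_eq_zero`).

In the bosonization, `Δ (x^[n] ⊗ h)` is a linear combination of the terms
`ω⁻¹ (gⁱ ⊗ gʲ ⊗ h₁) (x^[i] ⊗ gʲ h₂) ⊗ (x^[j] ⊗ h₃)` (`bosonComul_apply`). Coassociativity again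
reduces to `sum_qBinom_assoc`, because quasi-associativity and the pentagon move all factors `ω⁻¹`
to `h₁` (`mulComul_right`, `omR_inv_mul_pull`). For the coradical, let `D` be a nonzero subcoalgebra
and let `∑ x^[n] ⊗ h n` be a nonzero element of `D` of degree `m`. Contracting the first leg of its
comultiplication with `ξ ⊗ ε`, where `ξ` is dual to `x^[m]`, gives the nonzero element `1 ⊗ h m` of
`D ⊓ (k 1 ⊗ H)`. So a simple subcoalgebra lies in the subcoalgebra `k 1 ⊗ H`.
-/

noncomputable section

set_option linter.unusedSectionVars false
set_option linter.unusedSimpArgs false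

namespace QuantumLine

open WithConv

/-! ### Convolution with functionals on a coalgebra -/

section Convolution

variable {k : Type u} [Field k] {C D E : Type*} [AddCommMonoid C] [Module k C] [Coalgebra k C]
  [AddCommMonoid D] [Module k D] [Coalgebra k D] [AddCommMonoid E] [Module k E] [Coalgebra k E]

/-- Pulling functionals back along a coalgebra map is a homomorphism of convolution algebras. -/
def pull (θ : C →ₗc[k] D) : WithConv (D →ₗ[k] k) →* WithConv (C →ₗ[k] k) where
  toFun φ := toConv (φ.ofConv ∘ₗ θ.toLinearMap)
  map_one' := by
    ext c
    exact CoalgHomClass.counit_comp_apply θ c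
  map_mul' φ ψ := congrArg toConv (LinearMap.convMul_comp_coalgHom_distrib φ ψ θ)

@[simp] lemma pull_apply (θ : C →ₗc[k] D) (φ : WithConv (D →ₗ[k] k)) (c : C) :
    pull θ φ c = φ (θ c) := rfl

/-- The operator `c ↦ φ (c₁) c₂`. -/
def hitL (φ : WithConv (C →ₗ[k] k)) : C →ₗ[k] C :=
  (TensorProduct.lid k C).toLinearMap ∘ₗ LinearMap.rTensor C φ.ofConv ∘ₗ comul

/-- The operator `c ↦ c₁ φ (c₂)`. -/
def hitR (φ : WithConv (C →ₗ[k] k)) : C →ₗ[k] C :=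
  (TensorProduct.rid k C).toLinearMap ∘ₗ LinearMap.lTensor C φ.ofConv ∘ₗ comul

lemma mul_eq_comp_hitL (φ ψ : WithConv (C →ₗ[k] k)) : (φ * ψ).ofConv = ψ.ofConv ∘ₗ hitL φ := by
  ext c
  simp only [LinearMap.convMul_apply, hitL, LinearMap.comp_apply]
  induction (comul c : C ⊗[k] C) using TensorProduct.induction_on with
  | zero => simp
  | tmul x y => simp
  | add x y hx hy => simp only [map_add, hx, hy]

lemma mul_eq_comp_hitR (φ ψ : WithConv (C →ₗ[k] k)) : (φ * ψ).ofConv = φ.ofConv ∘ₗ hitR ψ := by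
  ext c
  simp only [LinearMap.convMul_apply, hitR, LinearMap.comp_apply]
  induction (comul c : C ⊗[k] C) using TensorProduct.induction_on with
  | zero => simp
  | tmul x y => simp [mul_comm]
  | add x y hx hy => simp only [map_add, hx, hy]

lemma counit_comp_hitL (φ : WithConv (C →ₗ[k] k)) : counit ∘ₗ hitL φ = φ.ofConv :=
  (mul_eq_comp_hitL φ 1).symm.trans (by rw [mul_one])

lemma counit_hitL (φ : WithConv (C →ₗ[k] k)) (c : C) : counit (R := k) (hitL φ c) = φ c :=
  LinearMap.congr_fun (counit_comp_hitL φ) c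

@[simp] lemma hitL_one : hitL (1 : WithConv (C →ₗ[k] k)) = LinearMap.id := by
  ext c
  have : LinearMap.rTensor C (1 : WithConv (C →ₗ[k] k)).ofConv (comul c) = 1 ⊗ₜ[k] c :=
    rTensor_counit_comul c
  simp [hitL, this]

/-- Coassociativity: `c₁ ⊗ φ (c₂) c₃` computed in two ways. -/
lemma rTensor_hitR_comul (φ : WithConv (C →ₗ[k] k)) :
    LinearMap.rTensor C (hitR φ) ∘ₗ comul = LinearMap.lTensor C (hitL φ) ∘ₗ comul := by
  ext c
  have h := congrArg (LinearMap.lTensor C ((TensorProduct.lid k C).toLinearMap ∘ₗ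
    LinearMap.rTensor C φ.ofConv)) (coassoc_apply (R := k) c)
  have h2 : ∀ t : C ⊗[k] C, LinearMap.rTensor C (hitR φ) t =
      LinearMap.lTensor C ((TensorProduct.lid k C).toLinearMap ∘ₗ LinearMap.rTensor C φ.ofConv)
        ((TensorProduct.assoc k C C C) (LinearMap.rTensor C comul t)) := by
    intro t
    induction t using TensorProduct.induction_on with
    | zero => simp
    | add x y hx hy => simp only [map_add, hx, hy]
    | tmul x y =>
      simp only [LinearMap.rTensor_tmul, hitR, LinearMap.comp_apply]
      induction (comul x : C ⊗[k] C) using TensorProduct.induction_on with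
      | zero => simp
      | tmul a b => simp [TensorProduct.smul_tmul]
      | add x y hx hy => simp only [map_add, add_tmul, hx, hy]
  rw [LinearMap.comp_apply, h2, h, LinearMap.comp_apply, ← LinearMap.comp_apply,
    ← LinearMap.lTensor_comp]
  rfl

/-- `hitL φ` is a map of right comodules: it acts on the first leg of the comultiplication. -/
lemma comul_comp_hitL (φ : WithConv (C →ₗ[k] k)) :
    comul ∘ₗ hitL φ = LinearMap.rTensor C (hitL φ) ∘ₗ comul := by
  ext c
  have h := congrArg ((TensorProduct.lid k _).toLinearMap ∘ₗ LinearMap.rTensor _ φ.ofConv)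
    (coassoc_apply (R := k) c)
  have h1 : ∀ t : C ⊗[k] C, ((TensorProduct.lid k _).toLinearMap ∘ₗ LinearMap.rTensor _ φ.ofConv)
        (LinearMap.lTensor C comul t) =
      comul (R := k) (TensorProduct.lid k C (LinearMap.rTensor C φ.ofConv t)) := by
    intro t
    induction t using TensorProduct.induction_on with
    | zero => simp
    | add x y hx hy => simp only [map_add, hx, hy]
    | tmul x y => simp
  have h2 : ∀ t : C ⊗[k] C, LinearMap.rTensor C (hitL φ) t =
      ((TensorProduct.lid k _).toLinearMap ∘ₗ LinearMap.rTensor _ φ.ofConv)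
        ((TensorProduct.assoc k C C C) (LinearMap.rTensor C comul t)) := by
    intro t
    induction t using TensorProduct.induction_on with
    | zero => simp
    | add x y hx hy => simp only [map_add, hx, hy]
    | tmul x y =>
      simp only [LinearMap.rTensor_tmul, hitL, LinearMap.comp_apply]
      induction (comul x : C ⊗[k] C) using TensorProduct.induction_on with
      | zero => simp
      | tmul a b => simp [TensorProduct.smul_tmul']
      | add x y hx hy => simp only [map_add, add_tmul, hx, hy]
  rw [LinearMap.comp_apply (LinearMap.rTensor C (hitL φ)), h2, h, h1]
  rfl

lemma comul_comp_hitR (φ : WithConv (C →ₗ[k] k)) :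
    comul ∘ₗ hitR φ = LinearMap.lTensor C (hitR φ) ∘ₗ comul := by
  ext c
  have h := congrArg ((TensorProduct.rid k _).toLinearMap ∘ₗ LinearMap.lTensor _ φ.ofConv)
    (coassoc_symm_apply (R := k) c)
  have h1 : ∀ t : C ⊗[k] C, ((TensorProduct.rid k _).toLinearMap ∘ₗ LinearMap.lTensor _ φ.ofConv)
        (LinearMap.rTensor C comul t) =
      comul (R := k) (TensorProduct.rid k C (LinearMap.lTensor C φ.ofConv t)) := by
    intro t
    induction t using TensorProduct.induction_on with
    | zero => simp
    | add x y hx hy => simp only [map_add, hx, hy]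
    | tmul x y => simp
  have h2 : ∀ t : C ⊗[k] C, LinearMap.lTensor C (hitR φ) t =
      ((TensorProduct.rid k _).toLinearMap ∘ₗ LinearMap.lTensor _ φ.ofConv)
        ((TensorProduct.assoc k C C C).symm (LinearMap.lTensor C comul t)) := by
    intro t
    induction t using TensorProduct.induction_on with
    | zero => simp
    | add x y hx hy => simp only [map_add, hx, hy]
    | tmul x y =>
      simp only [LinearMap.lTensor_tmul, hitR, LinearMap.comp_apply]
      induction (comul y : C ⊗[k] C) using TensorProduct.induction_on with
      | zero => simp
      | tmul a b => simp
      | add x y hx hy => simp only [map_add, tmul_add, hx, hy]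
  rw [LinearMap.comp_apply (LinearMap.lTensor C (hitR φ)), h2, h, h1]
  rfl

/-- The left-to-right order of the convolution product is the order of application of the
operators `hitL`, so `hitL` is an antihomomorphism. -/
lemma hitL_mul (φ ψ : WithConv (C →ₗ[k] k)) : hitL (φ * ψ) = hitL ψ ∘ₗ hitL φ := by
  have h : ∀ t : C ⊗[k] C, LinearMap.rTensor C (ψ.ofConv ∘ₗ hitL φ) t =
      LinearMap.rTensor C ψ.ofConv (LinearMap.rTensor C (hitL φ) t) := fun t => by
    rw [LinearMap.rTensor_comp]; rfl
  ext c
  simp only [LinearMap.comp_apply, hitL.eq_def (φ * ψ), mul_eq_comp_hitL, h]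
  rw [← LinearMap.comp_apply (LinearMap.rTensor C (hitL φ)), ← comul_comp_hitL]
  rfl

lemma hitL_hitL (φ ψ : WithConv (C →ₗ[k] k)) (c : C) : hitL ψ (hitL φ c) = hitL (φ * ψ) c :=
  (LinearMap.congr_fun (hitL_mul φ ψ) c).symm

@[simp] lemma hitR_one : hitR (1 : WithConv (C →ₗ[k] k)) = LinearMap.id := by
  ext c
  have : LinearMap.lTensor C (1 : WithConv (C →ₗ[k] k)).ofConv (comul c) = c ⊗ₜ[k] 1 :=
    lTensor_counit_comul c
  simp [hitR, this]

lemma hitL_comp_hitR (φ ψ : WithConv (C →ₗ[k] k)) : hitL φ ∘ₗ hitR ψ = hitR ψ ∘ₗ hitL φ := by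
  have h : ∀ t : C ⊗[k] C, LinearMap.rTensor C φ.ofConv (LinearMap.lTensor C (hitR ψ) t) =
      LinearMap.lTensor k (hitR ψ) (LinearMap.rTensor C φ.ofConv t) := fun t => by
    rw [← LinearMap.comp_apply, ← LinearMap.comp_apply, LinearMap.rTensor_comp_lTensor,
      LinearMap.lTensor_comp_rTensor]
  ext c
  have e : comul (R := k) (hitR ψ c) = LinearMap.lTensor C (hitR ψ) (comul c) :=
    LinearMap.congr_fun (comul_comp_hitR ψ) c
  simp only [LinearMap.comp_apply, hitL.eq_def φ, e, h]
  induction LinearMap.rTensor C φ.ofConv (comul c) using TensorProduct.induction_on with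
  | zero => simp
  | tmul x y => simp
  | add x y hx hy => simp only [map_add, hx, hy]

lemma hitR_mul (φ ψ : WithConv (C →ₗ[k] k)) : hitR (φ * ψ) = hitR φ ∘ₗ hitR ψ := by
  have h : ∀ t : C ⊗[k] C, LinearMap.lTensor C (φ.ofConv ∘ₗ hitR ψ) t =
      LinearMap.lTensor C φ.ofConv (LinearMap.lTensor C (hitR ψ) t) := fun t => by
    rw [LinearMap.lTensor_comp]; rfl
  ext c
  simp only [LinearMap.comp_apply, hitR.eq_def (φ * ψ), mul_eq_comp_hitR, h]
  rw [← LinearMap.comp_apply (LinearMap.lTensor C (hitR ψ)), ← comul_comp_hitR]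
  rfl

/-- A coalgebra map intertwines the operators `hitL`. -/
lemma hitL_coalgHom (θ : C →ₗc[k] D) (φ : WithConv (D →ₗ[k] k)) (c : C) :
    hitL φ (θ c) = θ (hitL (pull θ φ) c) := by
  simp only [hitL, LinearMap.comp_apply, ← CoalgHomClass.map_comp_comul_apply θ c]
  induction (comul c : C ⊗[k] C) using TensorProduct.induction_on with
  | zero => simp
  | tmul x y => simp
  | add x y hx hy => simp only [map_add, hx, hy]

lemma hitR_coalgHom (θ : C →ₗc[k] D) (φ : WithConv (D →ₗ[k] k)) (c : C) :
    hitR φ (θ c) = θ (hitR (pull θ φ) c) := by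
  simp only [hitR, LinearMap.comp_apply, ← CoalgHomClass.map_comp_comul_apply θ c]
  induction (comul c : C ⊗[k] C) using TensorProduct.induction_on with
  | zero => simp
  | tmul x y => simp
  | add x y hx hy => simp only [map_add, hx, hy]

/-- The tensor product of coalgebra maps. -/
def tmap {F : Type*} [AddCommMonoid F] [Module k F] [Coalgebra k F]
    (f : C →ₗc[k] D) (f' : E →ₗc[k] F) : C ⊗[k] E →ₗc[k] D ⊗[k] F :=
  Coalgebra.TensorProduct.map f f'

@[simp] lemma tmap_tmul {F : Type*} [AddCommMonoid F] [Module k F] [Coalgebra k F]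
    (f : C →ₗc[k] D) (f' : E →ₗc[k] F) (c : C) (e : E) : tmap f f' (c ⊗ₜ e) = f c ⊗ₜ f' e := rfl

/-- The projection `c ⊗ d ↦ ε (d) c`. -/
def prL : C ⊗[k] D →ₗc[k] C :=
  (Coalgebra.TensorProduct.rid k k C).toCoalgHom.comp
    (tmap (CoalgHom.id k C) (Coalgebra.counitCoalgHom k D))

/-- The projection `c ⊗ d ↦ ε (c) d`. -/
def prR : C ⊗[k] D →ₗc[k] D :=
  (Coalgebra.TensorProduct.lid k D).toCoalgHom.comp
    (tmap (Coalgebra.counitCoalgHom k C) (CoalgHom.id k D))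

@[simp] lemma prL_tmul (c : C) (d : D) :
    (prL : C ⊗[k] D →ₗc[k] C) (c ⊗ₜ d) = counit (R := k) d • c := rfl

@[simp] lemma prR_tmul (c : C) (d : D) :
    (prR : C ⊗[k] D →ₗc[k] D) (c ⊗ₜ d) = counit (R := k) c • d := rfl

/-- The insertion `c ↦ c ⊗ d` of a group-like element on the right. -/
def insR (d : GroupLike k D) : C →ₗc[k] C ⊗[k] D where
  toLinearMap := (TensorProduct.mk k C D).flip d.val
  counit_comp := by
    ext c
    simp [d.isGroupLikeElem_val.counit_eq_one]
  map_comp_comul := by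
    ext c
    simp only [LinearMap.comp_apply, LinearMap.flip_apply, TensorProduct.mk_apply,
      TensorProduct.comul_tmul, d.isGroupLikeElem_val.comul_eq_tmul_self]
    induction (comul c : C ⊗[k] C) using TensorProduct.induction_on with
    | zero => simp
    | tmul x y => simp
    | add x y hx hy => simp only [map_add, add_tmul, hx, hy]

/-- The insertion `c ↦ d ⊗ c` of a group-like element on the left. -/
def insL (d : GroupLike k D) : C →ₗc[k] D ⊗[k] C where
  toLinearMap := TensorProduct.mk k D C d.val
  counit_comp := by
    ext c
    simp [d.isGroupLikeElem_val.counit_eq_one]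
  map_comp_comul := by
    ext c
    simp only [LinearMap.comp_apply, TensorProduct.mk_apply,
      TensorProduct.comul_tmul, d.isGroupLikeElem_val.comul_eq_tmul_self]
    induction (comul c : C ⊗[k] C) using TensorProduct.induction_on with
    | zero => simp
    | tmul x y => simp
    | add x y hx hy => simp only [map_add, tmul_add, hx, hy]

@[simp] lemma insR_apply (d : GroupLike k D) (c : C) : insR d c = c ⊗ₜ[k] d.val := rfl

@[simp] lemma insL_apply (d : GroupLike k D) (c : C) : insL d c = d.val ⊗ₜ[k] c := rfl

/-- The coalgebra map `c ↦ ε (c) d` for a group-like element `d`. -/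
def constGL (d : GroupLike k D) : C →ₗc[k] D := prL.comp (insL d)

@[simp] lemma constGL_apply (d : GroupLike k D) (c : C) :
    constGL d c = counit (R := k) c • d.val := rfl

/-- The tensor product of group-like elements. -/
def tensorGL (c : GroupLike k C) (d : GroupLike k D) : GroupLike k (C ⊗[k] D) :=
  ⟨c.val ⊗ₜ d.val, c.isGroupLikeElem_val.map (insR d)⟩

@[simp] lemma tensorGL_val (c : GroupLike k C) (d : GroupLike k D) :
    (tensorGL c d).val = c.val ⊗ₜ[k] d.val := rfl

/-- A functional of the first tensor factor commutes with a functional of the second one: in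
either order their convolution product is their tensor product. -/
lemma pull_prL_mul_pull_prR (φ : WithConv (C →ₗ[k] k)) (ψ : WithConv (D →ₗ[k] k)) :
    pull (prL : C ⊗[k] D →ₗc[k] C) φ * pull prR ψ = pull prR ψ * pull prL φ := by
  ext c d
  simp only [LinearMap.convMul_apply, TensorProduct.AlgebraTensorModule.curry_apply,
    LinearMap.restrictScalars_self, TensorProduct.curry_apply, TensorProduct.comul_tmul]
  have hc : ∀ s : C ⊗[k] C, ∀ t : D ⊗[k] D,
      LinearMap.mul' k k (TensorProduct.map
        (pull (prL : C ⊗[k] D →ₗc[k] C) φ).ofConv (pull prR ψ).ofConv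
        (TensorProduct.AlgebraTensorModule.tensorTensorTensorComm k k k k C C D D (s ⊗ₜ t))) =
      φ (TensorProduct.rid k C (LinearMap.lTensor C counit s)) *
        ψ (TensorProduct.lid k D (LinearMap.rTensor D counit t)) := by
    intro s t
    induction s using TensorProduct.induction_on with
    | zero => simp
    | add x y hx hy => simp only [map_add, add_tmul, hx, hy, add_mul]
    | tmul x y =>
      induction t using TensorProduct.induction_on with
      | zero => simp
      | add x y hx hy => simp only [map_add, tmul_add, hx, hy, mul_add]
      | tmul z w => simp; ring
  have hd : ∀ s : C ⊗[k] C, ∀ t : D ⊗[k] D,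
      LinearMap.mul' k k (TensorProduct.map
        (pull (prR : C ⊗[k] D →ₗc[k] D) ψ).ofConv (pull prL φ).ofConv
        (TensorProduct.AlgebraTensorModule.tensorTensorTensorComm k k k k C C D D (s ⊗ₜ t))) =
      φ (TensorProduct.lid k C (LinearMap.rTensor C counit s)) *
        ψ (TensorProduct.rid k D (LinearMap.lTensor D counit t)) := by
    intro s t
    induction s using TensorProduct.induction_on with
    | zero => simp
    | add x y hx hy => simp only [map_add, add_tmul, hx, hy, add_mul]
    | tmul x y =>
      induction t using TensorProduct.induction_on with
      | zero => simp
      | add x y hx hy => simp only [map_add, tmul_add, hx, hy, mul_add]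
      | tmul z w => simp; ring
  rw [hc, hd]
  simp

lemma hitL_pull_prR (φ : WithConv (D →ₗ[k] k)) :
    hitL (pull (prR : C ⊗[k] D →ₗc[k] D) φ) = LinearMap.lTensor C (hitL φ) := by
  have hc : ∀ s : C ⊗[k] C, ∀ t : D ⊗[k] D,
      TensorProduct.lid k _ (LinearMap.rTensor _ (pull (prR : C ⊗[k] D →ₗc[k] D) φ).ofConv
        (TensorProduct.AlgebraTensorModule.tensorTensorTensorComm k k k k C C D D (s ⊗ₜ t))) =
      (TensorProduct.lid k C (LinearMap.rTensor C counit s)) ⊗ₜ[k]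
        (TensorProduct.lid k D (LinearMap.rTensor D φ.ofConv t)) := by
    intro s t
    induction s using TensorProduct.induction_on with
    | zero => simp
    | add x y hx hy => simp only [map_add, add_tmul, hx, hy]
    | tmul x y =>
      induction t using TensorProduct.induction_on with
      | zero => simp
      | add x y hx hy => simp only [map_add, tmul_add, hx, hy]
      | tmul z w => simp [TensorProduct.tmul_smul, ← TensorProduct.smul_tmul', smul_smul, mul_comm]
  ext c d
  simpa [hitL] using hc (comul c) (comul d)

lemma hitR_pull_prR (φ : WithConv (D →ₗ[k] k)) :
    hitR (pull (prR : C ⊗[k] D →ₗc[k] D) φ) = LinearMap.lTensor C (hitR φ) := by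
  have hc : ∀ s : C ⊗[k] C, ∀ t : D ⊗[k] D,
      TensorProduct.rid k _ (LinearMap.lTensor _ (pull (prR : C ⊗[k] D →ₗc[k] D) φ).ofConv
        (TensorProduct.AlgebraTensorModule.tensorTensorTensorComm k k k k C C D D (s ⊗ₜ t))) =
      (TensorProduct.rid k C (LinearMap.lTensor C counit s)) ⊗ₜ[k]
        (TensorProduct.rid k D (LinearMap.lTensor D φ.ofConv t)) := by
    intro s t
    induction s using TensorProduct.induction_on with
    | zero => simp
    | add x y hx hy => simp only [map_add, add_tmul, hx, hy]
    | tmul x y =>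
      induction t using TensorProduct.induction_on with
      | zero => simp
      | add x y hx hy => simp only [map_add, tmul_add, hx, hy]
      | tmul z w => simp [TensorProduct.tmul_smul, ← TensorProduct.smul_tmul', smul_smul, mul_comm]
  ext c d
  simpa [hitR] using hc (comul c) (comul d)

lemma hitL_pull_prL (φ : WithConv (C →ₗ[k] k)) :
    hitL (pull (prL : C ⊗[k] D →ₗc[k] C) φ) = LinearMap.rTensor D (hitL φ) := by
  have hc : ∀ s : C ⊗[k] C, ∀ t : D ⊗[k] D,
      TensorProduct.lid k _ (LinearMap.rTensor _ (pull (prL : C ⊗[k] D →ₗc[k] C) φ).ofConv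
        (TensorProduct.AlgebraTensorModule.tensorTensorTensorComm k k k k C C D D (s ⊗ₜ t))) =
      (TensorProduct.lid k C (LinearMap.rTensor C φ.ofConv s)) ⊗ₜ[k]
        (TensorProduct.lid k D (LinearMap.rTensor D counit t)) := by
    intro s t
    induction s using TensorProduct.induction_on with
    | zero => simp
    | add x y hx hy => simp only [map_add, add_tmul, hx, hy]
    | tmul x y =>
      induction t using TensorProduct.induction_on with
      | zero => simp
      | add x y hx hy => simp only [map_add, tmul_add, hx, hy]
      | tmul z w => simp [TensorProduct.tmul_smul, ← TensorProduct.smul_tmul', smul_smul, mul_comm]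
  ext c d
  simpa [hitL] using hc (comul c) (comul d)

lemma hitR_pull_prL (φ : WithConv (C →ₗ[k] k)) :
    hitR (pull (prL : C ⊗[k] D →ₗc[k] C) φ) = LinearMap.rTensor D (hitR φ) := by
  have hc : ∀ s : C ⊗[k] C, ∀ t : D ⊗[k] D,
      TensorProduct.rid k _ (LinearMap.lTensor _ (pull (prL : C ⊗[k] D →ₗc[k] C) φ).ofConv
        (TensorProduct.AlgebraTensorModule.tensorTensorTensorComm k k k k C C D D (s ⊗ₜ t))) =
      (TensorProduct.rid k C (LinearMap.lTensor C φ.ofConv s)) ⊗ₜ[k]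
        (TensorProduct.rid k D (LinearMap.lTensor D counit t)) := by
    intro s t
    induction s using TensorProduct.induction_on with
    | zero => simp
    | add x y hx hy => simp only [map_add, add_tmul, hx, hy]
    | tmul x y =>
      induction t using TensorProduct.induction_on with
      | zero => simp
      | add x y hx hy => simp only [map_add, tmul_add, hx, hy]
      | tmul z w => simp [TensorProduct.tmul_smul, ← TensorProduct.smul_tmul', smul_smul, mul_comm]
  ext c d
  simpa [hitR] using hc (comul c) (comul d)

end Convolution

/-! ### The reassociator evaluated at group-like elements -/

section Reassociator

lemma coalgHom_ext_tmul {k : Type u} [Field k] {C D E : Type*} [AddCommMonoid C] [Module k C]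
    [Coalgebra k C] [AddCommMonoid D] [Module k D] [Coalgebra k D] [AddCommMonoid E] [Module k E]
    [Coalgebra k E] {f f' : C ⊗[k] D →ₗc[k] E} (h : ∀ c d, f (c ⊗ₜ d) = f' (c ⊗ₜ d)) : f = f' :=
  CoalgHom.coe_linearMap_injective (TensorProduct.ext' h)

variable {k : Type u} {H : Type v} [Field k] [NonAssocRing H] [Module k H]
  [SMulCommClass k H H] [IsScalarTower k H H] [Coalgebra k H] [DualQuasiBialgebra k H]
variable {C D : Type*} [AddCommMonoid C] [Module k C] [Coalgebra k C]
  [AddCommMonoid D] [Module k D] [Coalgebra k D]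

variable (k H) in
/-- The multiplication of `H` as a coalgebra map. -/
def mulHom : H ⊗[k] H →ₗc[k] H where
  toLinearMap := LinearMap.mul' k H
  counit_comp := DualQuasiBialgebra.counit_mul
  map_comp_comul := DualQuasiBialgebra.comul_mul.symm

@[simp] lemma mulHom_tmul (a b : H) : mulHom k H (a ⊗ₜ b) = a * b := rfl

/-- Left multiplication `h ↦ a h` by a group-like element. -/
def lmul (a : GroupLike k H) : H →ₗc[k] H := (mulHom k H).comp (insL a)

/-- Right multiplication `h ↦ h a` by a group-like element. -/
def rmul (a : GroupLike k H) : H →ₗc[k] H := (mulHom k H).comp (insR a)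

@[simp] lemma lmul_apply (a : GroupLike k H) (h : H) : lmul a h = a.val * h := rfl

@[simp] lemma rmul_apply (a : GroupLike k H) (h : H) : rmul a h = h * a.val := rfl

/-- The product of group-like elements. -/
def mulGL (a b : GroupLike k H) : GroupLike k H :=
  ⟨a.val * b.val, b.isGroupLikeElem_val.map (lmul a)⟩

@[simp] lemma mulGL_val (a b : GroupLike k H) : (mulGL a b).val = a.val * b.val := rfl

variable (k H) in
/-- The unit of `H` as a group-like element. -/
def oneGL : GroupLike k H := ⟨1, DualQuasiBialgebra.counit_one, DualQuasiBialgebra.comul_one⟩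

@[simp] lemma oneGL_val : (oneGL k H).val = 1 := rfl

/-- Pullback of convolution invertible functionals. -/
abbrev upull (θ : C →ₗc[k] D) : (WithConv (D →ₗ[k] k))ˣ →* (WithConv (C →ₗ[k] k))ˣ :=
  Units.map (pull θ)

/-- The pullback of the reassociator along a coalgebra map into `H ⊗ H ⊗ H`, with its convolution
inverse. -/
def omegaPull (θ : C →ₗc[k] (H ⊗[k] H) ⊗[k] H) : (WithConv (C →ₗ[k] k))ˣ :=
  upull θ DualQuasiBialgebra.reassociator

lemma pull_val (θ : C →ₗc[k] D) (φ : (WithConv (D →ₗ[k] k))ˣ) :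
    pull θ φ.val = (upull θ φ).val := rfl

lemma upull_omegaPull (θ : C →ₗc[k] D) (η : D →ₗc[k] (H ⊗[k] H) ⊗[k] H) :
    upull θ (omegaPull η) = omegaPull (η.comp θ) := rfl

lemma omegaPull_apply (θ : C →ₗc[k] (H ⊗[k] H) ⊗[k] H) (c : C) :
    (omegaPull θ).val c = omega k H (θ c) := rfl

lemma omegaPull_inv_apply (θ : C →ₗc[k] (H ⊗[k] H) ⊗[k] H) (c : C) :
    ((omegaPull θ)⁻¹).val c = omegaInv k H (θ c) := rfl

variable (k H) in
/-- The coalgebra map `a ⊗ b ⊗ c ⊗ d ↦ ε (a) b ⊗ c ⊗ d`. -/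
def faceCounitLeft : ((H ⊗[k] H) ⊗[k] H) ⊗[k] H →ₗc[k] (H ⊗[k] H) ⊗[k] H :=
  tmap (tmap prR (CoalgHom.id k H)) (CoalgHom.id k H)

variable (k H) in
/-- The coalgebra map `a ⊗ b ⊗ c ⊗ d ↦ a ⊗ b c ⊗ d`. -/
def faceMulMid : ((H ⊗[k] H) ⊗[k] H) ⊗[k] H →ₗc[k] (H ⊗[k] H) ⊗[k] H :=
  tmap
    ((tmap (CoalgHom.id k H) (mulHom k H)).comp
      (Coalgebra.TensorProduct.assoc k k H H H).toCoalgHom) (CoalgHom.id k H)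

variable (k H) in
/-- The coalgebra map `a ⊗ b ⊗ c ⊗ d ↦ a ⊗ b ⊗ c d`. -/
def faceMulRight : ((H ⊗[k] H) ⊗[k] H) ⊗[k] H →ₗc[k] (H ⊗[k] H) ⊗[k] H :=
  (tmap (CoalgHom.id k (H ⊗[k] H)) (mulHom k H)).comp
    (Coalgebra.TensorProduct.assoc k k (H ⊗[k] H) H H).toCoalgHom

variable (k H) in
/-- The coalgebra map `a ⊗ b ⊗ c ⊗ d ↦ a b ⊗ c ⊗ d`. -/
def faceMulLeft : ((H ⊗[k] H) ⊗[k] H) ⊗[k] H →ₗc[k] (H ⊗[k] H) ⊗[k] H :=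
  tmap
    (tmap (mulHom k H) (CoalgHom.id k H)) (CoalgHom.id k H)

@[simp] lemma faceCounitLeft_tmul (a b c d : H) : faceCounitLeft k H (((a ⊗ₜ b) ⊗ₜ c) ⊗ₜ d) =
    ((counit (R := k) a • b) ⊗ₜ c) ⊗ₜ d := rfl

@[simp] lemma faceMulMid_tmul (a b c d : H) : faceMulMid k H (((a ⊗ₜ b) ⊗ₜ c) ⊗ₜ d) =
    (a ⊗ₜ (b * c)) ⊗ₜ d := rfl

@[simp] lemma faceMulRight_tmul (a b c d : H) : faceMulRight k H (((a ⊗ₜ b) ⊗ₜ c) ⊗ₜ d) =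
    (a ⊗ₜ b) ⊗ₜ (c * d) := rfl

@[simp] lemma faceMulLeft_tmul (a b c d : H) : faceMulLeft k H (((a ⊗ₜ b) ⊗ₜ c) ⊗ₜ d) =
    ((a * b) ⊗ₜ c) ⊗ₜ d := rfl

/-- The 3-cocycle identity, pulled back along a coalgebra map into `H ⊗ H ⊗ H ⊗ H`. -/
lemma pentagon (θ : C →ₗc[k] ((H ⊗[k] H) ⊗[k] H) ⊗[k] H) :
    omegaPull ((faceCounitLeft k H).comp θ) * omegaPull ((faceMulMid k H).comp θ) *
        omegaPull (prL.comp θ) =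
      omegaPull ((faceMulRight k H).comp θ) * omegaPull ((faceMulLeft k H).comp θ) := by
  have h : omegaPull (faceCounitLeft k H) * omegaPull (faceMulMid k H) *
      omegaPull prL = omegaPull (faceMulRight k H) * omegaPull (faceMulLeft k H) := by
    refine Units.ext ?_
    have e : (omegaPull (prL : ((H ⊗[k] H) ⊗[k] H) ⊗[k] H →ₗc[k] _)).val =
        toConv (LinearMap.mul' k k ∘ₗ TensorProduct.map
          (DualQuasiBialgebra.reassociator (k := k) (H := H)).val.ofConv counit) := by
      refine WithConv.ext (TensorProduct.ext' fun x d => ?_)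
      rw [omegaPull_apply]
      simp [omega, mul_comm]
    simp only [Units.val_mul, e]
    exact DualQuasiBialgebra.cocycle
  have h' := congrArg (upull θ) h
  simp only [map_mul, upull_omegaPull] at h'
  exact h'

/-- `ω (- ⊗ a ⊗ b)` -/
def omL (a b : GroupLike k H) : (WithConv (H →ₗ[k] k))ˣ := omegaPull ((insR b).comp (insR a))

/-- `ω (a ⊗ - ⊗ b)` -/
def omM (a b : GroupLike k H) : (WithConv (H →ₗ[k] k))ˣ := omegaPull ((insR b).comp (insL a))

/-- `ω (a ⊗ b ⊗ -)` -/
def omR (a b : GroupLike k H) : (WithConv (H →ₗ[k] k))ˣ := omegaPull (insL (tensorGL a b))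

/-- The coalgebra map `h ⊗ l ↦ h ⊗ a ⊗ l`. -/
def slotLR (a : GroupLike k H) : H ⊗[k] H →ₗc[k] (H ⊗[k] H) ⊗[k] H :=
  tmap (insR a) (CoalgHom.id k H)

/-- The coalgebra map `h ⊗ l ↦ a ⊗ h ⊗ l`. -/
def slotMR (a : GroupLike k H) : H ⊗[k] H →ₗc[k] (H ⊗[k] H) ⊗[k] H :=
  tmap (insL a) (CoalgHom.id k H)

@[simp] lemma slotLR_tmul (a : GroupLike k H) (h l : H) :
    slotLR a (h ⊗ₜ l) = (h ⊗ₜ a.val) ⊗ₜ l := rfl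

@[simp] lemma slotMR_tmul (a : GroupLike k H) (h l : H) :
    slotMR a (h ⊗ₜ l) = (a.val ⊗ₜ h) ⊗ₜ l := rfl

lemma omL_apply (a b : GroupLike k H) (h : H) :
    (omL a b).val h = omega k H ((h ⊗ₜ a.val) ⊗ₜ b.val) := rfl

lemma omM_apply (a b : GroupLike k H) (h : H) :
    (omM a b).val h = omega k H ((a.val ⊗ₜ h) ⊗ₜ b.val) := rfl

lemma omR_apply (a b : GroupLike k H) (h : H) :
    (omR a b).val h = omega k H ((a.val ⊗ₜ b.val) ⊗ₜ h) := rfl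

lemma omM_inv_apply (a b : GroupLike k H) (h : H) :
    (omM a b)⁻¹.val h = omegaInv k H ((a.val ⊗ₜ h) ⊗ₜ b.val) := rfl

lemma omR_inv_apply (a b : GroupLike k H) (h : H) :
    (omR a b)⁻¹.val h = omegaInv k H ((a.val ⊗ₜ b.val) ⊗ₜ h) := rfl

/-- `ω (- ⊗ - ⊗ a)` -/
def omLM (a : GroupLike k H) : (WithConv (H ⊗[k] H →ₗ[k] k))ˣ := omegaPull (insR a)

/-- `ω (- ⊗ a ⊗ -)` -/
def omLR (a : GroupLike k H) : (WithConv (H ⊗[k] H →ₗ[k] k))ˣ := omegaPull (slotLR a)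

/-- `ω (a ⊗ - ⊗ -)` -/
def omMR (a : GroupLike k H) : (WithConv (H ⊗[k] H →ₗ[k] k))ˣ := omegaPull (slotMR a)

/-- The coalgebra map `h ⊗ l ↦ h ⊗ f l`, along which functionals on `H ⊗ H` are pulled back in the
second argument. -/
abbrev pullSnd (f : H →ₗc[k] H) : H ⊗[k] H →ₗc[k] H ⊗[k] H :=
  tmap (CoalgHom.id k H) f

/-- The coalgebra map `h ⊗ l ↦ f h ⊗ l`, along which functionals on `H ⊗ H` are pulled back in the
first argument. -/
abbrev pullFst (f : H →ₗc[k] H) : H ⊗[k] H →ₗc[k] H ⊗[k] H :=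
  tmap f (CoalgHom.id k H)

/-! The cocycle identity with two group-like arguments, at the six positions of these. -/

section Pentagons

variable (a b c : GroupLike k H)

lemma pentagon_of {θ : C →ₗc[k] ((H ⊗[k] H) ⊗[k] H) ⊗[k] H}
    {θ₁ θ₂ θ₃ θ₄ θ₅ : C →ₗc[k] (H ⊗[k] H) ⊗[k] H}
    (h₁ : (faceCounitLeft k H).comp θ = θ₁) (h₂ : (faceMulMid k H).comp θ = θ₂)
    (h₃ : prL.comp θ = θ₃) (h₄ : (faceMulRight k H).comp θ = θ₄)
    (h₅ : (faceMulLeft k H).comp θ = θ₅) :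
    omegaPull θ₁ * omegaPull θ₂ * omegaPull θ₃ = omegaPull θ₄ * omegaPull θ₅ := by
  rw [← h₁, ← h₂, ← h₃, ← h₄, ← h₅]
  exact pentagon θ

lemma counit_val : counit (R := k) a.val = 1 := a.isGroupLikeElem_val.counit_eq_one

lemma pentagon_LM :
    upull prR (omL a b) * upull (pullSnd (rmul a)) (omLM b) * omLM a =
      omLM (mulGL a b) * upull (mulHom k H) (omL a b) := by
  simp only [omL, omLM, upull_omegaPull]
  apply pentagon_of (θ := (insR b).comp (insR a)) <;>
  exact coalgHom_ext_tmul fun x y => by simp [← smul_tmul']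

lemma pentagon_LR :
    upull prR (omM a b) * upull (pullSnd (lmul a)) (omLM b) * omLR a =
      upull (pullSnd (rmul b)) (omLR a) * upull (pullFst (rmul a)) (omLM b) := by
  simp only [omM, omLR, omLM, upull_omegaPull]
  apply pentagon_of (θ := (insR b).comp (slotLR a)) <;>
  exact coalgHom_ext_tmul fun x y => by simp [counit_val, ← smul_tmul', tmul_smul]

lemma pentagon_MR :
    omLM b * upull (mulHom k H) (omM a b) * omMR a =
      upull (pullSnd (rmul b)) (omMR a) * upull (pullFst (lmul a)) (omLM b) := by
  simp only [omM, omMR, omLM, upull_omegaPull]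
  apply pentagon_of (θ := (insR b).comp (slotMR a)) <;>
  exact coalgHom_ext_tmul fun x y => by simp [counit_val]

lemma pentagon_L_R :
    upull prR (omR a b) * omLR (mulGL a b) * upull prL (omL a b) =
      upull (pullSnd (lmul b)) (omLR a) * upull (pullFst (rmul a)) (omLR b) := by
  simp only [omR, omL, omLR, upull_omegaPull]
  apply pentagon_of (θ := (tmap (insR b) (CoalgHom.id k H)).comp (slotLR a)) <;>
  exact coalgHom_ext_tmul fun x y => by simp [counit_val, ← smul_tmul', tmul_smul]

lemma pentagon_M_R :
    omLR b * upull (pullFst (rmul b)) (omMR a) * upull prL (omM a b) =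
      upull (pullSnd (lmul b)) (omMR a) * upull (pullFst (lmul a)) (omLR b) := by
  simp only [omM, omMR, omLR, upull_omegaPull]
  apply pentagon_of (θ := (tmap (insR b) (CoalgHom.id k H)).comp (slotMR a)) <;>
  exact coalgHom_ext_tmul fun x y => by simp [counit_val, ← smul_tmul', tmul_smul]

lemma pentagon_R_R :
    omMR b * upull (pullFst (lmul b)) (omMR a) * upull prL (omR a b) =
      upull (mulHom k H) (omR a b) * omMR (mulGL a b) := by
  simp only [omR, omMR, upull_omegaPull]
  apply pentagon_of
    (θ := (tmap (tmap (insL a) (CoalgHom.id k H)) (CoalgHom.id k H)).comp (slotMR b)) <;>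
  exact coalgHom_ext_tmul fun x y => by simp [counit_val, ← smul_tmul', tmul_smul]

/-- The scalar `ω (a ⊗ b ⊗ c)`, as a multiple of the counit. -/
def omC : (WithConv (H →ₗ[k] k))ˣ := omegaPull (constGL (tensorGL (tensorGL a b) c))

lemma omC_mul_comm (φ : WithConv (H →ₗ[k] k)) : (omC a b c).val * φ = φ * (omC a b c).val := by
  have : (omC a b c).val = algebraMap k _ (omega k H ((a.val ⊗ₜ b.val) ⊗ₜ c.val)) := by
    ext h
    rw [LinearMap.convAlgebraMap_apply, omC, omegaPull_apply]
    simp [mul_comm]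
  rw [this, Algebra.commutes]

/-! The cocycle identity with three group-like arguments. -/

lemma pentagon_L : omC a b c * omL (mulGL a b) c * omL a b =
    omL a (mulGL b c) * upull (rmul a) (omL b c) := by
  simp only [omC, omL, upull_omegaPull]
  apply pentagon_of (θ := (insR c).comp ((insR b).comp (insR a))) <;>
  exact CoalgHom.ext fun x => by simp [counit_val, ← smul_tmul', tmul_smul]

lemma pentagon_M : omL b c * upull (rmul b) (omM a c) * omM a b =
    omM a (mulGL b c) * upull (lmul a) (omL b c) := by
  simp only [omM, omL, upull_omegaPull]
  apply pentagon_of (θ := (insR c).comp ((insR b).comp (insL a))) <;>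
  exact CoalgHom.ext fun x => by simp [counit_val, ← smul_tmul', tmul_smul]

lemma pentagon_R : omM b c * upull (lmul b) (omM a c) * omR a b =
    upull (rmul c) (omR a b) * omM (mulGL a b) c := by
  simp only [omM, omR, upull_omegaPull]
  apply pentagon_of (θ := (insR c).comp (insL (tensorGL a b))) <;>
  exact CoalgHom.ext fun x => by simp [counit_val, ← smul_tmul', tmul_smul]

lemma pentagon_RR : omR b c * omR a (mulGL b c) * omC a b c =
    upull (lmul c) (omR a b) * omR (mulGL a b) c := by
  simp only [omC, omR, upull_omegaPull]
  apply pentagon_of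
    (θ := (insL (tensorGL (tensorGL a b) c) : H →ₗc[k] ((H ⊗[k] H) ⊗[k] H) ⊗[k] H)) <;>
  exact CoalgHom.ext fun x => by simp [counit_val, ← smul_tmul', tmul_smul]

end Pentagons

/-! ### Normalization of the reassociator -/

section Normalization

variable (a b : GroupLike k H)

lemma omega_mid_one (h l : H) : omega k H ((h ⊗ₜ 1) ⊗ₜ l) =
    counit (R := k) h * counit (R := k) l := DualQuasiBialgebra.normalized h l

@[simp] lemma mulGL_one : mulGL a (oneGL k H) = a := GroupLike.ext (mul_one _)

@[simp] lemma one_mulGL : mulGL (oneGL k H) a = a := GroupLike.ext (one_mul _)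

@[simp] lemma lmul_one : lmul (oneGL k H) = CoalgHom.id k H := CoalgHom.ext fun h => one_mul h

@[simp] lemma rmul_one : rmul (oneGL k H) = CoalgHom.id k H := CoalgHom.ext fun h => mul_one h

@[simp] lemma upull_id (φ : (WithConv (C →ₗ[k] k))ˣ) : upull (CoalgHom.id k C) φ = φ := rfl

@[simp] lemma tmap_id : tmap (CoalgHom.id k C) (CoalgHom.id k D) = CoalgHom.id k (C ⊗[k] D) :=
  coalgHom_ext_tmul fun _ _ => rfl

@[simp] lemma omL_one : omL (oneGL k H) b = 1 := by
  refine Units.ext (WithConv.ext (LinearMap.ext fun h => ?_))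
  exact (omega_mid_one h b.val).trans (by simp [counit_val])

@[simp] lemma omR_one : omR a (oneGL k H) = 1 := by
  refine Units.ext (WithConv.ext (LinearMap.ext fun h => ?_))
  exact (omega_mid_one a.val h).trans (by simp [counit_val])

@[simp] lemma omC_mid_one : omC a (oneGL k H) b = 1 := by
  refine Units.ext (WithConv.ext (LinearMap.ext fun h => ?_))
  rw [omC, omegaPull_apply]
  simp [counit_val, omega_mid_one]

@[simp] lemma omLR_one : omLR (oneGL k H) = 1 := by
  refine Units.ext (WithConv.ext (TensorProduct.ext' fun h l => ?_))
  exact (omega_mid_one h l).trans (by simp [mul_comm])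

/-- The reassociator is normalized in every slot: apply the cocycle identity to two adjacent
units. -/
@[simp] lemma omM_one_left : omM (oneGL k H) b = 1 := by
  simpa using pentagon_R (oneGL k H) (oneGL k H) b

@[simp] lemma omM_one_right : omM a (oneGL k H) = 1 := by
  simpa using pentagon_M a (oneGL k H) (oneGL k H)

@[simp] lemma omR_one_left : omR (oneGL k H) b = 1 := by
  simpa using pentagon_RR (oneGL k H) (oneGL k H) b

@[simp] lemma omL_one_right : omL a (oneGL k H) = 1 := by
  simpa using pentagon_L a (oneGL k H) (oneGL k H)

@[simp] lemma omLM_one : omLM (oneGL k H) = 1 := by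
  simpa using pentagon_LM (oneGL k H) (oneGL k H)

@[simp] lemma omMR_one : omMR (oneGL k H) = 1 := by
  simpa using pentagon_R_R (oneGL k H) (oneGL k H)

end Normalization

/-! ### Quasi-associativity in terms of the operators `hitL` and `hitR` -/

section QuasiAssoc

variable (a b : GroupLike k H)

/-- Quasi-associativity, pulled back along a coalgebra map into `H ⊗ H ⊗ H`. -/
lemma quasiAssoc_comp (θ : C →ₗc[k] (H ⊗[k] H) ⊗[k] H) (c : C) :
    mulHom k H (LinearMap.lTensor H (LinearMap.mul' k H)
      (TensorProduct.assoc k H H H (θ (hitR (omegaPull θ).val c)))) =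
    mulHom k H (LinearMap.rTensor H (LinearMap.mul' k H) (θ (hitL (omegaPull θ).val c))) := by
  have hR : ∀ (f : (H ⊗[k] H) ⊗[k] H →ₗ[k] H) (φ : WithConv ((H ⊗[k] H) ⊗[k] H →ₗ[k] k)) (x),
      (toConv f * toConv (LinearMap.toSpanSingleton k H 1 ∘ₗ φ.ofConv)) x = f (hitR φ x) := by
    intro f φ x
    simp only [LinearMap.convMul_apply, hitR, LinearMap.comp_apply]
    induction (comul x : ((H ⊗[k] H) ⊗[k] H) ⊗[k] ((H ⊗[k] H) ⊗[k] H))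
      using TensorProduct.induction_on with
    | zero => simp
    | tmul x y => simp
    | add x y hx hy => simp only [map_add, hx, hy]
  have hL : ∀ (f : (H ⊗[k] H) ⊗[k] H →ₗ[k] H) (φ : WithConv ((H ⊗[k] H) ⊗[k] H →ₗ[k] k)) (x),
      (toConv (LinearMap.toSpanSingleton k H 1 ∘ₗ φ.ofConv) * toConv f) x = f (hitL φ x) := by
    intro f φ x
    simp only [LinearMap.convMul_apply, hitL, LinearMap.comp_apply]
    induction (comul x : ((H ⊗[k] H) ⊗[k] H) ⊗[k] ((H ⊗[k] H) ⊗[k] H))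
      using TensorProduct.induction_on with
    | zero => simp
    | tmul x y => simp
    | add x y hx hy => simp only [map_add, hx, hy]
  have h := congrArg (fun f => f (θ c)) (DualQuasiBialgebra.quasi_assoc (k := k) (H := H))
  simp only [hR, hL, hitR_coalgHom, hitL_coalgHom] at h
  exact h

/-- Quasi-associativity for two group-like factors and one arbitrary one. -/
lemma mul_assoc_hit_LR (h : H) :
    a.val * (b.val * hitR (omR a b).val h) = (a.val * b.val) * hitL (omR a b).val h :=
  quasiAssoc_comp (insL (tensorGL a b) : H →ₗc[k] (H ⊗[k] H) ⊗[k] H) h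

lemma mul_assoc_hit_M (h : H) :
    a.val * (hitR (omM a b).val h * b.val) = (a.val * hitL (omM a b).val h) * b.val :=
  quasiAssoc_comp ((insR b).comp (insL a)) h

lemma mul_assoc_hit_L (h : H) :
    hitR (omL a b).val h * (a.val * b.val) = (hitL (omL a b).val h * a.val) * b.val :=
  quasiAssoc_comp ((insR b).comp (insR a)) h

/-- Products of group-like elements are associative, because the reassociator is a nonzero scalar
there. -/
lemma mulGL_assoc (c : GroupLike k H) : mulGL (mulGL a b) c = mulGL a (mulGL b c) := by
  have hit : ∀ φ : WithConv (H →ₗ[k] k), hitL φ c.val = φ c.val • c.val ∧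
      hitR φ c.val = φ c.val • c.val := fun φ => by
    simp [hitL, hitR, c.isGroupLikeElem_val.comul_eq_tmul_self]
  have hne : (omR a b).val c.val ≠ 0 := by
    have h := congrArg (fun φ : WithConv (H →ₗ[k] k) => φ c.val) (omR a b).mul_inv
    simp only [LinearMap.convMul_apply, c.isGroupLikeElem_val.comul_eq_tmul_self,
      LinearMap.convOne_apply, counit_val] at h
    intro h0
    simp [h0] at h
  have h := mul_assoc_hit_LR a b c.val
  rw [(hit _).1, (hit _).2] at h
  simp only [mul_smul_comm] at h
  exact GroupLike.ext ((smul_right_injective H hne h).symm)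

end QuasiAssoc

end Reassociator

/-! ### The tensor product of one-dimensional Yetter–Drinfeld modules -/

section Datum

variable {k : Type u} {H : Type v} [Field k] [NonAssocRing H] [Module k H]
  [SMulCommClass k H H] [IsScalarTower k H H] [Coalgebra k H] [DualQuasiBialgebra k H]

/-- The pair `(a, χ)` defines a Yetter–Drinfeld module structure on `k`, with coaction `1 ↦ a ⊗ 1`
and action `h ▷ 1 = χ (h)`. -/
structure IsYDCharacter (a : GroupLike k H) (χ : WithConv (H →ₗ[k] k)) : Prop where
  map_one : χ 1 = 1
  map_mul : pull (mulHom k H) χ =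
    (omLM a)⁻¹.val * pull prR χ * (omLR a).val * pull prL χ * (omMR a)⁻¹.val
  comm : ∀ h, a.val * hitL χ h = hitR χ h * a.val

/-- The character of the tensor product of the one-dimensional modules given by `(a, χ)` and
`(b, ψ)`. -/
def tensorChar (a b : GroupLike k H) (χ ψ : WithConv (H →ₗ[k] k)) : WithConv (H →ₗ[k] k) :=
  (omL a b).val * χ * (omM a b)⁻¹.val * ψ * (omR a b).val

variable {a b c : GroupLike k H} {χ ψ ξ : WithConv (H →ₗ[k] k)}

/-- Moving `χ` past a functional turns right multiplication by `a` into left multiplication. -/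
lemma IsYDCharacter.pull_rmul_mul (hχ : IsYDCharacter a χ) (φ : WithConv (H →ₗ[k] k)) :
    pull (rmul a) φ * χ = χ * pull (lmul a) φ := by
  refine WithConv.ext (LinearMap.ext fun h => ?_)
  rw [mul_eq_comp_hitR, mul_eq_comp_hitL]
  exact congrArg φ (hχ.comm h).symm

lemma IsYDCharacter.pull_snd_rmul_mul (hχ : IsYDCharacter a χ)
    (φ : WithConv (H ⊗[k] H →ₗ[k] k)) :
    pull (pullSnd (rmul a)) φ * pull prR χ = pull prR χ * pull (pullSnd (lmul a)) φ := by
  refine WithConv.ext (TensorProduct.ext' fun h l => ?_)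
  rw [mul_eq_comp_hitR, mul_eq_comp_hitL, hitR_pull_prR, hitL_pull_prR]
  exact congrArg (fun x => φ (h ⊗ₜ x)) (hχ.comm l).symm

lemma IsYDCharacter.pull_fst_rmul_mul (hχ : IsYDCharacter a χ)
    (φ : WithConv (H ⊗[k] H →ₗ[k] k)) :
    pull (pullFst (rmul a)) φ * pull prL χ = pull prL χ * pull (pullFst (lmul a)) φ := by
  refine WithConv.ext (TensorProduct.ext' fun h l => ?_)
  rw [mul_eq_comp_hitR, mul_eq_comp_hitL, hitR_pull_prL, hitL_pull_prL]
  exact congrArg (fun x => φ (x ⊗ₜ l)) (hχ.comm h).symm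

/-- The word problem behind `IsYDCharacter.tensor`: `p₁, …, p₆` are the cocycle identities and the
remaining hypotheses move the characters past the reassociators. -/
lemma tensorChar_mul_word {M : Type*} [Monoid M]
    {A₁ A₂ A₁₂ B₁ B₂ B₁₂ C₁ C₂ C₁₂ Pl Ml Sl Ph Mh Sh Pm Mm Sm : Mˣ}
    {u₁ u₂ u₃ u₄ u₅ u₆ v₁ v₂ v₃ v₄ v₅ v₆ : Mˣ} {x₁ x₂ y₁ y₂ : M}
    (p₁ : Pl * u₁ * A₁ = A₁₂ * Pm) (p₂ : Ml * v₁ * B₁ = u₃ * u₂) (p₃ : A₂ * Mm * C₁ = u₄ * v₂)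
    (p₄ : Sl * B₁₂ * Ph = v₃ * u₅) (p₅ : B₂ * u₆ * Mh = v₄ * v₅) (p₆ : C₂ * v₆ * Sh = Sm * C₁₂)
    (e₁ : u₁.val * y₁ = y₁ * v₁.val) (e₂ : u₂.val * x₁ = x₁ * v₂.val)
    (e₃ : u₃.val * y₂ = y₂ * v₃.val) (e₄ : u₄.val * y₂ = y₂ * v₄.val)
    (e₅ : u₅.val * x₁ = x₁ * v₅.val) (e₆ : u₆.val * x₂ = x₂ * v₆.val)
    (e₇ : x₁ * y₂ = y₂ * x₁) :
    Pm.val * (A₁⁻¹.val * y₁ * B₁.val * x₁ * C₁⁻¹.val) * Mm⁻¹.val *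
        (A₂⁻¹.val * y₂ * B₂.val * x₂ * C₂⁻¹.val) * Sm.val =
      A₁₂⁻¹.val * (Pl.val * y₁ * Ml⁻¹.val * y₂ * Sl.val) * B₁₂.val *
        (Ph.val * x₁ * Mh⁻¹.val * x₂ * Sh.val) * C₁₂⁻¹.val := by
  obtain rfl : Pm = A₁₂⁻¹ * (Pl * u₁ * A₁) := by rw [p₁]; group
  obtain rfl : B₁ = v₁⁻¹ * Ml⁻¹ * (u₃ * u₂) := by rw [← p₂]; group
  obtain rfl : Mm = A₂⁻¹ * (u₄ * v₂) * C₁⁻¹ := by rw [← p₃]; group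
  obtain rfl : B₁₂ = Sl⁻¹ * (v₃ * u₅) * Ph⁻¹ := by rw [← p₄]; group
  obtain rfl : B₂ = v₄ * v₅ * Mh⁻¹ * u₆⁻¹ := by rw [← p₅]; group
  obtain rfl : Sm = C₂ * v₆ * Sh * C₁₂⁻¹ := by rw [p₆]; group
  have f₁ : ∀ z, u₁.val * (y₁ * z) = y₁ * (v₁.val * z) := fun z => by
    rw [← mul_assoc, e₁, mul_assoc]
  have f₂ : ∀ z, u₂.val * (x₁ * z) = x₁ * (v₂.val * z) := fun z => by
    rw [← mul_assoc, e₂, mul_assoc]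
  have f₃ : ∀ z, u₃.val * (y₂ * z) = y₂ * (v₃.val * z) := fun z => by
    rw [← mul_assoc, e₃, mul_assoc]
  have f₄ : ∀ z, u₄⁻¹.val * (y₂ * z) = y₂ * (v₄⁻¹.val * z) := fun z => by
    rw [Units.inv_mul_eq_iff_eq_mul, ← mul_assoc, e₄, mul_assoc, Units.mul_inv_cancel_left]
  have f₅ : ∀ z, u₅.val * (x₁ * z) = x₁ * (v₅.val * z) := fun z => by
    rw [← mul_assoc, e₅, mul_assoc]
  have f₆ : ∀ z, u₆⁻¹.val * (x₂ * z) = x₂ * (v₆⁻¹.val * z) := fun z => by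
    rw [Units.inv_mul_eq_iff_eq_mul, ← mul_assoc, e₆, mul_assoc, Units.mul_inv_cancel_left]
  have f₇ : ∀ z, x₁ * (y₂ * z) = y₂ * (x₁ * z) := fun z => by
    rw [← mul_assoc, e₇, mul_assoc]
  simp only [mul_inv_rev, inv_inv, Units.val_mul, mul_assoc, Units.inv_mul_cancel_left,
    Units.mul_inv_cancel_left, f₁, f₂, f₃, f₄, f₅, f₆, f₇]

lemma tensorChar_map_one (hχ : χ 1 = 1) (hψ : ψ 1 = 1) : tensorChar a b χ ψ 1 = 1 := by
  have e : ∀ φ φ' : WithConv (H →ₗ[k] k), (φ * φ') 1 = φ 1 * φ' 1 := fun φ φ' => by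
    simp [DualQuasiBialgebra.comul_one]
  have hL : (omL a b).val 1 = 1 := by
    rw [omL_apply, ← oneGL_val (k := k), ← omM_apply, omM_one_left]
    simp
  have hM : (omM a b)⁻¹.val 1 = 1 := by
    rw [omM_inv_apply, ← oneGL_val (k := k), ← omR_inv_apply, omR_one]
    simp
  have hR : (omR a b).val 1 = 1 := by
    rw [omR_apply, ← oneGL_val (k := k), ← omM_apply, omM_one_right]
    simp
  simp only [tensorChar, e, hL, hM, hR, hχ, hψ, mul_one]

lemma tensorChar_map_mul (hχ : IsYDCharacter a χ) (hψ : IsYDCharacter b ψ) :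
    pull (mulHom k H) (tensorChar a b χ ψ) =
      (omLM (mulGL a b))⁻¹.val * pull prR (tensorChar a b χ ψ) * (omLR (mulGL a b)).val *
        pull prL (tensorChar a b χ ψ) * (omMR (mulGL a b))⁻¹.val := by
  simp only [tensorChar, _root_.map_mul, hχ.map_mul, hψ.map_mul, pull_val, map_inv]
  exact tensorChar_mul_word (pentagon_LM a b) (pentagon_LR a b) (pentagon_MR a b)
    (pentagon_L_R a b) (pentagon_M_R a b) (pentagon_R_R a b)
    (hχ.pull_snd_rmul_mul _) (hχ.pull_fst_rmul_mul _) (hψ.pull_snd_rmul_mul _)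
    (hψ.pull_snd_rmul_mul _) (hχ.pull_fst_rmul_mul _) (hψ.pull_fst_rmul_mul _)
    (pull_prL_mul_pull_prR _ _)

lemma hitL_comp_hitR_apply (φ ψ : WithConv (H →ₗ[k] k)) (x : H) :
    hitL φ (hitR ψ x) = hitR ψ (hitL φ x) := LinearMap.congr_fun (hitL_comp_hitR φ ψ) x

lemma hitR_hitR_inv (φ : (WithConv (H →ₗ[k] k))ˣ) (x : H) : hitR φ.val (hitR φ⁻¹.val x) = x := by
  rw [← LinearMap.comp_apply, ← hitR_mul, φ.mul_inv, hitR_one, LinearMap.id_apply]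

lemma hitL_hitL_inv (φ : (WithConv (H →ₗ[k] k))ˣ) (x : H) : hitL φ.val (hitL φ⁻¹.val x) = x := by
  rw [← LinearMap.comp_apply, ← hitL_mul, φ.inv_mul, hitL_one, LinearMap.id_apply]

lemma mul_assoc_hit_M_inv (a b : GroupLike k H) (x : H) :
    a.val * (hitL (omM a b)⁻¹.val x * b.val) = (a.val * hitR (omM a b)⁻¹.val x) * b.val := by
  have h := mul_assoc_hit_M a b (hitL (omM a b)⁻¹.val (hitR (omM a b)⁻¹.val x))
  rwa [← hitL_comp_hitR_apply, hitR_hitR_inv, hitL_hitL_inv] at h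

lemma tensorChar_comm (hχ : ∀ h, a.val * hitL χ h = hitR χ h * a.val)
    (hψ : ∀ h, b.val * hitL ψ h = hitR ψ h * b.val) (h : H) :
    (mulGL a b).val * hitL (tensorChar a b χ ψ) h =
      hitR (tensorChar a b χ ψ) h * (mulGL a b).val := by
  simp only [tensorChar, mulGL_val, hitL_mul, hitR_mul, LinearMap.comp_apply]
  rw [← mul_assoc_hit_LR, ← hitL_comp_hitR_apply, hψ, ← hitL_comp_hitR_apply,
    ← hitL_comp_hitR_apply, mul_assoc_hit_M_inv, ← hitL_comp_hitR_apply,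
    ← hitL_comp_hitR_apply, ← hitL_comp_hitR_apply, hχ, mul_assoc_hit_L]
  simp only [hitL_comp_hitR_apply]

/-- One-dimensional Yetter–Drinfeld modules are closed under tensor products. -/
lemma IsYDCharacter.tensor (hχ : IsYDCharacter a χ) (hψ : IsYDCharacter b ψ) :
    IsYDCharacter (mulGL a b) (tensorChar a b χ ψ) :=
  ⟨tensorChar_map_one hχ.map_one hψ.map_one, tensorChar_map_mul hχ hψ,
    tensorChar_comm hχ.comm hψ.comm⟩

/-- The trivial one-dimensional Yetter–Drinfeld module. -/
lemma isYDCharacter_one : IsYDCharacter (oneGL k H) 1 where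
  map_one := by simp [DualQuasiBialgebra.counit_one]
  map_mul := by simp
  comm h := by simp

/-- The word problem behind `tensorChar_assoc`. -/
lemma tensorChar_assoc_word {M : Type*} [Monoid M]
    {P₁ P₂ P₃ P₄ M₁ M₂ M₃ M₄ S₁ S₂ S₃ S₄ r₁ r₂ r₃ l₁ l₂ l₃ d : Mˣ} {x y z : M}
    (p₁ : d * P₂ * P₁ = P₃ * r₁) (p₂ : P₄ * r₂ * M₁ = M₃ * l₁) (p₃ : M₄ * l₂ * S₁ = r₃ * M₂)
    (p₄ : S₄ * S₃ * d = l₃ * S₂) (e₁ : r₁.val * x = x * l₁.val) (e₂ : r₂.val * y = y * l₂.val)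
    (e₃ : r₃.val * z = z * l₃.val) (e₄ : ∀ w, d.val * w = w * d.val) :
    P₂.val * (P₁.val * x * M₁⁻¹.val * y * S₁.val) * M₂⁻¹.val * z * S₂.val =
      P₃.val * x * M₃⁻¹.val * (P₄.val * y * M₄⁻¹.val * z * S₄.val) * S₃.val := by
  obtain rfl : P₂ = d⁻¹ * (P₃ * r₁) * P₁⁻¹ := by rw [← p₁]; group
  obtain rfl : M₁ = r₂⁻¹ * P₄⁻¹ * (M₃ * l₁) := by rw [← p₂]; group
  obtain rfl : M₂ = r₃⁻¹ * (M₄ * l₂ * S₁) := by rw [p₃]; group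
  obtain rfl : S₂ = l₃⁻¹ * (S₄ * S₃ * d) := by rw [p₄]; group
  have f₁ : ∀ w, r₁.val * (x * w) = x * (l₁.val * w) := fun w => by
    rw [← mul_assoc, e₁, mul_assoc]
  have f₂ : ∀ w, r₂.val * (y * w) = y * (l₂.val * w) := fun w => by
    rw [← mul_assoc, e₂, mul_assoc]
  have f₃ : ∀ w, r₃.val * (z * w) = z * (l₃.val * w) := fun w => by
    rw [← mul_assoc, e₃, mul_assoc]
  simp only [mul_inv_rev, inv_inv, Units.val_mul, mul_assoc, Units.inv_mul_cancel_left,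
    Units.mul_inv_cancel_left, f₁, f₂, f₃]
  rw [Units.inv_mul_eq_iff_eq_mul, e₄]
  simp only [mul_assoc]

/-- The tensor product of one-dimensional Yetter–Drinfeld modules is associative. -/
lemma tensorChar_assoc (hχ : IsYDCharacter a χ) (hψ : IsYDCharacter b ψ)
    (hξ : IsYDCharacter c ξ) : tensorChar (mulGL a b) c (tensorChar a b χ ψ) ξ =
      tensorChar a (mulGL b c) χ (tensorChar b c ψ ξ) :=
  tensorChar_assoc_word (pentagon_L a b c) (pentagon_M a b c) (pentagon_R a b c)
    (pentagon_RR a b c) (hχ.pull_rmul_mul _) (hψ.pull_rmul_mul _) (hξ.pull_rmul_mul _)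
    (omC_mul_comm a b c)

lemma tensorChar_one_left : tensorChar (oneGL k H) b 1 ψ = ψ := by
  simp [tensorChar]

/-- A quasi-Yetter–Drinfeld datum is the same as a one-dimensional Yetter–Drinfeld module. -/
lemma _root_.IsQuasiYDDatum.isYDCharacter {g : H} {χ : H →ₗ[k] k} (h : IsQuasiYDDatum g χ) :
    IsYDCharacter ⟨g, h.groupLike⟩ (toConv χ) where
  map_one := h.unitary
  map_mul := by
    have e₁ : pull prR (toConv χ) =
        toConv (LinearMap.mul' k k ∘ₗ TensorProduct.map (counit (R := k) (A := H)) χ) :=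
      WithConv.ext (TensorProduct.ext' fun x y => by simp)
    have e₂ : pull prL (toConv χ) =
        toConv (LinearMap.mul' k k ∘ₗ TensorProduct.map χ (counit (R := k) (A := H))) :=
      WithConv.ext (TensorProduct.ext' fun x y => by simp [mul_comm])
    rw [e₁, e₂]
    exact h.chi_mul
  comm := h.chi_comm

/-! ### Tensor powers of a one-dimensional Yetter–Drinfeld module -/

/-- The powers of a group-like element. -/
def powGL (a : GroupLike k H) : ℕ → GroupLike k H
  | 0 => oneGL k H
  | n + 1 => mulGL a (powGL a n)

lemma powGL_val (a : GroupLike k H) (n : ℕ) : (powGL a n).val = grpPow a.val n := by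
  induction n with
  | zero => rfl
  | succ n ih => exact congrArg (a.val * ·) ih

lemma powGL_add (a : GroupLike k H) (m n : ℕ) :
    powGL a (m + n) = mulGL (powGL a m) (powGL a n) := by
  induction m with
  | zero => simp [powGL]
  | succ m ih => rw [Nat.succ_add, powGL, ih, powGL, mulGL_assoc]

/-- The character of the `n`-th tensor power, bracketed to the right. -/
def powChar (a : GroupLike k H) (χ : WithConv (H →ₗ[k] k)) : ℕ → WithConv (H →ₗ[k] k)
  | 0 => 1
  | n + 1 => tensorChar a (powGL a n) χ (powChar a χ n)

lemma IsYDCharacter.pow (hχ : IsYDCharacter a χ) : ∀ n, IsYDCharacter (powGL a n) (powChar a χ n)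
  | 0 => isYDCharacter_one
  | n + 1 => hχ.tensor (hχ.pow n)

lemma powChar_add (hχ : IsYDCharacter a χ) (m n : ℕ) : powChar a χ (m + n) =
    tensorChar (powGL a m) (powGL a n) (powChar a χ m) (powChar a χ n) := by
  induction m with
  | zero => simp [powGL, powChar, tensorChar_one_left]
  | succ m ih =>
    rw [Nat.succ_add, powChar, ih, powGL_add, powGL, powChar,
      tensorChar_assoc hχ (hχ.pow m) (hχ.pow n)]

/-- The functionals `χ_[n]` are the characters of the tensor powers. -/
lemma powChar_eq_chiN (a : GroupLike k H) (χ : H →ₗ[k] k) (n : ℕ) :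
    powChar a (toConv χ) n = toConv (chiN a.val χ n) := by
  have hL : ∀ b : GroupLike k H, sliceLeft (omega k H) a.val b.val = (omL a b).val := fun _ => rfl
  have hM : ∀ b : GroupLike k H, sliceMid (omegaInv k H) a.val b.val = (omM a b)⁻¹.val :=
    fun _ => rfl
  have hR : ∀ b : GroupLike k H, sliceRight (omega k H) a.val b.val = (omR a b).val :=
    fun _ => rfl
  induction n with
  | zero => simp [powChar, chiN]
  | succ n ih =>
    rw [powChar, ih]
    simp only [chiN, ← powGL_val, hL, hM, hR, tensorChar, toConv_ofConv]
    rw [List.prod_range_succ (fun i => (omR a (powGL a i)).val), List.prod_range_succ']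
    simp only [mul_assoc, Nat.add_sub_cancel, Nat.sub_zero, Nat.succ_eq_add_one, Nat.sub_sub,
      Nat.add_comm 1]

end Datum

/-! ### Gaussian binomial coefficients -/

section Gauss

open Finset.HasAntidiagonal (antidiagonal mem_antidiagonal)

variable {k : Type u} [Field k] (q : k) {M : Type*} [AddCommGroup M] [Module k M]

lemma qBinom_zero_right (n : ℕ) : qBinom q n 0 = 1 := by
  cases n <;> simp [qBinom]

lemma qBinom_succ_succ (n i : ℕ) :
    qBinom q (n + 1) (i + 1) = qBinom q n i + q ^ (i + 1) * qBinom q n (i + 1) := by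
  rw [qBinom]

lemma qBinom_eq_zero_of_lt {n i : ℕ} (h : n < i) : qBinom q n i = 0 := by
  induction n generalizing i with
  | zero =>
    obtain ⟨i, rfl⟩ := Nat.exists_eq_succ_of_ne_zero h.ne'
    simp [qBinom]
  | succ n ih =>
    obtain ⟨i, rfl⟩ := Nat.exists_eq_succ_of_ne_zero (Nat.ne_zero_of_lt h)
    rw [Nat.succ_eq_add_one, qBinom_succ_succ, ih (by omega), ih (by omega)]
    simp

lemma qBinom_self (n : ℕ) : qBinom q n n = 1 := by
  induction n with
  | zero => simp [qBinom]
  | succ n ih => rw [qBinom_succ_succ, ih, qBinom_eq_zero_of_lt q (Nat.lt_succ_self n)]; simp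

/-- The `q`-Pascal rule for sums weighted by Gaussian binomial coefficients. -/
lemma sum_qBinom_succ (n : ℕ) (F : ℕ → ℕ → M) :
    ∑ x ∈ antidiagonal (n + 1), qBinom q (n + 1) x.1 • F x.1 x.2 =
      ∑ x ∈ antidiagonal n, qBinom q n x.1 • (F (x.1 + 1) x.2 + q ^ x.1 • F x.1 (x.2 + 1)) := by
  have h : ∑ x ∈ antidiagonal n, (qBinom q n x.1 * q ^ x.1) • F x.1 (x.2 + 1) =
      F 0 (n + 1) + ∑ x ∈ antidiagonal n,
        (q ^ (x.1 + 1) * qBinom q n (x.1 + 1)) • F (x.1 + 1) x.2 := by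
    have h₁ := Finset.Nat.sum_antidiagonal_succ (n := n)
      (f := fun x => (qBinom q n x.1 * q ^ x.1) • F x.1 x.2)
    have h₂ := Finset.Nat.sum_antidiagonal_succ' (n := n)
      (f := fun x => (qBinom q n x.1 * q ^ x.1) • F x.1 x.2)
    simp only [qBinom_eq_zero_of_lt q (Nat.lt_succ_self n), qBinom_zero_right, zero_mul, zero_smul,
      pow_zero, mul_one, one_smul] at h₁ h₂
    rw [zero_add] at h₂
    rw [← h₂, h₁]
    simp only [mul_comm]
  rw [Finset.Nat.sum_antidiagonal_succ]
  simp only [smul_add, smul_smul, Finset.sum_add_distrib, h, qBinom_zero_right, one_smul,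
    qBinom_succ_succ, add_smul]
  abel

/-- The `q`-Vandermonde identity, weighted by an arbitrary function. -/
lemma sum_qBinom_add (a b : ℕ) (F : ℕ → ℕ → M) :
    ∑ x ∈ antidiagonal (a + b), qBinom q (a + b) x.1 • F x.1 x.2 =
      ∑ x ∈ antidiagonal a, ∑ y ∈ antidiagonal b,
        (qBinom q a x.1 * qBinom q b y.1 * q ^ (x.2 * y.1)) • F (x.1 + y.1) (x.2 + y.2) := by
  induction a generalizing F with
  | zero => simp [qBinom_zero_right]
  | succ a ih =>
    have e := sum_qBinom_succ q a fun i p => ∑ y ∈ antidiagonal b,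
      (qBinom q b y.1 * q ^ (p * y.1)) • F (i + y.1) (p + y.2)
    simp only [Finset.smul_sum, smul_smul, ← mul_assoc] at e
    rw [e, Nat.add_right_comm, sum_qBinom_succ q (a + b) F,
      ih fun n m => F (n + 1) m + q ^ n • F n (m + 1)]
    refine Finset.sum_congr rfl fun x _ => ?_
    simp only [Finset.smul_sum, ← Finset.sum_add_distrib]
    refine Finset.sum_congr rfl fun y _ => ?_
    rw [smul_add, smul_add, smul_smul, smul_smul, smul_smul,
      Nat.add_right_comm x.1, Nat.add_right_comm x.2]
    ring_nf

/-- The two iterated expansions into Gaussian trinomial coefficients agree. -/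
lemma sum_qBinom_assoc (n : ℕ) (F : ℕ → ℕ → ℕ → M) :
    ∑ x ∈ antidiagonal n, ∑ y ∈ antidiagonal x.1,
        (qBinom q n x.1 * qBinom q x.1 y.1) • F y.1 y.2 x.2 =
      ∑ x ∈ antidiagonal n, ∑ y ∈ antidiagonal x.2,
        (qBinom q n x.1 * qBinom q x.2 y.1) • F x.1 y.1 y.2 := by
  induction n generalizing F with
  | zero => simp
  | succ n ih =>
    have eL := sum_qBinom_succ q n fun m l => ∑ y ∈ antidiagonal m,
      qBinom q m y.1 • F y.1 y.2 l
    have eR := sum_qBinom_succ q n fun i s => ∑ y ∈ antidiagonal s, qBinom q s y.1 • F i y.1 y.2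
    simp only [fun m l => sum_qBinom_succ q m fun i j => F i j l] at eL
    simp only [fun s i => sum_qBinom_succ q s (F i)] at eR
    simp only [Finset.smul_sum, smul_smul] at eL eR
    rw [eL, eR]
    have h := ih fun i j l => F (i + 1) j l + q ^ i • (F i (j + 1) l + q ^ j • F i j (l + 1))
    calc _ = _ := ?_
      _ = _ := h
      _ = _ := ?_
    · refine Finset.sum_congr rfl fun x _ => ?_
      simp only [Finset.smul_sum, ← Finset.sum_add_distrib]
      refine Finset.sum_congr rfl fun y hy => ?_
      rw [← mem_antidiagonal.mp hy, pow_add]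
      module
    · refine Finset.sum_congr rfl fun x _ => ?_
      simp only [Finset.smul_sum, ← Finset.sum_add_distrib]
      refine Finset.sum_congr rfl fun y _ => ?_
      module

/-- The `q`-integer `1 + q + ⋯ + q ^ (n - 1)`. -/
def qInt (n : ℕ) : k := ∑ i ∈ Finset.range n, q ^ i

/-- The `q`-factorial. -/
def qFactorial (n : ℕ) : k := ∏ i ∈ Finset.range n, qInt q (i + 1)

lemma qFactorial_succ (n : ℕ) : qFactorial q (n + 1) = qFactorial q n * qInt q (n + 1) :=
  Finset.prod_range_succ _ _

lemma qInt_add (a b : ℕ) : qInt q (a + b) = qInt q a + q ^ a * qInt q b := by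
  simp only [qInt, Finset.sum_range_add, pow_add, Finset.mul_sum]

lemma qBinom_mul_qFactorial (a b : ℕ) :
    qBinom q (a + b) a * (qFactorial q a * qFactorial q b) = qFactorial q (a + b) := by
  induction a generalizing b with
  | zero => simp [qBinom_zero_right, qFactorial]
  | succ a iha =>
    induction b with
    | zero => simp [qBinom_self, qFactorial]
    | succ b ihb =>
      have h₁ := iha (b + 1)
      have e₁ : a + (b + 1) = a + b + 1 := by ring
      have e₂ : a + 1 + b = a + b + 1 := by ring
      have e₃ : a + 1 + (b + 1) = a + b + 1 + 1 := by ring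
      have e₄ : qInt q (a + b + 1 + 1) = qInt q (a + 1) + q ^ (a + 1) * qInt q (b + 1) := by
        rw [← qInt_add]; congr 1; ring
      rw [e₁, qFactorial_succ q b] at h₁
      rw [e₂, qFactorial_succ q a] at ihb
      rw [e₃, qBinom_succ_succ, qFactorial_succ q a, qFactorial_succ q b,
        qFactorial_succ q (a + b + 1), e₄]
      linear_combination qInt q (a + 1) * h₁ + q ^ (a + 1) * qInt q (b + 1) * ihb

variable {q}

lemma qInt_ne_zero {N n : ℕ} (hprim : IsPrimitiveRoot q N) (h0 : 0 < n) (hn : n < N) :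
    qInt q n ≠ 0 := by
  intro h
  have := mul_neg_geom_sum q n
  rw [← qInt, h, mul_zero] at this
  exact hprim.pow_ne_one_of_pos_of_lt h0.ne' hn (sub_eq_zero.mp this.symm).symm

lemma qInt_eq_zero {N : ℕ} (hprim : IsPrimitiveRoot q N) (hq : q ≠ 1) : qInt q N = 0 := by
  have := mul_neg_geom_sum q N
  rw [hprim.pow_eq_one, sub_self] at this
  exact (mul_eq_zero.mp this).resolve_left (sub_ne_zero.mpr hq.symm)

/-- At a primitive `N`-th root of unity `q ≠ 1`, the Gaussian binomial coefficient `(a + b, a)`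
vanishes if `a, b < N ≤ a + b`. -/
lemma qBinom_eq_zero {N a b : ℕ} (hprim : IsPrimitiveRoot q N) (hq : q ≠ 1) (ha : a < N)
    (hb : b < N) (hab : N ≤ a + b) : qBinom q (a + b) a = 0 := by
  have hne : ∀ n < N, qFactorial q n ≠ 0 := fun n hn => by
    refine Finset.prod_ne_zero_iff.mpr fun i hi => qInt_ne_zero hprim i.succ_pos ?_
    have := Finset.mem_range.mp hi
    omega
  have hz : qFactorial q (a + b) = 0 := by
    refine Finset.prod_eq_zero (i := N - 1) (Finset.mem_range.mpr (by omega)) ?_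
    rw [Nat.sub_add_cancel (by omega), qInt_eq_zero hprim hq]
  have h := qBinom_mul_qFactorial q a b
  rw [hz] at h
  exact (mul_eq_zero.mp h).resolve_right (mul_ne_zero (hne a ha) (hne b hb))

end Gauss

/-! ### The reassociator on powers of a group-like element -/

section Scalars

variable {k : Type u} {H : Type v} [Field k] [NonAssocRing H] [Module k H]
  [SMulCommClass k H H] [IsScalarTower k H H] [Coalgebra k H] [DualQuasiBialgebra k H]

lemma conv_apply_groupLike {C : Type*} [AddCommMonoid C] [Module k C] [Coalgebra k C]
    (φ ψ : WithConv (C →ₗ[k] k)) (x : GroupLike k C) : (φ * ψ) x.val = φ x.val * ψ x.val := by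
  simp [x.isGroupLikeElem_val.comul_eq_tmul_self]

lemma conv_inv_apply_groupLike {C : Type*} [AddCommMonoid C] [Module k C] [Coalgebra k C]
    (φ : (WithConv (C →ₗ[k] k))ˣ) (x : GroupLike k C) :
    φ.val x.val ≠ 0 ∧ φ⁻¹.val x.val = (φ.val x.val)⁻¹ := by
  have h : φ.val x.val * φ⁻¹.val x.val = 1 := by
    rw [← conv_apply_groupLike, φ.mul_inv]
    simp [x.isGroupLikeElem_val.counit_eq_one]
  exact ⟨left_ne_zero_of_mul_eq_one h, eq_inv_of_mul_eq_one_right h⟩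

variable (γ : GroupLike k H)

/-- The scalar `ω (γᵃ ⊗ γᵇ ⊗ γᶜ)`. -/
def powOmega (a b c : ℕ) : k :=
  omega k H (((powGL γ a).val ⊗ₜ (powGL γ b).val) ⊗ₜ (powGL γ c).val)

lemma powOmega_ne_zero (a b c : ℕ) : powOmega γ a b c ≠ 0 :=
  (conv_inv_apply_groupLike (omR (powGL γ a) (powGL γ b)) (powGL γ c)).1

lemma omegaInv_powGL (a b c : ℕ) :
    omegaInv k H (((powGL γ a).val ⊗ₜ (powGL γ b).val) ⊗ₜ (powGL γ c).val) =
      (powOmega γ a b c)⁻¹ :=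
  (conv_inv_apply_groupLike (omR (powGL γ a) (powGL γ b)) (powGL γ c)).2

lemma powOmega_cocycle (a b c d : ℕ) :
    powOmega γ b c d * powOmega γ a (b + c) d * powOmega γ a b c =
      powOmega γ a b (c + d) * powOmega γ (a + b) c d := by
  have h := congrArg (fun φ : (WithConv (H →ₗ[k] k))ˣ => φ.val (powGL γ c).val)
    (pentagon_R (powGL γ a) (powGL γ b) (powGL γ d))
  simp only [Units.val_mul, conv_apply_groupLike] at h
  simp only [powOmega, powGL_add]
  exact h

lemma powOmega_one_zero (b : ℕ) : powOmega γ 1 0 b = 1 :=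
  (omega_mid_one _ _).trans (by simp)

lemma powOmega_one_right_zero (b : ℕ) : powOmega γ 1 b 0 = 1 := by
  have h : (omM (powGL γ 1) (oneGL k H)).val (powGL γ b).val = 1 := by
    rw [omM_one_right]; simp
  exact h

/-- The cochain `f (a, b) = ∏_{i < a} ω (γ ⊗ γⁱ ⊗ γᵇ)` on `ℕ`. -/
def cochain (a b : ℕ) : k := ∏ i ∈ Finset.range a, powOmega γ 1 i b

lemma cochain_succ (a b : ℕ) : cochain γ (a + 1) b = cochain γ a b * powOmega γ 1 a b :=
  Finset.prod_range_succ _ _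

lemma cochain_ne_zero (a b : ℕ) : cochain γ a b ≠ 0 :=
  Finset.prod_ne_zero_iff.mpr fun _ _ => powOmega_ne_zero _ _ _ _

@[simp] lemma cochain_zero_left (b : ℕ) : cochain γ 0 b = 1 := rfl

@[simp] lemma cochain_zero_right (a : ℕ) : cochain γ a 0 = 1 :=
  Finset.prod_eq_one fun _ _ => powOmega_one_right_zero _ _

@[simp] lemma cochain_one_left (b : ℕ) : cochain γ 1 b = 1 := by
  simp [cochain, powOmega_one_zero]

/-- On the powers of `γ`, indexed by `ℕ`, the reassociator is the coboundary of `cochain`. -/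
lemma powOmega_eq (a b c : ℕ) : powOmega γ a b c =
    cochain γ a b * cochain γ (a + b) c / (cochain γ b c * cochain γ a (b + c)) := by
  rw [eq_div_iff (mul_ne_zero (cochain_ne_zero _ _ _) (cochain_ne_zero _ _ _))]
  induction a with
  | zero =>
    have h : powOmega γ 0 b c = 1 := by
      have h : (omR (oneGL k H) (powGL γ b)).val (powGL γ c).val = 1 := by
        rw [omR_one_left]; simp
      exact h
    simp [h]
  | succ a ih =>
    have h := powOmega_cocycle γ 1 a b c
    rw [Nat.add_comm 1 a] at h
    rw [cochain_succ, Nat.succ_add, cochain_succ, cochain_succ]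
    linear_combination powOmega γ 1 (a + b) c * powOmega γ 1 a b * ih -
      cochain γ b c * cochain γ a (b + c) * h

/-- The braiding coefficients are, up to the coboundary of `cochain`, those of the bicharacter
`(a, b) ↦ q ^ (a * b)`. -/
lemma powChar_powGL {χ : WithConv (H →ₗ[k] k)} (hχ : IsYDCharacter γ χ) {q : k}
    (hq : χ γ.val = q) (a b : ℕ) :
    powChar γ χ b (powGL γ a).val = q ^ (a * b) * cochain γ b a / cochain γ a b := by
  have pow_one : powGL γ 1 = γ := mulGL_one γ
  have h1 : ∀ a, χ (powGL γ a).val = q ^ a / cochain γ a 1 := by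
    intro a
    induction a with
    | zero => simpa [powGL] using hχ.map_one
    | succ a ih =>
      have h := congrArg (fun φ : WithConv (H ⊗[k] H →ₗ[k] k) =>
        φ (tensorGL γ (powGL γ a)).val) hχ.map_mul
      simp only [conv_apply_groupLike, (conv_inv_apply_groupLike _ _).2] at h
      have e₁ : (omLM γ).val (tensorGL γ (powGL γ a)).val = powOmega γ 1 a 1 := by
        rw [powOmega, pow_one]; rfl
      have e₂ : (omLR γ).val (tensorGL γ (powGL γ a)).val ≠ 0 := (conv_inv_apply_groupLike _ _).1
      have e₃ : (omMR γ).val (tensorGL γ (powGL γ a)).val =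
        (omLR γ).val (tensorGL γ (powGL γ a)).val := rfl
      have e₄ : pull (mulHom k H) χ (tensorGL γ (powGL γ a)).val = χ (powGL γ (a + 1)).val := rfl
      have e₅ : pull prR χ (tensorGL γ (powGL γ a)).val = χ (powGL γ a).val := by
        rw [pull_apply, tensorGL_val, prR_tmul, counit_val, one_smul]
      have e₆ : pull prL χ (tensorGL γ (powGL γ a)).val = q := by
        rw [pull_apply, tensorGL_val, prL_tmul, counit_val, one_smul, hq]
      rw [e₁, e₃, e₄, e₅, e₆, ih] at h
      have n₁ := powOmega_ne_zero γ 1 a 1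
      have n₂ := cochain_ne_zero γ a 1
      rw [h, cochain_succ, pow_succ]
      field_simp
  induction b with
  | zero => simp [powChar]
  | succ b ih =>
    have e₁ : (omL γ (powGL γ b)).val (powGL γ a).val = powOmega γ a 1 b := by
      rw [powOmega, pow_one]; rfl
    have e₂ : (omM γ (powGL γ b)).val (powGL γ a).val = powOmega γ 1 a b := by
      rw [powOmega, pow_one]; rfl
    have e₃ : (omR γ (powGL γ b)).val (powGL γ a).val = powOmega γ 1 b a := by
      rw [powOmega, pow_one]; rfl
    rw [powChar, tensorChar]
    simp only [conv_apply_groupLike, (conv_inv_apply_groupLike _ _).2]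
    rw [e₁, e₂, e₃, h1, ih, powOmega_eq γ a 1 b, cochain_succ γ b a, cochain_succ γ a b,
      cochain_one_left, Nat.add_comm 1 b]
    have n₁ := powOmega_ne_zero γ 1 a b
    have n₂ := cochain_ne_zero γ a 1
    have n₃ := cochain_ne_zero γ a b
    have n₄ := cochain_ne_zero γ a (b + 1)
    field_simp
    ring

end Scalars

/-! ### The structure maps of the category on homogeneous vectors -/

section Homogeneous

variable {k : Type u} {H : Type v} [Field k] [NonAssocRing H] [Module k H] [Coalgebra k H]
variable {U V W : Type*} [AddCommGroup U] [Module k U] [AddCommGroup V] [Module k V]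
  [AddCommGroup W] [Module k W]
variable {φ : ((H ⊗[k] H) ⊗[k] H) →ₗ[k] k}
  {ρU : U →ₗ[k] H ⊗[k] U} {ρV : V →ₗ[k] H ⊗[k] V} {ρW : W →ₗ[k] H ⊗[k] W}
  {u : U} {v : V} {w : W} {a b c : H}

lemma twist_homogeneous (hu : ρU u = a ⊗ₜ u) (hv : ρV v = b ⊗ₜ v) (hw : ρW w = c ⊗ₜ w) :
    twist φ ρU ρV ρW ((u ⊗ₜ v) ⊗ₜ w) = φ ((a ⊗ₜ b) ⊗ₜ c) • ((u ⊗ₜ v) ⊗ₜ w) := by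
  simp [twist, coactPair, hu, hv, hw]

/-- If two of the three tensor factors are homogeneous and the third one is `H` with its regular
coaction, then twisting by `φ` acts on `H` by `hitL` of the slice of `φ` at the two degrees. -/
lemma twist_comul_left {ψ : WithConv (H →ₗ[k] k)} (hv : ρV v = a ⊗ₜ v) (hw : ρW w = b ⊗ₜ w)
    (hψ : ∀ x, φ ((x ⊗ₜ a) ⊗ₜ b) = ψ x) (h : H) :
    twist φ comul ρV ρW ((h ⊗ₜ v) ⊗ₜ w) = (hitL ψ h ⊗ₜ v) ⊗ₜ w := by
  simp only [twist, coactPair, LinearMap.comp_apply, TensorProduct.map_tmul, hv, hw, hitL,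
    LinearEquiv.coe_coe]
  induction (comul h : H ⊗[k] H) using TensorProduct.induction_on with
  | zero => simp
  | tmul x y => simp [hψ, ← smul_tmul']
  | add x y hx hy => simp only [map_add, add_tmul, hx, hy]

lemma twist_comul_mid {ψ : WithConv (H →ₗ[k] k)} (hu : ρU u = a ⊗ₜ u) (hw : ρW w = b ⊗ₜ w)
    (hψ : ∀ x, φ ((a ⊗ₜ x) ⊗ₜ b) = ψ x) (h : H) :
    twist φ ρU comul ρW ((u ⊗ₜ h) ⊗ₜ w) = (u ⊗ₜ hitL ψ h) ⊗ₜ w := by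
  simp only [twist, coactPair, LinearMap.comp_apply, TensorProduct.map_tmul, hu, hw, hitL,
    LinearEquiv.coe_coe]
  induction (comul h : H ⊗[k] H) using TensorProduct.induction_on with
  | zero => simp
  | tmul x y => simp [hψ, ← smul_tmul', tmul_smul]
  | add x y hx hy => simp only [map_add, add_tmul, tmul_add, hx, hy]

lemma twist_comul_right {ψ : WithConv (H →ₗ[k] k)} (hu : ρU u = a ⊗ₜ u) (hv : ρV v = b ⊗ₜ v)
    (hψ : ∀ x, φ ((a ⊗ₜ b) ⊗ₜ x) = ψ x) (h : H) :
    twist φ ρU ρV comul ((u ⊗ₜ v) ⊗ₜ h) = (u ⊗ₜ v) ⊗ₜ hitL ψ h := by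
  simp only [twist, coactPair, LinearMap.comp_apply, TensorProduct.map_tmul, hu, hv, hitL,
    LinearEquiv.coe_coe]
  induction (comul h : H ⊗[k] H) using TensorProduct.induction_on with
  | zero => simp
  | tmul x y => simp [hψ, tmul_smul]
  | add x y hx hy => simp only [map_add, tmul_add, hx, hy]

variable (H) in
/-- The insertion `h ⊗ l ↦ h ⊗ v ⊗ l`. -/
def insMid (v : V) : H ⊗[k] H →ₗ[k] (H ⊗[k] V) ⊗[k] H :=
  LinearMap.rTensor H ((TensorProduct.mk k H V).flip v)

variable (H) in
/-- The insertion `h ⊗ l ↦ v ⊗ h ⊗ l`. -/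
def insLeft (v : V) : H ⊗[k] H →ₗ[k] (V ⊗[k] H) ⊗[k] H :=
  LinearMap.rTensor H (TensorProduct.mk k V H v)

lemma twist_comul_left_mid {ψ : WithConv (H ⊗[k] H →ₗ[k] k)} (hw : ρW w = a ⊗ₜ w)
    (hψ : ∀ x, φ (x ⊗ₜ a) = ψ x) (t : H ⊗[k] H) :
    twist φ comul comul ρW (t ⊗ₜ w) = hitL ψ t ⊗ₜ w := by
  have key : ∀ s s' : H ⊗[k] H, TensorProduct.lid k ((H ⊗[k] H) ⊗[k] W)
      (LinearMap.rTensor ((H ⊗[k] H) ⊗[k] W) φ (TensorProduct.tensorTensorTensorComm k _ _ _ _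
        (TensorProduct.tensorTensorTensorComm k H H H H (s ⊗ₜ s') ⊗ₜ (a ⊗ₜ[k] w)))) =
      (TensorProduct.lid k (H ⊗[k] H) (LinearMap.rTensor (H ⊗[k] H) ψ.ofConv
        (TensorProduct.AlgebraTensorModule.tensorTensorTensorComm k k k k H H H H (s ⊗ₜ s')))) ⊗ₜ
        w := by
    intro s s'
    induction s using TensorProduct.induction_on with
    | zero => simp
    | add x y hx hy => simp only [map_add, add_tmul, hx, hy]
    | tmul x y =>
      induction s' using TensorProduct.induction_on with
      | zero => simp
      | add x y hx hy => simp only [map_add, add_tmul, tmul_add, hx, hy]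
      | tmul z w => simp [hψ, ← smul_tmul']
  induction t using TensorProduct.induction_on with
  | zero => simp
  | add x y hx hy => simp only [map_add, add_tmul, hx, hy]
  | tmul h l =>
    simp only [twist, coactPair, LinearMap.comp_apply, TensorProduct.map_tmul, hw, hitL,
      LinearEquiv.coe_coe, TensorProduct.comul_tmul]
    exact key _ _

lemma twist_comul_left_right {ψ : WithConv (H ⊗[k] H →ₗ[k] k)} (hv : ρV v = a ⊗ₜ v)
    (hψ : ∀ x y, φ ((x ⊗ₜ a) ⊗ₜ y) = ψ (x ⊗ₜ y)) (t : H ⊗[k] H) :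
    twist φ comul ρV comul (insMid H v t) = insMid H v (hitL ψ t) := by
  have key : ∀ s s' : H ⊗[k] H, TensorProduct.lid k ((H ⊗[k] V) ⊗[k] H)
      (LinearMap.rTensor ((H ⊗[k] V) ⊗[k] H) φ (TensorProduct.tensorTensorTensorComm k _ _ _ _
        (TensorProduct.tensorTensorTensorComm k H H H V (s ⊗ₜ (a ⊗ₜ[k] v)) ⊗ₜ s'))) =
      insMid H v (TensorProduct.lid k (H ⊗[k] H) (LinearMap.rTensor (H ⊗[k] H) ψ.ofConv
        (TensorProduct.AlgebraTensorModule.tensorTensorTensorComm k k k k H H H H (s ⊗ₜ s')))) := by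
    intro s s'
    induction s using TensorProduct.induction_on with
    | zero => simp
    | add x y hx hy => simp only [map_add, add_tmul, hx, hy]
    | tmul x y =>
      induction s' using TensorProduct.induction_on with
      | zero => simp
      | add x y hx hy => simp only [map_add, tmul_add, hx, hy]
      | tmul z w => simp [hψ, insMid]
  induction t using TensorProduct.induction_on with
  | zero => simp
  | add x y hx hy => simp only [map_add, hx, hy]
  | tmul h l =>
    rw [insMid, LinearMap.rTensor_tmul]
    simp only [twist, coactPair, LinearMap.comp_apply, LinearMap.flip_apply,
      TensorProduct.mk_apply, TensorProduct.map_tmul, hv, hitL,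
      LinearEquiv.coe_coe, TensorProduct.comul_tmul]
    exact key _ _

lemma twist_comul_mid_right {ψ : WithConv (H ⊗[k] H →ₗ[k] k)} (hv : ρV v = a ⊗ₜ v)
    (hψ : ∀ x y, φ ((a ⊗ₜ x) ⊗ₜ y) = ψ (x ⊗ₜ y)) (t : H ⊗[k] H) :
    twist φ ρV comul comul (insLeft H v t) = insLeft H v (hitL ψ t) := by
  have key : ∀ s s' : H ⊗[k] H, TensorProduct.lid k ((V ⊗[k] H) ⊗[k] H)
      (LinearMap.rTensor ((V ⊗[k] H) ⊗[k] H) φ (TensorProduct.tensorTensorTensorComm k _ _ _ _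
        (TensorProduct.tensorTensorTensorComm k H V H H ((a ⊗ₜ[k] v) ⊗ₜ s) ⊗ₜ s'))) =
      insLeft H v (TensorProduct.lid k (H ⊗[k] H) (LinearMap.rTensor (H ⊗[k] H) ψ.ofConv
        (TensorProduct.AlgebraTensorModule.tensorTensorTensorComm k k k k H H H H (s ⊗ₜ s')))) := by
    intro s s'
    induction s using TensorProduct.induction_on with
    | zero => simp
    | add x y hx hy => simp only [map_add, add_tmul, tmul_add, hx, hy]
    | tmul x y =>
      induction s' using TensorProduct.induction_on with
      | zero => simp
      | add x y hx hy => simp only [map_add, tmul_add, hx, hy]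
      | tmul z w => simp [hψ, insLeft]
  induction t using TensorProduct.induction_on with
  | zero => simp
  | add x y hx hy => simp only [map_add, hx, hy]
  | tmul h l =>
    rw [insLeft, LinearMap.rTensor_tmul]
    simp only [twist, coactPair, LinearMap.comp_apply,
      TensorProduct.mk_apply, TensorProduct.map_tmul, hv, hitL,
      LinearEquiv.coe_coe, TensorProduct.comul_tmul]
    exact key _ _

lemma braid_comul {actV : H ⊗[k] V →ₗ[k] V} {χ : WithConv (H →ₗ[k] k)}
    (hv : ∀ h, actV (h ⊗ₜ v) = χ h • v) (h : H) : braid comul actV (h ⊗ₜ v) = v ⊗ₜ hitL χ h := by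
  simp only [braid, LinearMap.comp_apply, LinearMap.rTensor_tmul, hitL, LinearEquiv.coe_coe]
  induction (comul h : H ⊗[k] H) using TensorProduct.induction_on with
  | zero => simp
  | tmul x y => simp [hv, smul_tmul]
  | add x y hx hy => simp only [map_add, add_tmul, tmul_add, hx, hy]

lemma braid_homogeneous {actW : H ⊗[k] W →ₗ[k] W} {s : k} (hu : ρU u = a ⊗ₜ u)
    (hw : actW (a ⊗ₜ w) = s • w) : braid ρU actW (u ⊗ₜ w) = s • (w ⊗ₜ u) := by
  simp [braid, hu, hw, smul_tmul']

variable [SMulCommClass k H H] [IsScalarTower k H H]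

lemma tensorCoact_homogeneous (hv : ρV v = a ⊗ₜ v) (hw : ρW w = b ⊗ₜ w) :
    tensorCoact ρV ρW (v ⊗ₜ w) = (a * b) ⊗ₜ (v ⊗ₜ w) := by
  simp [tensorCoact, coactPair, hv, hw]

/-- The compatibility of action and coaction on a homogeneous vector. -/
lemma compat_homogeneous {actV : H ⊗[k] V →ₗ[k] V} {χ : WithConv (H →ₗ[k] k)}
    (hρ : ρV v = a ⊗ₜ v) (hv : ∀ h, actV (h ⊗ₜ v) = χ h • v)
    (hχ : ∀ h, a * hitL χ h = hitR χ h * a) (h : H) :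
    LinearMap.rTensor V (LinearMap.mul' k H) (TensorProduct.rightComm k H V H
      (LinearMap.rTensor H ρV (braid comul actV (h ⊗ₜ v)))) =
    TensorProduct.map (LinearMap.mul' k H) actV (coactPair comul ρV (h ⊗ₜ v)) := by
  have e : TensorProduct.map (LinearMap.mul' k H) actV (coactPair comul ρV (h ⊗ₜ v)) =
      (hitR χ h * a) ⊗ₜ v := by
    simp only [coactPair, LinearMap.comp_apply, TensorProduct.map_tmul, hρ, hitR,
      LinearEquiv.coe_coe]
    induction (comul h : H ⊗[k] H) using TensorProduct.induction_on with
    | zero => simp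
    | tmul x y => simp [hv, tmul_smul, smul_tmul', smul_mul_assoc]
    | add x y hx hy => simp only [map_add, add_tmul, hx, hy, add_mul]
  rw [e, braid_comul hv, ← hχ]
  simp [hρ]

variable [DualQuasiBialgebra k H]

lemma tensorAct_homogeneous {actV : H ⊗[k] V →ₗ[k] V} {actW : H ⊗[k] W →ₗ[k] W}
    {α β : GroupLike k H} {χ ψ : WithConv (H →ₗ[k] k)}
    (hv : ρV v = α.val ⊗ₜ v) (hw : ρW w = β.val ⊗ₜ w)
    (hv' : ∀ h, actV (h ⊗ₜ v) = χ h • v) (hw' : ∀ h, actW (h ⊗ₜ w) = ψ h • w) (h : H) :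
    tensorAct ρV actV ρW actW (h ⊗ₜ (v ⊗ₜ w)) = tensorChar α β χ ψ h • (v ⊗ₜ w) := by
  simp only [tensorAct, assocYD, assocInvYD, LinearMap.comp_apply, LinearEquiv.coe_coe,
    TensorProduct.assoc_symm_tmul]
  rw [twist_comul_left hv hw (fun x => (omL_apply α β x).symm), LinearMap.rTensor_tmul,
    braid_comul hv', twist_comul_mid hv hw (fun x => (omM_inv_apply α β x).symm),
    TensorProduct.assoc_tmul, LinearMap.lTensor_tmul, braid_comul hw',
    TensorProduct.assoc_symm_tmul, twist_comul_right hv hw (fun x => (omR_apply α β x).symm),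
    hitL_hitL, hitL_hitL, hitL_hitL, hitL_hitL, LinearMap.lTensor_tmul, counit_hitL]
  rw [TensorProduct.rid_tmul, tensorChar]
  simp only [mul_assoc]

lemma mul_act_homogeneous {actV : H ⊗[k] V →ₗ[k] V} {α : GroupLike k H}
    {χ : WithConv (H →ₗ[k] k)} (hχ : IsYDCharacter α χ)
    (hv : ρV v = α.val ⊗ₜ v) (hv' : ∀ h, actV (h ⊗ₜ v) = χ h • v) (t : H ⊗[k] H) :
    (actV ∘ₗ LinearMap.rTensor V (LinearMap.mul' k H)) (t ⊗ₜ v) =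
      ((TensorProduct.rid k V).toLinearMap ∘ₗ LinearMap.lTensor V counit ∘ₗ
      assocYD ρV comul comul ∘ₗ LinearMap.rTensor H (braid comul actV) ∘ₗ
      assocInvYD comul ρV comul ∘ₗ LinearMap.lTensor H (braid comul actV) ∘ₗ
      assocYD comul comul ρV) (t ⊗ₜ v) := by
  have h₁ : ∀ t : H ⊗[k] H, (TensorProduct.assoc k H V H).symm
      (LinearMap.lTensor H (braid comul actV) (TensorProduct.assoc k H H V (t ⊗ₜ v))) =
      insMid H v (hitL (pull prR χ) t) := by
    intro t
    induction t using TensorProduct.induction_on with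
    | zero => simp
    | add x y hx hy => simp only [map_add, add_tmul, hx, hy]
    | tmul x y => simp [hitL_pull_prR, braid_comul hv', insMid]
  have h₂ : ∀ t : H ⊗[k] H, LinearMap.rTensor H (braid comul actV) (insMid H v t) =
      insLeft H v (hitL (pull prL χ) t) := by
    intro t
    induction t using TensorProduct.induction_on with
    | zero => simp
    | add x y hx hy => simp only [map_add, hx, hy]
    | tmul x y => simp [hitL_pull_prL, braid_comul hv', insMid, insLeft]
  have h₃ : ∀ t : H ⊗[k] H, TensorProduct.rid k V (LinearMap.lTensor V counit
      (TensorProduct.assoc k V H H (insLeft H v t))) = counit (R := k) t • v := by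
    intro t
    induction t using TensorProduct.induction_on with
    | zero => simp
    | add x y hx hy => simp only [map_add, hx, hy, add_smul]
    | tmul x y => simp [insLeft]
  simp only [assocYD, assocInvYD, LinearMap.comp_apply, LinearEquiv.coe_coe]
  rw [twist_comul_left_mid hv (φ := omegaInv k H) (ψ := (omLM α)⁻¹.val) (fun x => rfl), h₁,
    twist_comul_left_right hv (φ := omega k H) (ψ := (omLR α).val) (fun x y => rfl), h₂,
    twist_comul_mid_right hv (φ := omegaInv k H) (ψ := (omMR α)⁻¹.val) (fun x y => rfl), h₃,
    hitL_hitL, hitL_hitL, hitL_hitL, hitL_hitL, counit_hitL, LinearMap.rTensor_tmul, hv']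
  have h := congrArg (fun φ : WithConv (H ⊗[k] H →ₗ[k] k) => φ t) hχ.map_mul
  simp only [mul_assoc] at h
  exact congrArg (· • v) h

end Homogeneous

/-! ### The quantum line as a bialgebra of Yetter–Drinfeld modules -/

section Bialgebra

open Finset.HasAntidiagonal (antidiagonal mem_antidiagonal)

lemma span_range_tmul {k : Type*} [Field k] {M N ι κ : Type*} [AddCommGroup M] [Module k M]
    [AddCommGroup N] [Module k N] {s : ι → M} {t : κ → N}
    (hs : Submodule.span k (Set.range s) = ⊤) (ht : Submodule.span k (Set.range t) = ⊤) :
    Submodule.span k (Set.range fun p : ι × κ => s p.1 ⊗ₜ[k] t p.2) = ⊤ := by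
  rw [← TensorProduct.map₂_mk_top_top_eq_top, ← hs, ← ht, Submodule.map₂_span_span]
  congr 1
  ext z
  simp [Set.mem_image2]

lemma span_range_id {k : Type*} [Field k] {M : Type*} [AddCommGroup M] [Module k M] :
    Submodule.span k (Set.range (id : M → M)) = ⊤ := by simp

variable {k : Type u} {H : Type v} [Field k] [NonAssocRing H] [Module k H]
  [SMulCommClass k H H] [IsScalarTower k H H] [Coalgebra k H] [DualQuasiBialgebra k H]
variable {R : Type*} [AddCommGroup R] [Module k R]

/-- The maps `ρ`, `act`, `mul`, `Δ`, `ε` are given on the spanning family `x` by the formulas of the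
quantum line. The formulas are required for all `n : ℕ`: in the quantum line `x n = 0` for
`n ≥ N`. -/
structure IsQuantumLine (γ : GroupLike k H) (χ : WithConv (H →ₗ[k] k)) (q : k) (x : ℕ → R)
    (ρ : R →ₗ[k] H ⊗[k] R) (act : H ⊗[k] R →ₗ[k] R) (mul : R ⊗[k] R →ₗ[k] R)
    (Δ : R →ₗ[k] R ⊗[k] R) (ε : R →ₗ[k] k) : Prop where
  character : IsYDCharacter γ χ
  apply_self : χ γ.val = q
  span_eq_top : Submodule.span k (Set.range x) = ⊤
  coact_apply : ∀ n, ρ (x n) = (powGL γ n).val ⊗ₜ x n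
  act_apply : ∀ n h, act (h ⊗ₜ x n) = powChar γ χ n h • x n
  mul_apply : ∀ a b, mul (x a ⊗ₜ x b) = (cochain γ a b)⁻¹ • x (a + b)
  comul_apply : ∀ n, Δ (x n) = ∑ p ∈ antidiagonal n,
    (qBinom q n p.1 * cochain γ p.1 p.2) • (x p.1 ⊗ₜ[k] x p.2)
  counit_apply : ∀ n, ε (x n) = if n = 0 then 1 else 0

namespace IsQuantumLine

variable {γ : GroupLike k H} {χ : WithConv (H →ₗ[k] k)} {q : k} {x : ℕ → R}
  {ρ : R →ₗ[k] H ⊗[k] R} {act : H ⊗[k] R →ₗ[k] R} {mul : R ⊗[k] R →ₗ[k] R}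
  {Δ : R →ₗ[k] R ⊗[k] R} {ε : R →ₗ[k] k} (L : IsQuantumLine γ χ q x ρ act mul Δ ε)

include L

lemma ext₁ {M : Type*} [AddCommGroup M] [Module k M] {f f' : R →ₗ[k] M}
    (h : ∀ n, f (x n) = f' (x n)) : f = f' :=
  LinearMap.ext_on_range L.span_eq_top h

lemma ext₂ {M : Type*} [AddCommGroup M] [Module k M] {f f' : R ⊗[k] R →ₗ[k] M}
    (h : ∀ a b, f (x a ⊗ₜ x b) = f' (x a ⊗ₜ x b)) : f = f' :=
  LinearMap.ext_on_range (span_range_tmul L.span_eq_top L.span_eq_top) fun p => h p.1 p.2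

lemma ext₃ {M : Type*} [AddCommGroup M] [Module k M] {f f' : (R ⊗[k] R) ⊗[k] R →ₗ[k] M}
    (h : ∀ a b c, f ((x a ⊗ₜ x b) ⊗ₜ x c) = f' ((x a ⊗ₜ x b) ⊗ₜ x c)) : f = f' :=
  LinearMap.ext_on_range (span_range_tmul (span_range_tmul L.span_eq_top L.span_eq_top)
    L.span_eq_top) fun p => h p.1.1 p.1.2 p.2

lemma ext_left {M N : Type*} [AddCommGroup M] [Module k M] [AddCommGroup N] [Module k N]
    {f f' : N ⊗[k] R →ₗ[k] M} (h : ∀ y n, f (y ⊗ₜ x n) = f' (y ⊗ₜ x n)) : f = f' :=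
  LinearMap.ext_on_range (span_range_tmul span_range_id L.span_eq_top) fun p => h p.1 p.2

lemma ext_left₂ {M N : Type*} [AddCommGroup M] [Module k M] [AddCommGroup N] [Module k N]
    {f f' : N ⊗[k] (R ⊗[k] R) →ₗ[k] M}
    (h : ∀ y a b, f (y ⊗ₜ (x a ⊗ₜ x b)) = f' (y ⊗ₜ (x a ⊗ₜ x b))) : f = f' :=
  LinearMap.ext_on_range
    (span_range_tmul span_range_id (span_range_tmul L.span_eq_top L.span_eq_top))
    fun p => h p.1 p.2.1 p.2.2

lemma tensorCoact_apply (a b : ℕ) :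
    tensorCoact ρ ρ (x a ⊗ₜ x b) = (powGL γ (a + b)).val ⊗ₜ (x a ⊗ₜ x b) := by
  rw [powGL_add]
  exact tensorCoact_homogeneous (L.coact_apply a) (L.coact_apply b)

lemma assocYD_apply (a b c : ℕ) : assocYD ρ ρ ρ ((x a ⊗ₜ x b) ⊗ₜ x c) =
    (powOmega γ a b c)⁻¹ • (x a ⊗ₜ (x b ⊗ₜ x c)) := by
  rw [assocYD, LinearMap.comp_apply,
    twist_homogeneous (L.coact_apply a) (L.coact_apply b) (L.coact_apply c), omegaInv_powGL]
  simp

lemma assocInvYD_apply (a b c : ℕ) : assocInvYD ρ ρ ρ (x a ⊗ₜ (x b ⊗ₜ x c)) =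
    powOmega γ a b c • ((x a ⊗ₜ x b) ⊗ₜ x c) := by
  rw [assocInvYD, LinearMap.comp_apply, LinearEquiv.coe_coe, TensorProduct.assoc_symm_tmul,
    twist_homogeneous (L.coact_apply a) (L.coact_apply b) (L.coact_apply c)]
  rfl

lemma tensorAct_apply (h : H) (a b : ℕ) : tensorAct ρ act ρ act (h ⊗ₜ (x a ⊗ₜ x b)) =
    powChar γ χ (a + b) h • (x a ⊗ₜ x b) := by
  rw [powChar_add L.character]
  exact tensorAct_homogeneous (L.coact_apply a) (L.coact_apply b) (L.act_apply a) (L.act_apply b) h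

lemma braid_apply (a b : ℕ) : braid ρ act (x a ⊗ₜ x b) =
    (q ^ (a * b) * cochain γ b a / cochain γ a b) • (x b ⊗ₜ x a) :=
  braid_homogeneous (L.coact_apply a) (by
    rw [L.act_apply, powChar_powGL γ L.character L.apply_self])

lemma assocYD_tensor_apply (a b c d : ℕ) :
    assocYD ρ ρ (tensorCoact ρ ρ) ((x a ⊗ₜ x b) ⊗ₜ (x c ⊗ₜ x d)) =
      (powOmega γ a b (c + d))⁻¹ • (x a ⊗ₜ (x b ⊗ₜ (x c ⊗ₜ x d))) := by
  rw [assocYD, LinearMap.comp_apply, twist_homogeneous (L.coact_apply a) (L.coact_apply b)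
    (L.tensorCoact_apply c d), omegaInv_powGL]
  simp

lemma assocInvYD_tensor_apply (a b c d : ℕ) :
    assocInvYD ρ ρ (tensorCoact ρ ρ) (x a ⊗ₜ (x b ⊗ₜ (x c ⊗ₜ x d))) =
      powOmega γ a b (c + d) • ((x a ⊗ₜ x b) ⊗ₜ (x c ⊗ₜ x d)) := by
  rw [assocInvYD, LinearMap.comp_apply, LinearEquiv.coe_coe, TensorProduct.assoc_symm_tmul,
    twist_homogeneous (L.coact_apply a) (L.coact_apply b) (L.tensorCoact_apply c d)]
  rfl

lemma interchange_apply (a b c d : ℕ) :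
    interchange ρ act ((x a ⊗ₜ x b) ⊗ₜ (x c ⊗ₜ x d)) =
      (q ^ (b * c) * (cochain γ a c * cochain γ b d * cochain γ (a + c) (b + d)) /
        (cochain γ a b * cochain γ c d * cochain γ (a + b) (c + d))) •
        ((x a ⊗ₜ[k] x c) ⊗ₜ[k] (x b ⊗ₜ[k] x d)) := by
  simp only [interchange, LinearMap.comp_apply, L.assocYD_tensor_apply, map_smul,
    LinearMap.lTensor_tmul, L.assocInvYD_apply, tmul_smul, LinearMap.rTensor_tmul, L.braid_apply,
    ← smul_tmul', L.assocYD_apply, L.assocInvYD_tensor_apply, smul_smul]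
  congr 1
  have n₁ := cochain_ne_zero γ a b
  have n₂ := cochain_ne_zero γ c d
  have n₃ := cochain_ne_zero γ (a + b) (c + d)
  have n₄ := cochain_ne_zero γ b (c + d)
  have n₅ := cochain_ne_zero γ a (b + (c + d))
  have n₆ := cochain_ne_zero γ b c
  have n₇ := cochain_ne_zero γ c b
  have n₈ := cochain_ne_zero γ (c + b) d
  have n₉ := cochain_ne_zero γ c (b + d)
  have n₁₀ := cochain_ne_zero γ b d
  rw [powOmega_eq, powOmega_eq, powOmega_eq, powOmega_eq, Nat.add_comm b c,
    Nat.add_left_comm c b d]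
  field_simp

/-- Coassociativity of the `q`-binomial comultiplication up to the constraint, which is the
coboundary of `cochain`. -/
lemma coassoc_apply (n : ℕ) :
    assocYD ρ ρ ρ (LinearMap.rTensor R Δ (Δ (x n))) = LinearMap.lTensor R Δ (Δ (x n)) := by
  have h := sum_qBinom_assoc q n fun i j l =>
    (cochain γ i (j + l) * cochain γ j l) • (x i ⊗ₜ[k] (x j ⊗ₜ[k] x l))
  simp only [L.comul_apply, map_sum, map_smul, LinearMap.rTensor_tmul, LinearMap.lTensor_tmul,
    sum_tmul, tmul_sum, ← smul_tmul', tmul_smul, L.assocYD_apply, Finset.smul_sum, smul_smul] at h ⊢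
  calc _ = _ := ?_
    _ = _ := h
    _ = _ := ?_
  · refine Finset.sum_congr rfl fun p _ => Finset.sum_congr rfl fun r hr => ?_
    congr 1
    have n₁ := cochain_ne_zero γ r.1 r.2
    have n₂ := cochain_ne_zero γ (r.1 + r.2) p.2
    have n₃ := cochain_ne_zero γ r.2 p.2
    have n₄ := cochain_ne_zero γ r.1 (r.2 + p.2)
    rw [powOmega_eq, ← mem_antidiagonal.mp hr]
    field_simp
  · refine Finset.sum_congr rfl fun p _ => Finset.sum_congr rfl fun r hr => ?_
    rw [mem_antidiagonal.mp hr]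
    congr 1
    ring

/-- The comultiplication is multiplicative by the `q`-Vandermonde identity. -/
lemma comul_mul_apply (a b : ℕ) : Δ (mul (x a ⊗ₜ x b)) =
    TensorProduct.map mul mul (interchange ρ act (TensorProduct.map Δ Δ (x a ⊗ₜ x b))) := by
  have h := sum_qBinom_add q a b fun m n =>
    ((cochain γ a b)⁻¹ * cochain γ m n) • (x m ⊗ₜ[k] x n)
  simp only [L.comul_apply, L.mul_apply, map_sum, map_smul, TensorProduct.map_tmul,
    sum_tmul, tmul_sum, ← smul_tmul', tmul_smul, L.interchange_apply, Finset.smul_sum,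
    smul_smul] at h ⊢
  calc _ = _ := ?_
    _ = _ := h
    _ = _ := ?_
  · refine Finset.sum_congr rfl fun p _ => ?_
    congr 1
    ring
  · rw [Finset.sum_comm]
    refine Finset.sum_congr rfl fun p hp => Finset.sum_congr rfl fun r hr => ?_
    congr 1
    have n₁ := cochain_ne_zero γ r.1 r.2
    have n₂ := cochain_ne_zero γ p.1 p.2
    have n₃ := cochain_ne_zero γ (r.1 + r.2) (p.1 + p.2)
    have n₄ := cochain_ne_zero γ r.1 p.1
    have n₅ := cochain_ne_zero γ r.2 p.2
    rw [← mem_antidiagonal.mp hp, ← mem_antidiagonal.mp hr]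
    field_simp

lemma sum_counit_left (n : ℕ) {M : Type*} [AddCommGroup M] [Module k M] (F : ℕ → ℕ → M) :
    ∑ p ∈ antidiagonal n, ((qBinom q n p.1 * cochain γ p.1 p.2) * ε (x p.1)) • F p.1 p.2 =
      F 0 n := by
  rw [Finset.sum_eq_single (0, n)]
  · simp [L.counit_apply, qBinom_zero_right]
  · rintro ⟨i, j⟩ hp hne
    have : i ≠ 0 := by
      rintro rfl
      simp_all
    simp [L.counit_apply, this]
  · simp

lemma sum_counit_right (n : ℕ) {M : Type*} [AddCommGroup M] [Module k M] (F : ℕ → ℕ → M) :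
    ∑ p ∈ antidiagonal n, ((qBinom q n p.1 * cochain γ p.1 p.2) * ε (x p.2)) • F p.1 p.2 =
      F n 0 := by
  rw [Finset.sum_eq_single (n, 0)]
  · simp [L.counit_apply, qBinom_self]
  · rintro ⟨i, j⟩ hp hne
    have : j ≠ 0 := by
      rintro rfl
      simp_all
    simp [L.counit_apply, this]
  · simp

/-- The Yetter–Drinfeld module underlying the quantum line. -/
def toYDModule : YDModule k H R where
  coact := ρ
  act := act
  coact_coassoc := L.ext₁ fun n => by
    simp [L.coact_apply, (powGL γ n).isGroupLikeElem_val.comul_eq_tmul_self]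
  coact_counit := L.ext₁ fun n => by simp [L.coact_apply]
  mul_act := L.ext_left fun t n =>
    mul_act_homogeneous (L.character.pow n) (L.coact_apply n) (L.act_apply n) t
  one_act v := by
    have h : act ∘ₗ TensorProduct.mk k H R 1 = LinearMap.id := L.ext₁ fun n => by
      simp [L.act_apply, (L.character.pow n).map_one]
    exact LinearMap.congr_fun h v
  compat := L.ext_left fun h n =>
    compat_homogeneous (L.coact_apply n) (L.act_apply n) (L.character.pow n).comm h

/-- The quantum line as a bialgebra in the category of Yetter–Drinfeld modules. -/
def toYDBialgebra : YDBialgebra k H R where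
  toYDModule := L.toYDModule
  mul := mul
  one := x 0
  Δ := Δ
  ε := ε
  mul_coact := L.ext₂ fun a b => by
    have h := L.tensorCoact_apply a b
    simp only [toYDModule, LinearMap.comp_apply, h, LinearMap.lTensor_tmul, L.mul_apply, map_smul,
      L.coact_apply, tmul_smul]
  mul_act_linear := L.ext_left₂ fun h a b => by
    simp only [toYDModule, LinearMap.comp_apply, L.tensorAct_apply, LinearMap.lTensor_tmul,
      L.mul_apply, map_smul, L.act_apply, tmul_smul]
    rw [smul_comm]
  one_coact := L.coact_apply 0
  one_act_linear h := by
    simp [toYDModule, L.act_apply, powChar]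
  Δ_coact := L.ext₁ fun n => by
    simp only [toYDModule, LinearMap.comp_apply, L.coact_apply, LinearMap.lTensor_tmul,
      L.comul_apply, map_sum, tmul_sum, map_smul, tmul_smul]
    refine Finset.sum_congr rfl fun p hp => ?_
    rw [L.tensorCoact_apply, mem_antidiagonal.mp hp]
  Δ_act_linear := L.ext_left fun h n => by
    simp only [toYDModule, LinearMap.comp_apply, L.act_apply, LinearMap.lTensor_tmul,
      L.comul_apply, map_sum, tmul_sum, map_smul, tmul_smul, Finset.smul_sum]
    refine Finset.sum_congr rfl fun p hp => ?_
    rw [L.tensorAct_apply, mem_antidiagonal.mp hp, smul_comm]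
  ε_coact r := by
    have h : (TensorProduct.rid k H).toLinearMap ∘ₗ LinearMap.lTensor H ε ∘ₗ ρ =
        LinearMap.toSpanSingleton k H 1 ∘ₗ ε := L.ext₁ fun n => by
      by_cases hn : n = 0 <;> simp [L.coact_apply, L.counit_apply, hn, powGL]
    exact LinearMap.congr_fun h r
  ε_act_linear h r := by
    have e : ε ∘ₗ act ∘ₗ TensorProduct.mk k H R h = counit (R := k) h • ε := L.ext₁ fun n => by
      by_cases hn : n = 0 <;> simp [L.act_apply, L.counit_apply, hn, powChar]
    exact LinearMap.congr_fun e r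
  mul_assoc := L.ext₃ fun a b c => by
    simp only [toYDModule, LinearMap.comp_apply, LinearMap.rTensor_tmul, L.assocYD_apply,
      L.mul_apply, map_smul, LinearMap.lTensor_tmul, ← smul_tmul', tmul_smul, smul_smul,
      Nat.add_assoc]
    congr 1
    have n₁ := cochain_ne_zero γ a b
    have n₂ := cochain_ne_zero γ (a + b) c
    have n₃ := cochain_ne_zero γ b c
    have n₄ := cochain_ne_zero γ a (b + c)
    rw [powOmega_eq]
    field_simp
  one_mul r := by
    have h : mul ∘ₗ TensorProduct.mk k R R (x 0) = LinearMap.id := L.ext₁ fun n => by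
      simp [L.mul_apply]
    exact LinearMap.congr_fun h r
  mul_one r := by
    have h : mul ∘ₗ (TensorProduct.mk k R R).flip (x 0) = LinearMap.id := L.ext₁ fun n => by
      simp [L.mul_apply]
    exact LinearMap.congr_fun h r
  Δ_coassoc := L.ext₁ L.coassoc_apply
  ε_Δ := L.ext₁ fun n => by
    simpa [L.comul_apply, smul_smul] using L.sum_counit_left n fun _ j => x j
  Δ_ε := L.ext₁ fun n => by
    simpa [L.comul_apply, smul_smul] using L.sum_counit_right n fun i _ => x i
  Δ_mul := L.ext₂ L.comul_mul_apply
  Δ_one := by simp [L.comul_apply, qBinom]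
  ε_mul r s := by
    have h : ε ∘ₗ mul = LinearMap.mul' k k ∘ₗ TensorProduct.map ε ε := L.ext₂ fun a b => by
      by_cases ha : a = 0 <;> by_cases hb : b = 0 <;> simp [L.mul_apply, L.counit_apply, ha, hb]
    exact LinearMap.congr_fun h (r ⊗ₜ s)
  ε_one := by simp [L.counit_apply]

end IsQuantumLine

end Bialgebra

/-! ### The coradical -/

section Coradical

variable {k : Type u} [Field k] {C : Type*} [AddCommGroup C] [Module k C]

/-- Some linear projection onto `p` maps `p'` into `p ⊓ p'`. -/
lemma exists_projection_map_le (p p' : Submodule k C) :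
    ∃ f : C →ₗ[k] C, (∀ c ∈ p, f c = c) ∧ ∀ c ∈ p', f c ∈ p' ⊓ p := by
  obtain ⟨s, hs⟩ := (Submodule.comap p'.subtype p).exists_isCompl
  have hdisj : Disjoint (s.map p'.subtype) p := by
    rw [Submodule.disjoint_def]
    rintro _ ⟨y, hy, rfl⟩ hyp
    have := (Submodule.disjoint_def.mp hs.disjoint) y hyp hy
    simp [this]
  obtain ⟨t, hst, ht⟩ := hdisj.exists_isCompl
  refine ⟨p.subtype ∘ₗ Submodule.projectionOnto p t ht.symm, fun c hc => ?_, fun c hc => ?_⟩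
  · exact congrArg Subtype.val (Submodule.projectionOnto_apply_left ht.symm ⟨c, hc⟩)
  · have hc' : (⟨c, hc⟩ : p') ∈ Submodule.comap p'.subtype p ⊔ s := by
      rw [hs.sup_eq_top]; trivial
    obtain ⟨y, hy, z, hz, hyz⟩ := Submodule.mem_sup.mp hc'
    have hcyz : c = y + z := congrArg Subtype.val hyz.symm
    have h₁ := Submodule.projectionOnto_apply_left ht.symm ⟨y.val, hy⟩
    have h₂ := Submodule.projectionOnto_apply_right ht.symm
      ⟨z.val, hst (Submodule.mem_map_of_mem hz)⟩
    simp only at h₁ h₂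
    rw [hcyz, map_add, LinearMap.comp_apply, LinearMap.comp_apply, h₁, h₂]
    simpa using And.intro y.2 (Submodule.mem_comap.mp hy)

variable [Coalgebra k C]

lemma IsSubcoalgebra_inf {D E : Submodule k C} (hD : IsSubcoalgebra k C D)
    (hE : IsSubcoalgebra k C E) : IsSubcoalgebra k C (D ⊓ E) := by
  obtain ⟨f, hfE, hfD⟩ := exists_projection_map_le E D
  rintro d ⟨hdD, hdE⟩
  obtain ⟨s, hs⟩ := hD d hdD
  obtain ⟨t, ht⟩ := hE d hdE
  have h₁ : TensorProduct.map f f (comul (R := k) d) = comul d := by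
    have e : f ∘ₗ E.subtype = E.subtype := LinearMap.ext fun y => hfE y y.2
    rw [← ht, ← LinearMap.comp_apply, ← TensorProduct.map_comp, e]
  have e : f ∘ₗ D.subtype = (D ⊓ E).subtype ∘ₗ (f ∘ₗ D.subtype).codRestrict (D ⊓ E)
    (fun y => hfD y y.2) := rfl
  rw [← h₁, ← hs, ← LinearMap.comp_apply, ← TensorProduct.map_comp, e, TensorProduct.map_comp]
  exact ⟨_, rfl⟩

/-- A subcoalgebra is stable under contraction of the first leg of the comultiplication. -/
lemma hitL_mem {D : Submodule k C} (hD : IsSubcoalgebra k C D) (φ : WithConv (C →ₗ[k] k)) {d : C}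
    (hd : d ∈ D) : hitL φ d ∈ D := by
  obtain ⟨s, hs⟩ := hD d hd
  rw [hitL, LinearMap.comp_apply, LinearMap.comp_apply, ← hs]
  clear hs
  induction s using TensorProduct.induction_on with
  | zero => simp
  | tmul x y => simpa using D.smul_mem _ y.2
  | add x y hx hy => rw [map_add, map_add, map_add]; exact D.add_mem hx hy

/-- A subcoalgebra that meets every nonzero subcoalgebra contains the coradical. -/
lemma coradical_le {E : Submodule k C} (hE : IsSubcoalgebra k C E)
    (h : ∀ D, IsSubcoalgebra k C D → D ≠ ⊥ → D ⊓ E ≠ ⊥) : coradical k C ≤ E := by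
  refine sSup_le fun D hD => ?_
  obtain ⟨hsub, hne, hmin⟩ := hD
  have := (hmin _ (IsSubcoalgebra_inf hsub hE) inf_le_left).resolve_left (h D hsub hne)
  exact inf_eq_left.mp this

end Coradical

/-! ### The bosonization of the quantum line -/

section Bosonization

open Finset.HasAntidiagonal (antidiagonal mem_antidiagonal)

variable {k : Type u} {H : Type v} [Field k] [NonAssocRing H] [Module k H]
  [SMulCommClass k H H] [IsScalarTower k H H] [Coalgebra k H] [DualQuasiBialgebra k H]

lemma mul_hitR_omR_inv (a b : GroupLike k H) (h : H) :
    (a.val * b.val) * hitR (omR a b)⁻¹.val h = a.val * (b.val * hitL (omR a b)⁻¹.val h) := by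
  have e := mul_assoc_hit_LR a b (hitL (omR a b)⁻¹.val (hitR (omR a b)⁻¹.val h))
  rw [← hitL_comp_hitR_apply, hitR_hitR_inv, hitL_hitL_inv] at e
  exact e.symm

lemma omC_inv_val (γ : GroupLike k H) (a b c : ℕ) :
    (omC (powGL γ a) (powGL γ b) (powGL γ c))⁻¹.val =
      (powOmega γ a b c)⁻¹ • (1 : WithConv (H →ₗ[k] k)) := by
  refine WithConv.ext (LinearMap.ext fun h => ?_)
  rw [omC, omegaPull_inv_apply, constGL_apply, map_smul, tensorGL_val, tensorGL_val,
    omegaInv_powGL]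
  simp [mul_comm]

lemma hitL_smul (s : k) (φ : WithConv (H →ₗ[k] k)) (h : H) : hitL (s • φ) h = s • hitL φ h := by
  simp [hitL, LinearMap.rTensor_smul]

/-- The inverse of the cocycle identity `pentagon_RR` on powers of `γ`. -/
lemma omR_inv_mul_pull (γ : GroupLike k H) (a b c : ℕ) :
    (omR (powGL γ (a + b)) (powGL γ c))⁻¹.val *
        pull (lmul (powGL γ c)) (omR (powGL γ a) (powGL γ b))⁻¹.val =
      (powOmega γ a b c)⁻¹ • ((omR (powGL γ a) (powGL γ (b + c)))⁻¹.val *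
        (omR (powGL γ b) (powGL γ c))⁻¹.val) := by
  have h := congrArg (fun φ => φ⁻¹) (pentagon_RR (powGL γ a) (powGL γ b) (powGL γ c))
  simp only [mul_inv_rev] at h
  have h' := congrArg Units.val h
  rw [Units.val_mul, Units.val_mul, Units.val_mul, omC_inv_val, smul_mul_assoc, one_mul,
    ← powGL_add, ← powGL_add, ← map_inv] at h'
  exact h'.symm

/-- The map `h ↦ a h₁ ⊗ h₂`. -/
def mulComul (a : GroupLike k H) : H →ₗ[k] H ⊗[k] H :=
  LinearMap.rTensor H (lmul a).toLinearMap ∘ₗ comul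

lemma lid_counit_mulComul (a : GroupLike k H) (h : H) :
    TensorProduct.lid k H (LinearMap.rTensor H counit (mulComul a h)) = h := by
  have e : counit (R := k) ∘ₗ (lmul a).toLinearMap = counit := (lmul a).counit_comp
  rw [mulComul, LinearMap.comp_apply, ← LinearMap.comp_apply (LinearMap.rTensor H counit),
    ← LinearMap.rTensor_comp, e, rTensor_counit_comul, TensorProduct.lid_tmul, one_smul]

lemma rid_counit_mulComul (a : GroupLike k H) (h : H) :
    TensorProduct.rid k H (LinearMap.lTensor H counit (mulComul a h)) = a.val * h := by
  rw [mulComul, LinearMap.comp_apply, ← LinearMap.comp_apply (LinearMap.lTensor H counit),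
    LinearMap.lTensor_comp_rTensor, ← LinearMap.rTensor_comp_lTensor, LinearMap.comp_apply,
    lTensor_counit_comul, LinearMap.rTensor_tmul, TensorProduct.rid_tmul, one_smul]
  rfl

/-- The map `h ↦ a (b h₁) ⊗ (b h₂ ⊗ h₃)`. -/
def mulMulComul (a b : GroupLike k H) : H →ₗ[k] H ⊗[k] (H ⊗[k] H) :=
  TensorProduct.map ((lmul a).toLinearMap ∘ₗ (lmul b).toLinearMap) (mulComul b) ∘ₗ comul

/-- In the first iterated comultiplication, `φ` acts on a factor `b h₁`; moving it past `b` it is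
absorbed into `hitL`. -/
lemma assoc_mulComul_left (a b : GroupLike k H) (φ ψ : WithConv (H →ₗ[k] k)) (h : H) :
    TensorProduct.assoc k H H H (LinearMap.rTensor H (mulComul a ∘ₗ hitL φ)
        (mulComul b (hitL ψ h))) =
      mulMulComul a b (hitL (ψ * pull (lmul b) φ) h) := by
  have e₁ : hitL φ ∘ₗ (lmul b).toLinearMap = (lmul b).toLinearMap ∘ₗ hitL (pull (lmul b) φ) :=
    LinearMap.ext fun t => hitL_coalgHom _ _ _
  have e₂ : mulComul a ∘ₗ (lmul b).toLinearMap =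
      TensorProduct.map ((lmul a).toLinearMap ∘ₗ (lmul b).toLinearMap) (lmul b).toLinearMap ∘ₗ
        comul := by
    rw [mulComul, LinearMap.comp_assoc, ← (lmul b).map_comp_comul, ← LinearMap.comp_assoc,
      LinearMap.rTensor_comp_map]
  have e₃ : LinearMap.rTensor H (mulComul a ∘ₗ hitL φ) ∘ₗ mulComul b ∘ₗ hitL ψ =
      LinearMap.rTensor H (mulComul a ∘ₗ (lmul b).toLinearMap) ∘ₗ comul ∘ₗ
        hitL (ψ * pull (lmul b) φ) := by
    rw [hitL_mul, ← LinearMap.comp_assoc _ _ comul, comul_comp_hitL, LinearMap.comp_assoc,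
      ← LinearMap.comp_assoc _ _ (LinearMap.rTensor H (mulComul a ∘ₗ (lmul b).toLinearMap)),
      ← LinearMap.rTensor_comp, LinearMap.comp_assoc, ← e₁, ← LinearMap.comp_assoc _ _ (mulComul a),
      LinearMap.rTensor_comp _ (mulComul a ∘ₗ hitL φ)]
    rfl
  have e₄ : ∀ t : (H ⊗[k] H) ⊗[k] H, TensorProduct.assoc k H H H
      (LinearMap.rTensor H (TensorProduct.map ((lmul a).toLinearMap ∘ₗ (lmul b).toLinearMap)
        (lmul b).toLinearMap) t) =
      TensorProduct.map ((lmul a).toLinearMap ∘ₗ (lmul b).toLinearMap)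
        (LinearMap.rTensor H (lmul b).toLinearMap) (TensorProduct.assoc k H H H t) := fun t =>
    (LinearMap.congr_fun (TensorProduct.map_map_comp_assoc_eq _ _ _) t).symm
  have e₅ := LinearMap.congr_fun e₃ h
  simp only [LinearMap.comp_apply] at e₅
  rw [e₅, e₂, LinearMap.rTensor_comp, LinearMap.comp_apply, e₄, coassoc_apply, mulMulComul,
    LinearMap.comp_apply, ← LinearMap.comp_apply (TensorProduct.map _ _) (LinearMap.lTensor _ _),
    LinearMap.map_comp_lTensor]
  rfl

/-- In the second iterated comultiplication, the factor `ω⁻¹ (a ⊗ b ⊗ -)` acts on the second leg,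
that is, by `hitR` on the first one, where quasi-associativity turns it into `hitL` and `(a b) h`
into `a (b h)`. -/
lemma mulComul_right (a b : GroupLike k H) (ψ : WithConv (H →ₗ[k] k)) (h : H) :
    LinearMap.lTensor H (mulComul b ∘ₗ hitL (omR a b)⁻¹.val)
        (mulComul (mulGL a b) (hitL ψ h)) =
      mulMulComul a b (hitL (ψ * (omR a b)⁻¹.val) h) := by
  have e₁ : (lmul (mulGL a b)).toLinearMap ∘ₗ hitR (omR a b)⁻¹.val =
      (lmul a).toLinearMap ∘ₗ (lmul b).toLinearMap ∘ₗ hitL (omR a b)⁻¹.val :=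
    LinearMap.ext fun t => mul_hitR_omR_inv a b t
  have e₂ : LinearMap.lTensor H (mulComul b ∘ₗ hitL (omR a b)⁻¹.val) ∘ₗ mulComul (mulGL a b) =
      TensorProduct.map ((lmul (mulGL a b)).toLinearMap ∘ₗ hitR (omR a b)⁻¹.val) (mulComul b) ∘ₗ
        comul := by
    rw [mulComul.eq_1 (mulGL a b), ← LinearMap.comp_assoc, LinearMap.lTensor_comp_rTensor,
      ← LinearMap.map_comp_rTensor, LinearMap.comp_assoc, rTensor_hitR_comul,
      ← LinearMap.comp_assoc, LinearMap.map_comp_lTensor]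
  have e₃ : LinearMap.rTensor H (hitL (omR a b)⁻¹.val) ∘ₗ comul ∘ₗ hitL ψ =
      comul ∘ₗ hitL (ψ * (omR a b)⁻¹.val) := by
    rw [hitL_mul, ← LinearMap.comp_assoc _ _ comul, comul_comp_hitL (omR a b)⁻¹.val,
      LinearMap.comp_assoc]
  have e₄ := LinearMap.congr_fun e₂ (hitL ψ h)
  rw [LinearMap.comp_apply] at e₄
  rw [e₄, e₁, ← LinearMap.comp_assoc, ← LinearMap.map_comp_rTensor, LinearMap.comp_assoc,
    LinearMap.comp_apply]
  exact congrArg _ (LinearMap.congr_fun e₃ h)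

variable {R : Type*} [AddCommGroup R] [Module k R]

namespace IsQuantumLine

variable {γ : GroupLike k H} {χ : WithConv (H →ₗ[k] k)} {q : k} {x : ℕ → R}
  {ρ : R →ₗ[k] H ⊗[k] R} {act : H ⊗[k] R →ₗ[k] R} {mul : R ⊗[k] R →ₗ[k] R}
  {Δ : R →ₗ[k] R ⊗[k] R} {ε : R →ₗ[k] k} (L : IsQuantumLine γ χ q x ρ act mul Δ ε)

/-- The map `h ⊗ l ↦ (r ⊗ h) ⊗ (s ⊗ l)`. -/
def inPair (r s : R) : H ⊗[k] H →ₗ[k] (R ⊗[k] H) ⊗[k] (R ⊗[k] H) :=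
  TensorProduct.map (TensorProduct.mk k R H r) (TensorProduct.mk k R H s)

/-- The map `h ⊗ (l ⊗ m) ↦ (r ⊗ h) ⊗ ((s ⊗ l) ⊗ (t ⊗ m))`. -/
def inTriple (r s t : R) :
    H ⊗[k] (H ⊗[k] H) →ₗ[k] (R ⊗[k] H) ⊗[k] ((R ⊗[k] H) ⊗[k] (R ⊗[k] H)) :=
  TensorProduct.map (TensorProduct.mk k R H r) (inPair s t)

include L

lemma ext_right {M N : Type*} [AddCommGroup M] [Module k M] [AddCommGroup N] [Module k N]
    {f f' : R ⊗[k] N →ₗ[k] M} (h : ∀ n y, f (x n ⊗ₜ y) = f' (x n ⊗ₜ y)) : f = f' :=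
  LinearMap.ext_on_range (span_range_tmul L.span_eq_top span_range_id) fun p => h p.1 p.2

lemma bosonComul_apply (n : ℕ) (h : H) : bosonComul L.toYDBialgebra (x n ⊗ₜ h) =
    ∑ p ∈ antidiagonal n, (qBinom q n p.1 * cochain γ p.1 p.2) • inPair (x p.1) (x p.2)
      (mulComul (powGL γ p.2) (hitL (omR (powGL γ p.1) (powGL γ p.2))⁻¹.val h)) := by
  have e₁ : ∀ a b h, assocYD ρ ρ comul ((x a ⊗ₜ x b) ⊗ₜ h) =
      x a ⊗ₜ (x b ⊗ₜ hitL (omR (powGL γ a) (powGL γ b))⁻¹.val h) := fun a b h => by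
    rw [assocYD, LinearMap.comp_apply, twist_comul_right (L.coact_apply a) (L.coact_apply b)
      fun y => (omR_inv_apply _ _ y).symm]
    rfl
  have e₂ : ∀ a b h, (TensorProduct.assoc k R H (R ⊗[k] H)).symm
      (x a ⊗ₜ (tensorCoact ρ comul (x b ⊗ₜ h))) =
        inPair (x a) (x b) (mulComul (powGL γ b) h) := fun a b h => by
    simp only [tensorCoact, coactPair, LinearMap.comp_apply, TensorProduct.map_tmul,
      L.coact_apply, mulComul, inPair, LinearEquiv.coe_coe]
    induction (comul h : H ⊗[k] H) using TensorProduct.induction_on with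
    | zero => simp
    | tmul y z => simp
    | add y z hy hz => simp only [map_add, tmul_add, hy, hz]
  simp only [bosonComul, toYDBialgebra, toYDModule, LinearMap.comp_apply, LinearMap.rTensor_tmul,
    L.comul_apply, sum_tmul, map_sum, ← smul_tmul', map_smul, e₁, LinearMap.lTensor_tmul,
    LinearEquiv.coe_coe, e₂]

lemma assoc_rTensor_bosonComul (m l : ℕ) (t : H ⊗[k] H) :
    TensorProduct.assoc k (R ⊗[k] H) (R ⊗[k] H) (R ⊗[k] H)
        (LinearMap.rTensor _ (bosonComul L.toYDBialgebra) (inPair (x m) (x l) t)) =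
      ∑ p ∈ antidiagonal m, (qBinom q m p.1 * cochain γ p.1 p.2) •
        inTriple (x p.1) (x p.2) (x l) (TensorProduct.assoc k H H H (LinearMap.rTensor H
          (mulComul (powGL γ p.2) ∘ₗ hitL (omR (powGL γ p.1) (powGL γ p.2))⁻¹.val) t)) := by
  have e : ∀ (r s : R) (w : H ⊗[k] H) (z : H), TensorProduct.assoc k _ _ _
      (inPair r s w ⊗ₜ (x l ⊗ₜ[k] z)) = inTriple r s (x l) (TensorProduct.assoc k H H H (w ⊗ₜ z)) :=
    fun r s w z => by
      induction w using TensorProduct.induction_on with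
      | zero => simp
      | tmul y y' => simp [inTriple, inPair]
      | add y y' hy hy' => simp only [map_add, add_tmul, hy, hy']
  induction t using TensorProduct.induction_on with
  | zero => simp
  | tmul y z =>
    rw [inPair, TensorProduct.map_tmul, LinearMap.rTensor_tmul, TensorProduct.mk_apply,
      TensorProduct.mk_apply, L.bosonComul_apply]
    simp only [sum_tmul, map_sum, ← smul_tmul', map_smul, e, LinearMap.rTensor_tmul,
      LinearMap.comp_apply]
  | add y z hy hz => simp only [map_add, hy, hz, smul_add, Finset.sum_add_distrib]

lemma lTensor_bosonComul (i m : ℕ) (t : H ⊗[k] H) :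
    LinearMap.lTensor _ (bosonComul L.toYDBialgebra) (inPair (x i) (x m) t) =
      ∑ p ∈ antidiagonal m, (qBinom q m p.1 * cochain γ p.1 p.2) •
        inTriple (x i) (x p.1) (x p.2) (LinearMap.lTensor H
          (mulComul (powGL γ p.2) ∘ₗ hitL (omR (powGL γ p.1) (powGL γ p.2))⁻¹.val) t) := by
  induction t using TensorProduct.induction_on with
  | zero => simp
  | tmul y z =>
    rw [inPair, TensorProduct.map_tmul, LinearMap.lTensor_tmul, TensorProduct.mk_apply,
      TensorProduct.mk_apply, L.bosonComul_apply]
    simp only [tmul_sum, tmul_smul, LinearMap.lTensor_tmul, LinearMap.comp_apply, inTriple,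
      TensorProduct.map_tmul, TensorProduct.mk_apply]
  | add y z hy hz => simp only [map_add, hy, hz, smul_add, Finset.sum_add_distrib]

/-- The terms of the two iterated comultiplications agree because the pentagon and
quasi-associativity move all `ω⁻¹` to the last leg, up to `powOmega`, the coboundary of
`cochain`. -/
lemma bosonComul_coassoc :
    (TensorProduct.assoc k (R ⊗[k] H) (R ⊗[k] H) (R ⊗[k] H)).toLinearMap ∘ₗ
        LinearMap.rTensor _ (bosonComul L.toYDBialgebra) ∘ₗ bosonComul L.toYDBialgebra =
      LinearMap.lTensor _ (bosonComul L.toYDBialgebra) ∘ₗ bosonComul L.toYDBialgebra := by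
  refine L.ext_right fun n h => ?_
  have key := sum_qBinom_assoc q n fun i j l =>
    (cochain γ i (j + l) * cochain γ j l) • inTriple (x i) (x j) (x l)
      (mulMulComul (powGL γ j) (powGL γ l)
        (hitL ((omR (powGL γ i) (powGL γ (j + l)))⁻¹.val *
          (omR (powGL γ j) (powGL γ l))⁻¹.val) h))
  simp only [LinearMap.comp_apply, LinearEquiv.coe_coe, L.bosonComul_apply, map_sum, map_smul,
    L.assoc_rTensor_bosonComul, L.lTensor_bosonComul, Finset.smul_sum, smul_smul] at key ⊢
  calc _ = _ := ?_
    _ = _ := key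
    _ = _ := ?_
  · refine Finset.sum_congr rfl fun p _ => Finset.sum_congr rfl fun r hr => ?_
    rw [assoc_mulComul_left, ← mem_antidiagonal.mp hr, omR_inv_mul_pull, hitL_smul, map_smul,
      map_smul, smul_smul, powOmega_eq]
    congr 1
    have n₁ := cochain_ne_zero γ r.1 r.2
    have n₂ := cochain_ne_zero γ (r.1 + r.2) p.2
    have n₃ := cochain_ne_zero γ r.2 p.2
    have n₄ := cochain_ne_zero γ r.1 (r.2 + p.2)
    field_simp
  · refine Finset.sum_congr rfl fun p _ => Finset.sum_congr rfl fun r hr => ?_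
    rw [← mem_antidiagonal.mp hr, powGL_add, mulComul_right]
    congr 1
    ring

lemma bosonCounit_inPair_left (r s : R) (t : H ⊗[k] H) :
    LinearMap.rTensor _ (counit ∘ₗ bosonProj L.toYDBialgebra) (inPair r s t) =
      ε r • (1 ⊗ₜ[k] (s ⊗ₜ[k] TensorProduct.lid k H (LinearMap.rTensor H counit t))) := by
  induction t using TensorProduct.induction_on with
  | zero => simp
  | tmul y z =>
    have e : ∀ (c : k) (w : R ⊗[k] H), c ⊗ₜ[k] w = c • ((1 : k) ⊗ₜ[k] w) := fun c w => by
      rw [smul_tmul', smul_eq_mul, mul_one]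
    rw [inPair, TensorProduct.map_tmul, LinearMap.rTensor_tmul, e]
    simp [bosonProj, toYDBialgebra, smul_smul, tmul_smul]
  | add y z hy hz => simp only [map_add, hy, hz, tmul_add, smul_add]

lemma bosonCounit_inPair_right (r s : R) (t : H ⊗[k] H) :
    LinearMap.lTensor _ (counit ∘ₗ bosonProj L.toYDBialgebra) (inPair r s t) =
      ε s • ((r ⊗ₜ[k] TensorProduct.rid k H (LinearMap.lTensor H counit t)) ⊗ₜ[k] 1) := by
  induction t using TensorProduct.induction_on with
  | zero => simp
  | tmul y z =>
    have e : ∀ (c : k) (w : R ⊗[k] H), w ⊗ₜ[k] c = c • (w ⊗ₜ[k] (1 : k)) := fun c w => by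
      rw [← tmul_smul, smul_eq_mul, mul_one]
    rw [inPair, TensorProduct.map_tmul, LinearMap.lTensor_tmul, e]
    simp [bosonProj, toYDBialgebra, ← smul_tmul', smul_smul, tmul_smul]
  | add y z hy hz => simp only [map_add, hy, hz, tmul_add, add_tmul, smul_add]

/-- The bosonization of the quantum line as a coalgebra. -/
abbrev bosonCoalgebra : Coalgebra k (R ⊗[k] H) where
  comul := bosonComul L.toYDBialgebra
  counit := counit ∘ₗ bosonProj L.toYDBialgebra
  coassoc := L.bosonComul_coassoc
  rTensor_counit_comp_comul := L.ext_right fun n h => by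
    have key := L.sum_counit_left n fun i j => (1 : k) ⊗ₜ[k] (x j ⊗ₜ[k]
      hitL (omR (powGL γ i) (powGL γ j))⁻¹.val h)
    simp only [LinearMap.comp_apply, L.bosonComul_apply, map_sum, map_smul,
      L.bosonCounit_inPair_left, lid_counit_mulComul, smul_smul]
    exact key.trans (by simp [powGL])
  lTensor_counit_comp_comul := L.ext_right fun n h => by
    have key := L.sum_counit_right n fun i j => (x i ⊗ₜ[k]
      ((powGL γ j).val * hitL (omR (powGL γ i) (powGL γ j))⁻¹.val h)) ⊗ₜ[k] (1 : k)
    simp only [LinearMap.comp_apply, L.bosonComul_apply, map_sum, map_smul,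
      L.bosonCounit_inPair_right, rid_counit_mulComul, smul_smul]
    exact key.trans (by simp [powGL])

lemma isSubcoalgebra_range :
    letI := L.bosonCoalgebra
    IsSubcoalgebra k (R ⊗[k] H) (LinearMap.range (TensorProduct.mk k R H (x 0))) := by
  rintro _ ⟨h, rfl⟩
  have e : inPair (H := H) (x 0) (x 0) =
      TensorProduct.map (LinearMap.range (TensorProduct.mk k R H (x 0))).subtype
        (LinearMap.range (TensorProduct.mk k R H (x 0))).subtype ∘ₗ
      TensorProduct.map (TensorProduct.mk k R H (x 0)).rangeRestrict
        (TensorProduct.mk k R H (x 0)).rangeRestrict := by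
    rw [← TensorProduct.map_comp]
    rfl
  have h₁ := L.bosonComul_apply 0 h
  rw [Finset.Nat.antidiagonal_zero, Finset.sum_singleton, e] at h₁
  exact h₁ ▸ Submodule.smul_mem _ _ ⟨_, rfl⟩

lemma exists_eq_sum {N : ℕ} (hN : ∀ n, N ≤ n → x n = 0) (d : R ⊗[k] H) :
    ∃ h : ℕ → H, d = ∑ n ∈ Finset.range N, x n ⊗ₜ[k] h n := by
  have hd : d ∈ Submodule.span k (Set.range fun p : ℕ × H => x p.1 ⊗ₜ[k] (id p.2 : H)) := by
    rw [span_range_tmul L.span_eq_top span_range_id]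
    exact Submodule.mem_top
  induction hd using Submodule.span_induction with
  | mem _ hx =>
    obtain ⟨⟨n, h⟩, rfl⟩ := hx
    by_cases hn : n < N
    · refine ⟨Pi.single n h, ?_⟩
      rw [Finset.sum_eq_single_of_mem n (Finset.mem_range.mpr hn)]
      · simp
      · intro m _ hm
        simp [Pi.single_eq_of_ne hm]
    · exact ⟨0, by simp [hN n (not_lt.mp hn)]⟩
  | zero => exact ⟨0, by simp⟩
  | add _ _ _ _ h₁ h₂ =>
    obtain ⟨⟨h, rfl⟩, ⟨h', rfl⟩⟩ := And.intro h₁ h₂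
    exact ⟨h + h', by simp [tmul_add, Finset.sum_add_distrib]⟩
  | smul s _ _ h₁ =>
    obtain ⟨h, rfl⟩ := h₁
    exact ⟨s • h, by simp [tmul_smul, Finset.smul_sum]⟩

/-- If `ξ` is dual to `x m`, then `ξ ⊗ ε` lowers the degree by `m`. -/
lemma hitL_dual {ξ : R →ₗ[k] k} {m : ℕ} (hξ : ∀ n, ξ (x n) = if n = m then 1 else 0) {n : ℕ}
    (hn : n ≤ m) (h : H) :
    letI := L.bosonCoalgebra
    hitL (toConv (LinearMap.mul' k k ∘ₗ TensorProduct.map ξ counit)) (x n ⊗ₜ[k] h) =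
      if n = m then x 0 ⊗ₜ[k] h else 0 := by
  let _ := L.bosonCoalgebra
  have e : ∀ (r s : R) (t : H ⊗[k] H), TensorProduct.lid k (R ⊗[k] H) (LinearMap.rTensor _
      (LinearMap.mul' k k ∘ₗ TensorProduct.map ξ counit) (inPair r s t)) =
      ξ r • (s ⊗ₜ[k] TensorProduct.lid k H (LinearMap.rTensor H counit t)) := fun r s t => by
    induction t using TensorProduct.induction_on with
    | zero => simp
    | tmul y z => simp [inPair, smul_smul, tmul_smul]
    | add y z hy hz => simp only [map_add, hy, hz, tmul_add, smul_add]
  have h₁ : comul (R := k) (x n ⊗ₜ[k] h) = _ := L.bosonComul_apply n h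
  rw [hitL, LinearMap.comp_apply, LinearMap.comp_apply, h₁]
  simp only [LinearEquiv.coe_coe, map_sum, map_smul, e, lid_counit_mulComul, hξ]
  split_ifs with hnm
  · subst hnm
    rw [Finset.sum_eq_single (n, 0)]
    · simp [qBinom_self, powGL]
    · rintro ⟨i, j⟩ hp hne
      have : i ≠ n := by
        rintro rfl
        simp_all
      simp [this]
    · simp
  · refine Finset.sum_eq_zero fun p hp => ?_
    have : p.1 ≠ m := by
      have := mem_antidiagonal.mp hp
      omega
    simp [this]

lemma coradical_le_range {N : ℕ} (hN : ∀ n, N ≤ n → x n = 0)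
    (hdual : ∀ n < N, ∃ ξ : R →ₗ[k] k, ∀ m, ξ (x m) = if m = n then 1 else 0) :
    letI := L.bosonCoalgebra
    coradical k (R ⊗[k] H) ≤ LinearMap.range (TensorProduct.mk k R H (x 0)) := by
  let _ := L.bosonCoalgebra
  -- It suffices to find a nonzero element of `D` of the form `x 0 ⊗ h`.
  refine coradical_le L.isSubcoalgebra_range fun D hD hne => ?_
  obtain ⟨d, hdD, hd⟩ := (Submodule.ne_bot_iff D).mp hne
  obtain ⟨h, rfl⟩ := L.exists_eq_sum hN d
  -- Induction on a bound `M` for the degrees; `hdual` needs `M ≤ N`.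
  obtain ⟨M, hM⟩ : ∃ M, M = N := ⟨N, rfl⟩
  rw [← hM] at hdD hd
  have hMN := hM.le
  clear hM
  induction M with
  | zero => simp at hd
  | succ M ih =>
    by_cases hh : x M ⊗ₜ[k] h M = 0
    · rw [Finset.sum_range_succ, hh, add_zero] at hdD hd
      exact ih hd hdD (by omega)
    · -- Contraction with `ξ ⊗ ε` kills all terms but the one of top degree.
      obtain ⟨ξ, hξ⟩ := hdual M (by omega)
      have key := hitL_mem hD (toConv (LinearMap.mul' k k ∘ₗ TensorProduct.map ξ counit)) hdD
      rw [map_sum, Finset.sum_range_succ, L.hitL_dual hξ le_rfl, if_pos rfl,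
        Finset.sum_eq_zero, zero_add] at key
      · refine (Submodule.ne_bot_iff _).mpr ⟨_, ⟨key, h M, rfl⟩, fun h₀ => hh ?_⟩
        have := congrArg (bosonProj L.toYDBialgebra) h₀
        have h₁ : h M = 0 := by
          simpa [bosonProj, toYDBialgebra, L.counit_apply] using this
        rw [h₁, tmul_zero]
      · intro n hn
        have := Finset.mem_range.mp hn
        rw [L.hitL_dual hξ (by omega), if_neg (by omega)]

end IsQuantumLine

end Bosonization

/-! ### Existence of the quantum line -/

section Existence

open Finset.HasAntidiagonal (antidiagonal mem_antidiagonal)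

variable {k : Type u} [Field k] {N : ℕ}

/-- The standard basis of `kᴺ`, continued by `0` to all of `ℕ`. -/
def stdVec (k : Type u) [Field k] (N n : ℕ) : Fin N → k := fun i => if i.val = n then 1 else 0

lemma stdVec_eq_zero {n : ℕ} (hn : N ≤ n) : stdVec k N n = 0 :=
  funext fun i => if_neg (by omega)

lemma basisFun_eq_stdVec (n : Fin N) : Pi.basisFun k (Fin N) n = stdVec k N n := by
  funext i
  simp [stdVec, Pi.single_apply, Fin.ext_iff]

lemma span_range_stdVec : Submodule.span k (Set.range (stdVec k N)) = ⊤ := by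
  refine top_le_iff.mp ((Pi.basisFun k (Fin N)).span_eq.symm.le.trans (Submodule.span_mono ?_))
  rintro _ ⟨n, rfl⟩
  exact ⟨n, (basisFun_eq_stdVec n).symm⟩

variable {M : Type*} [AddCommGroup M] [Module k M]

/-- The linear map on `kᴺ` taking the values `F n` on the standard basis. -/
def extend (F : ℕ → M) : (Fin N → k) →ₗ[k] M := Fintype.linearCombination k fun i : Fin N => F i

lemma extend_stdVec (F : ℕ → M) {n : ℕ} (hn : n < N) : extend F (stdVec k N n) = F n := by
  rw [extend, Fintype.linearCombination_apply,
    Finset.sum_eq_single_of_mem (⟨n, hn⟩ : Fin N) (Finset.mem_univ _)]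
  · simp [stdVec]
  · intro i _ hi
    have : i.val ≠ n := fun e => hi (Fin.ext e)
    simp [stdVec, this]

lemma extend_stdVec_of_eq_zero {F : ℕ → M} (hF : ∀ n, N ≤ n → F n = 0) (n : ℕ) :
    extend F (stdVec k N n) = F n := by
  rcases lt_or_ge n N with hn | hn
  · exact extend_stdVec F hn
  · rw [stdVec_eq_zero hn, map_zero, hF n hn]

variable {H : Type v} [NonAssocRing H] [Module k H] [SMulCommClass k H H] [IsScalarTower k H H]
  [Coalgebra k H] [DualQuasiBialgebra k H]

/-- At a primitive `N`-th root of unity the quantum line is truncated at `N`: the comultiplication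
formula is consistent with `x n = 0` for `n ≥ N` because the inner `q`-binomial coefficients
vanish. -/
lemma isQuantumLine_stdVec {γ : GroupLike k H} {χ : WithConv (H →ₗ[k] k)} {q : k}
    (hχ : IsYDCharacter γ χ) (hq : χ γ.val = q) (hq1 : q ≠ 1) (hN : 0 < N)
    (hprim : IsPrimitiveRoot q N) :
    IsQuantumLine γ χ q (stdVec k N)
      (extend fun n => (powGL γ n).val ⊗ₜ[k] stdVec k N n)
      (TensorProduct.lift (LinearMap.flip (extend fun n =>
        (powChar γ χ n).ofConv.smulRight (stdVec k N n))))
      (TensorProduct.lift (extend fun a => extend fun b =>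
        (cochain γ a b)⁻¹ • stdVec k N (a + b)))
      (extend fun n => ∑ p ∈ antidiagonal n,
        (qBinom q n p.1 * cochain γ p.1 p.2) • (stdVec k N p.1 ⊗ₜ[k] stdVec k N p.2))
      (extend fun n => if n = 0 then 1 else 0) where
  character := hχ
  apply_self := hq
  span_eq_top := span_range_stdVec
  coact_apply := extend_stdVec_of_eq_zero fun n hn => by rw [stdVec_eq_zero hn, tmul_zero]
  act_apply n h := by
    rw [TensorProduct.lift.tmul, LinearMap.flip_apply, extend_stdVec_of_eq_zero]
    · rfl
    · intro n hn
      rw [stdVec_eq_zero hn, LinearMap.smulRight_zero]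
  mul_apply a b := by
    rw [TensorProduct.lift.tmul]
    rcases lt_or_ge a N with ha | ha
    · rw [extend_stdVec _ ha, extend_stdVec_of_eq_zero]
      intro b hb
      rw [stdVec_eq_zero (by omega), smul_zero]
    · rw [stdVec_eq_zero ha, stdVec_eq_zero (n := a + b) (by omega), map_zero, smul_zero,
        LinearMap.zero_apply]
  comul_apply := extend_stdVec_of_eq_zero fun n hn => Finset.sum_eq_zero fun p hp => by
    have hp := mem_antidiagonal.mp hp
    rcases lt_or_ge p.1 N with h₁ | h₁
    · rcases lt_or_ge p.2 N with h₂ | h₂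
      · rw [← hp, qBinom_eq_zero hprim hq1 h₁ h₂ (by omega), zero_mul, zero_smul]
      · rw [stdVec_eq_zero h₂, tmul_zero, smul_zero]
    · rw [stdVec_eq_zero h₁, zero_tmul, smul_zero]
  counit_apply := extend_stdVec_of_eq_zero fun n hn => if_neg (by omega)

end Existence

end QuantumLine

open QuantumLine

theorem mainTheorem1 {k : Type u} [Field k] [IsAlgClosed k] [CharZero k]
    {H : Type v} [NonAssocRing H] [Module k H] [SMulCommClass k H H] [IsScalarTower k H H]
    [Coalgebra k H] [DualQuasiBialgebra k H]
    (g : H) (χ : H →ₗ[k] k) (q : k) (N : ℕ)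
    (hdatum : IsQuasiYDDatum g χ) (hq : χ g = q) (hq1 : q ≠ 1)
    (hN : 0 < N) (hprim : IsPrimitiveRoot q N) :
    ∃ (R : Type u) (_ : AddCommGroup R) (_ : Module k R) (S : YDBialgebra k H R) (x : ℕ → R),
      -- `(x n)` for `0 ≤ n ≤ N - 1` is a basis of `R`
      (∃ b : Module.Basis (Fin N) k R, ∀ n : Fin N, b n = x n) ∧
      -- coaction and action
      (∀ n < N, S.coact (x n) = grpPow g n ⊗ₜ[k] x n) ∧
      (∀ n < N, ∀ h : H, S.act (h ⊗ₜ[k] x n) = chiN g χ n h • x n) ∧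
      -- unit and multiplication
      S.one = x 0 ∧
      (∀ a < N, ∀ b < N, S.mul (x a ⊗ₜ[k] x b) =
        if a + b ≤ N - 1 then
          (∏ i ∈ Finset.range a, omegaInv k H ((g ⊗ₜ[k] grpPow g i) ⊗ₜ[k] grpPow g b)) • x (a + b)
        else 0) ∧
      -- comultiplication and counit
      (∀ n < N, S.Δ (x n) =
        ∑ i ∈ Finset.range (n + 1), beta g q i n • (x i ⊗ₜ[k] x (n - i))) ∧
      (∀ n < N, S.ε (x n) = if n = 0 then 1 else 0) ∧
      -- the bosonization `B = R # H` is a coalgebra and `B₀ ⊆ k 1_R ⊗ H`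
      (∃ c : Coalgebra k (R ⊗[k] H),
        c.comul = (bosonization S).comul ∧ c.counit = (bosonization S).counit ∧
        coradical k (R ⊗[k] H) ≤ LinearMap.range (TensorProduct.mk k R H S.one)) := by
  let γ : GroupLike k H := ⟨g, hdatum.groupLike⟩
  have L := isQuantumLine_stdVec (γ := γ) (χ := WithConv.toConv χ) hdatum.isYDCharacter hq hq1 hN
    hprim
  have hγ : (powGL γ 1).val = g := congrArg GroupLike.val (mulGL_one γ)
  have hpow : ∀ n, (powGL γ n).val = grpPow g n := powGL_val γ
  refine ⟨Fin N → k, inferInstance, inferInstance, L.toYDBialgebra, stdVec k N,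
    ⟨Pi.basisFun k (Fin N), basisFun_eq_stdVec⟩, fun n _ => ?_, fun n _ h => ?_, rfl,
    fun a _ b _ => ?_, fun n _ => ?_, fun n _ => L.counit_apply n,
    L.bosonCoalgebra, rfl, rfl, ?_⟩
  · rw [← hpow]
    exact L.coact_apply n
  · refine (L.act_apply n h).trans ?_
    rw [powChar_eq_chiN]
  · refine (L.mul_apply a b).trans ?_
    split_ifs with hab
    · simp only [← hpow, cochain, ← Finset.prod_inv_distrib, ← omegaInv_powGL, hγ]
    · rw [stdVec_eq_zero (by omega), smul_zero]
  · refine (L.comul_apply n).trans ?_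
    rw [Finset.Nat.sum_antidiagonal_eq_sum_range_succ_mk]
    simp only [beta, ← hpow, cochain, powOmega, hγ]
  · exact L.coradical_le_range (fun n => stdVec_eq_zero) fun n hn =>
      ⟨LinearMap.proj ⟨n, hn⟩, fun m => if_congr eq_comm rfl rfl⟩
end
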